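/- Let $V$ be a simple vertex operator algebra over $\mathbb{C}$ (with finite-dimensional weight spaces $V_d$, i.e. the $L_0$-eigenspaces, $V=\bigoplus_{d\ge -t}V_d$) of CFT type, meaning $V_d=0$ for $d<0$ and $V_0=\mathbb{C}\mathbf 1$. Write $a_{(n)}b$ for the $n$-th product. Let $T^2(V)=V\otimes V$ be the tensor product vertex operator algebra, with $n$-th products $(a\otimes b)_{(n)}(c\otimes d)=\sum_{i\in\mathbb{Z}}a_{(i)}c\otimes b_{(n-1-i)}d$, let $T^2(V)^{S_2}$ be its subalgebra of vectors fixed by the transposition $a\otimes b\mapsto b\otimes a$, and let $C_2(T^2(V)^{S_2})$ be the linear span of all $u_{(-2)}v$ with $u,v\in T^2(V)^{S_2}$. For $a\in V$ let $$\overline{\eta}(a)=(a\otimes\mathbf 1+\mathbf 1\otimes a)+C_2(T^2(V)^{S_2})\in T^2(V)^{S_2}/C_2(T^2(V)^{S_2}).$$ Then for every $r\ge 0$ and all $x^1,\dots,x^r\in V_1$ there is an integer $N\ge 0$ such that $$\overline{\eta}\bigl(x^1_{(-m_1)}\cdots x^r_{(-m_r)}\mathbf 1\bigr)=0$$ for all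 positive integers $m_1,\dots,m_r$ with $m_1+\cdots+m_r\ge N$. -/

import Mathlib

open scoped TensorProduct

/-- A vertex operator algebra structure on a complex vector space `V`, given by the `n`-th products
`a_(n) b = nth n a b`, the vacuum vector and the Virasoro vector. All infinite sums in the Borcherds
identity have finite support by `truncation`. -/
structure VertexOperatorAlgebra (V : Type*) [AddCommGroup V] [Module ℂ V] where
  /-- `nth n a b` is the `n`-th product `a_(n) b`. -/
  nth : ℤ → V →ₗ[ℂ] V →ₗ[ℂ] V
  /-- the vacuum vector -/
  vac : V
  /-- the Virasoro vector; its modes are `L_n = nth (n + 1) omega` -/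
  omega : V
  /-- the central charge -/
  centralCharge : ℂ
  truncation : ∀ a b : V, ∃ N : ℤ, ∀ n : ℤ, N ≤ n → nth n a b = 0
  vac_nth : ∀ (n : ℤ) (b : V), nth n vac b = if n = -1 then b else 0
  nth_neg_one_vac : ∀ a : V, nth (-1) a vac = a
  nth_vac : ∀ (a : V) (n : ℤ), 0 ≤ n → nth n a vac = 0
  borcherds : ∀ (a b c : V) (p q r : ℤ),
    ∑ᶠ i : ℕ, (Ring.choose p i : ℤ) • nth (p + q - i) (nth (r + i) a b) c =
      ∑ᶠ i : ℕ, ((-1 : ℤ) ^ i * Ring.choose r i) •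
        (nth (p + r - i) a (nth (q + i) b c) -
          ((-1 : ℂ) ^ r) • nth (q + r - i) b (nth (p + i) a c))
  virasoro : ∀ (m n : ℤ) (v : V),
    nth (m + 1) omega (nth (n + 1) omega v) - nth (n + 1) omega (nth (m + 1) omega v) =
      ((m : ℂ) - n) • nth (m + n + 1) omega v +
        (if m + n = 0 then (((m : ℂ) ^ 3 - m) / 12 * centralCharge) • v else 0)
  /-- `L_{-1} a = a_(-2) 1` -/
  translation : ∀ a : V, nth 0 omega a = nth (-2) a vac
  /-- `V` is the (automatically direct) sum of the eigenspaces of `L_0` for integral eigenvalues. -/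
  iSup_eigenspace : ⨆ d : ℤ, Module.End.eigenspace (nth 1 omega) (d : ℂ) = ⊤
  finiteDimensional_eigenspace : ∀ d : ℤ,
    FiniteDimensional ℂ (Module.End.eigenspace (nth 1 omega) (d : ℂ))
  eigenspace_eq_bot : ∃ t : ℕ, ∀ d : ℤ, d < -(t : ℤ) →
    Module.End.eigenspace (nth 1 omega) (d : ℂ) = ⊥

namespace VertexOperatorAlgebra

variable {V : Type*} [AddCommGroup V] [Module ℂ V] (A : VertexOperatorAlgebra V)

/-- The weight space `V_d`, the eigenspace of `L_0 = omega_(1)` of eigenvalue `d`. -/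
def weightSpace (d : ℤ) : Submodule ℂ V := Module.End.eigenspace (A.nth 1 A.omega) (d : ℂ)

/-- CFT type: `V_d = 0` for `d < 0` and `V_0 = ℂ 1`. -/
def IsCFTType : Prop :=
  (∀ d : ℤ, d < 0 → A.weightSpace d = ⊥) ∧ A.weightSpace 0 = Submodule.span ℂ {A.vac}

/-- A (two-sided) ideal of the vertex operator algebra. -/
def IsIdeal (I : Submodule ℂ V) : Prop :=
  ∀ (n : ℤ) (a v : V), v ∈ I → A.nth n a v ∈ I ∧ A.nth n v a ∈ I

/-- Simplicity: `V ≠ 0` and the only ideals are `0` and `V`. -/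
def IsSimple : Prop :=
  Nontrivial V ∧ ∀ I : Submodule ℂ V, A.IsIdeal I → I = ⊥ ∨ I = ⊤

/-- The iterated product `x^1_(-m_1) (x^2_(-m_2) (⋯ (x^r_(-m_r) 1)))`; it is `1` for `r = 0`. -/
def monomial {r : ℕ} (x : Fin r → V) (m : Fin r → ℕ) : V :=
  (List.ofFn fun i => (x i, m i)).foldr (fun p v => A.nth (-(p.2 : ℤ)) p.1 v) A.vac

/-- The bilinear map with `(a ⊗ b, c ⊗ d) ↦ a_(i) c ⊗ b_(n - 1 - i) d`. -/
def tensorTerm (n i : ℤ) : V ⊗[ℂ] V →ₗ[ℂ] V ⊗[ℂ] V →ₗ[ℂ] V ⊗[ℂ] V :=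
  TensorProduct.map₂ (A.nth i) (A.nth (n - 1 - i))

theorem tensorTerm_tmul (n i : ℤ) (a b c d : V) :
    A.tensorTerm n i (a ⊗ₜ b) (c ⊗ₜ d) = A.nth i a c ⊗ₜ A.nth (n - 1 - i) b d := by
  simp [tensorTerm]

theorem tensorTerm_support_finite (n : ℤ) (s t : V ⊗[ℂ] V) :
    (Function.support fun i : ℤ => A.tensorTerm n i s t).Finite := by
  induction s using TensorProduct.induction_on with
  | zero => simp
  | add s₁ s₂ h₁ h₂ =>
    refine (h₁.union h₂).subset ?_
    simp only [map_add, LinearMap.add_apply]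
    exact Function.support_add _ _
  | tmul a b =>
    induction t using TensorProduct.induction_on with
    | zero => simp
    | add t₁ t₂ h₁ h₂ =>
      refine (h₁.union h₂).subset ?_
      simp only [map_add]
      exact Function.support_add _ _
    | tmul c d =>
      obtain ⟨N, hN⟩ := A.truncation a c
      obtain ⟨M, hM⟩ := A.truncation b d
      refine (Set.finite_Icc (n - M) N).subset fun i hi => ?_
      rw [Function.mem_support, tensorTerm_tmul] at hi
      constructor
      · by_contra h
        exact hi (by rw [hM (n - 1 - i) (by lia), TensorProduct.tmul_zero])
      · by_contra h
        exact hi (by rw [hN i (by lia), TensorProduct.zero_tmul])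

/-- The `n`-th product of the tensor product vertex operator algebra `T^2(V) = V ⊗ V`:
`(a ⊗ b)_(n) (c ⊗ d) = ∑_{i ∈ ℤ} a_(i) c ⊗ b_(n - 1 - i) d`, a finite sum. -/
noncomputable def tensorNth (n : ℤ) : V ⊗[ℂ] V →ₗ[ℂ] V ⊗[ℂ] V →ₗ[ℂ] V ⊗[ℂ] V :=
  LinearMap.mk₂ ℂ (fun s t => ∑ᶠ i : ℤ, A.tensorTerm n i s t)
    (fun s₁ s₂ t => by
      simp only [map_add, LinearMap.add_apply]
      exact finsum_add_distrib (A.tensorTerm_support_finite n s₁ t)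
        (A.tensorTerm_support_finite n s₂ t))
    (fun c s t => by
      simp only [map_smul, LinearMap.smul_apply]
      exact (smul_finsum' c (A.tensorTerm_support_finite n s t)).symm)
    (fun s t₁ t₂ => by
      simp only [map_add]
      exact finsum_add_distrib (A.tensorTerm_support_finite n s t₁)
        (A.tensorTerm_support_finite n s t₂))
    (fun c s t => by
      simp only [map_smul]
      exact (smul_finsum' c (A.tensorTerm_support_finite n s t)).symm)

theorem tensorNth_apply (n : ℤ) (s t : V ⊗[ℂ] V) :
    A.tensorNth n s t = ∑ᶠ i : ℤ, A.tensorTerm n i s t := rfl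

theorem comm_tensorTerm (n i : ℤ) (s t : V ⊗[ℂ] V) :
    TensorProduct.comm ℂ V V (A.tensorTerm n i s t) =
      A.tensorTerm n (n - 1 - i) (TensorProduct.comm ℂ V V s) (TensorProduct.comm ℂ V V t) := by
  induction s using TensorProduct.induction_on with
  | zero => simp
  | add s₁ s₂ h₁ h₂ => simp only [map_add, LinearMap.add_apply, h₁, h₂]
  | tmul a b =>
    induction t using TensorProduct.induction_on with
    | zero => simp
    | add t₁ t₂ h₁ h₂ => simp only [map_add, h₁, h₂]
    | tmul c d => simp [tensorTerm_tmul]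

theorem comm_tensorNth (n : ℤ) (s t : V ⊗[ℂ] V) :
    TensorProduct.comm ℂ V V (A.tensorNth n s t) =
      A.tensorNth n (TensorProduct.comm ℂ V V s) (TensorProduct.comm ℂ V V t) := by
  rw [tensorNth_apply, tensorNth_apply,
    ← finsum_comp_equiv (Equiv.subLeft (n - 1))
      (f := fun i => A.tensorTerm n i (TensorProduct.comm ℂ V V s) (TensorProduct.comm ℂ V V t))]
  have h := (TensorProduct.comm ℂ V V).toLinearMap.toAddMonoidHom.map_finsum
    (A.tensorTerm_support_finite n s t)
  exact h.trans (finsum_congr fun i => A.comm_tensorTerm n i s t)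

variable (V) in
/-- The underlying space of the permutation orbifold model `T^2(V)^{S_2}`: the vectors of `V ⊗ V`
fixed by the transposition `a ⊗ b ↦ b ⊗ a`. -/
def orbifold : Submodule ℂ (V ⊗[ℂ] V) :=
  LinearMap.eqLocus (TensorProduct.comm ℂ V V).toLinearMap LinearMap.id

theorem mem_orbifold (s : V ⊗[ℂ] V) :
    s ∈ orbifold V ↔ TensorProduct.comm ℂ V V s = s := Iff.rfl

/-- The `n`-th product of `T^2(V)^{S_2}`, the restriction of that of `T^2(V)`. -/
noncomputable def orbifoldNth (n : ℤ) : orbifold V →ₗ[ℂ] orbifold V →ₗ[ℂ] orbifold V :=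
  LinearMap.mk₂ ℂ
    (fun s t => ⟨A.tensorNth n s t, by
      rw [mem_orbifold, comm_tensorNth, (mem_orbifold _).1 s.2, (mem_orbifold _).1 t.2]⟩)
    (fun _ _ _ => by ext; simp) (fun _ _ _ => by ext; simp)
    (fun _ _ _ => by ext; simp) (fun _ _ _ => by ext; simp)

/-- `C_2(T^2(V)^{S_2})`, the span of all `a_(-2) b` with `a, b ∈ T^2(V)^{S_2}`. -/
def orbifoldC2 : Submodule ℂ (orbifold V) :=
  Submodule.span ℂ {v | ∃ a b : orbifold V, v = A.orbifoldNth (-2) a b}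

/-- `η(a) = a ⊗ 1 + 1 ⊗ a`, as a linear map from `V` to `T^2(V)^{S_2}`. -/
noncomputable def eta : V →ₗ[ℂ] orbifold V where
  toFun a := ⟨a ⊗ₜ A.vac + A.vac ⊗ₜ a, by
    rw [mem_orbifold, map_add, TensorProduct.comm_tmul, TensorProduct.comm_tmul, add_comm]⟩
  map_add' a b := by
    ext
    simp only [TensorProduct.add_tmul, TensorProduct.tmul_add, Submodule.coe_add]
    abel
  map_smul' c a := by
    ext
    simp [TensorProduct.smul_tmul']

/-- `η̄(a) = η(a) + C_2(T^2(V)^{S_2})` in `T^2(V)^{S_2} / C_2(T^2(V)^{S_2})`. -/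
noncomputable def etaBar : V →ₗ[ℂ] orbifold V ⧸ A.orbifoldC2 :=
  A.orbifoldC2.mkQ ∘ₗ A.eta

end VertexOperatorAlgebra

namespace VertexOperatorAlgebra

variable {V : Type*} [AddCommGroup V] [Module ℂ V] (A : VertexOperatorAlgebra V)

/-! ### Consequences of the Borcherds identity -/

/-! Write D⁺f = f⊗1 + 1⊗f and D⁻f = f⊗1 − 1⊗f (`diagAdd`, `diagSub`), and ⟨e⟩ for the class of e +
σe modulo C_2 (`coinv`), so that ⟨a⊗1⟩ = η̄(a). Since η(c)_(n) is the operator D⁺c_(n), the bracket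
kills D⁺c_(n)e for n ≤ -2, and it also kills D⁺L_{-1}e. Moreover a⊗b + b⊗a is fixed by σ, and its
modes are half the normally ordered D⁺aD⁺b minus half the normally ordered D⁻aD⁻b. The first part
dies under the bracket, so the modes n ≤ -2 of the normally ordered product of D⁻a and D⁻b vanish as
well (`coinv_normalOrder`).

For x, y of weight one this bounds the two-point functions ⟨D⁻x_(-M) D⁻y_(-1) 1⟩. The vanishing is
applied to the pairs (ω, ω), (L_{-1}ω, L_{-1}ω), (ω, x_(-1-α)1) and (L_{-1}ω, x_(-1-α)1), acting on
D⁻x_(-α-1) D⁻y_(-1) 1 or D⁻L_{-q} D⁻y_(-1) 1. CFT type makes the commutators explicit, so everything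
reduces to four-point functions of L, L, x, y with creating modes, and to two-point functions. There
are more relations than four-point functions. Eliminating the latter leaves one linear relation
between ⟨x_(-M) y_(-1)⟩ and ⟨L_{-M} w_(-1)⟩, with w = x_(0)y (`relation_even`, `relation_even'`,
`relation_odd`). For M even two such relations are available; for M odd the relation is combined
with the one for x and y exchanged. In both cases the w term drops out and the two-point function is
zero for M ≥ 9 (`pt₂_eq_zero`). Unfolded, this says η̄(x_(m) y_(-1-j) 1) = 0 for m ≤ -9
(`etaBar_nth_nth_vac`).

Longer words go by induction on the length s, for words whose modes sum to at most -(9s+1). This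
class is stable under the shortening of words by commutators, so modulo shorter words all letters
commute. A nonnegative mode may be moved to the vacuum; otherwise some mode m is at most -10 and may
be moved to the front. With c = x_(m) y_(-1-j) 1 and the word x_(m) y_(-1-j) v, the equality η̄(c) =
0 lets η̄ of the word be computed both as -⟨c⊗v⟩ and, after exchanging x and y, as +⟨c⊗v⟩; hence it
is zero (`etaBar_word`). -/

theorem neg_one_pow_mul_choose_neg (r : ℤ) (i : ℕ) :
    (-1 : ℤ) ^ i * Ring.choose (-r) i = Ring.multichoose r i := by
  rw [Ring.choose_neg', Units.smul_def, Int.coe_negOnePow_natCast, smul_eq_mul, ← mul_assoc,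
    ← mul_pow]
  simp

theorem nth_comm_finsum (a b c : V) (p q : ℤ) :
    A.nth p a (A.nth q b c) - A.nth q b (A.nth p a c) =
      ∑ᶠ i : ℕ, (Ring.choose p i : ℤ) • A.nth (p + q - i) (A.nth i a b) c := by
  have h := A.borcherds a b c p q 0
  rw [finsum_eq_single (fun i : ℕ => ((-1 : ℤ) ^ i * Ring.choose 0 i) • _) 0
    (fun i hi => by rw [Ring.choose_zero_pos ℤ (Nat.pos_of_ne_zero hi), mul_zero, zero_smul])] at h
  simpa using h.symm

theorem nth_assoc_finsum (a b c : V) (q r : ℤ) :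
    A.nth q (A.nth r a b) c = ∑ᶠ i : ℕ, ((-1 : ℤ) ^ i * Ring.choose r i) •
      (A.nth (r - i) a (A.nth (q + i) b c) -
        ((-1 : ℂ) ^ r) • A.nth (q + r - i) b (A.nth i a c)) := by
  have h := A.borcherds a b c 0 q r
  rw [finsum_eq_single (fun i : ℕ => (Ring.choose (0 : ℤ) i : ℤ) • _) 0
    (fun i hi => by rw [Ring.choose_zero_pos ℤ (Nat.pos_of_ne_zero hi), zero_smul])] at h
  simpa using h

theorem nth_comm_sum {a b : V} {M : ℕ} (hM : ∀ i : ℕ, M ≤ i → A.nth i a b = 0) (c : V) (p q : ℤ) :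
    A.nth p a (A.nth q b c) - A.nth q b (A.nth p a c) =
      ∑ i ∈ Finset.range M, (Ring.choose p i : ℤ) • A.nth (p + q - i) (A.nth i a b) c := by
  rw [nth_comm_finsum]
  refine finsum_eq_sum_of_support_subset _ fun i hi => ?_
  by_contra h
  refine hi ?_
  dsimp only
  rw [hM i (by simpa using h)]
  simp

theorem exists_nth_eq_zero (a b : V) : ∃ M : ℕ, ∀ n : ℤ, M ≤ n → A.nth n a b = 0 := by
  obtain ⟨N, hN⟩ := A.truncation a b
  exact ⟨N.toNat, fun n hn => hN n (by lia)⟩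

/-- `(L_{-1} a)_(n) = -n a_(n-1)`. -/
theorem nth_translation (a : V) (n : ℤ) :
    A.nth n (A.nth 0 A.omega a) = (-n : ℂ) • A.nth (n - 1) a := by
  ext c
  rw [translation, nth_assoc_finsum]
  simp only [vac_nth, neg_one_pow_mul_choose_neg, Ring.multichoose_two]
  -- The only nonzero mode of the vacuum is the one of index -1. It selects one term of the first
  -- half when n < 0, one of the second half when n > 0, and none when n = 0.
  rcases lt_or_ge n 0 with hn | hn
  · rw [finsum_eq_single _ (-1 - n).toNat]
    · have e : (((-1 - n).toNat : ℕ) : ℤ) = -1 - n := by lia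
      rw [e, if_pos (by ring), if_neg (by lia)]
      simp only [smul_zero, sub_zero, LinearMap.smul_apply]
      rw [← Int.cast_smul_eq_zsmul ℂ]
      congr 2 <;> [(push_cast; ring); ring_nf]
    · intro i hi
      rw [if_neg (by lia), if_neg (by lia)]
      simp
  · rcases hn.eq_or_lt with rfl | hn
    · rw [finsum_eq_zero_of_forall_eq_zero]
      · simp
      · intro i
        rw [if_neg (by lia), if_neg (by lia)]
        simp
    · rw [finsum_eq_single _ (n - 1).toNat]
      · have e : (((n - 1).toNat : ℕ) : ℤ) = n - 1 := by lia
        rw [e, if_neg (by lia), if_pos (by lia)]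
        simp only [map_zero, zero_sub, LinearMap.smul_apply]
        rw [← Int.cast_smul_eq_zsmul ℂ, smul_neg, smul_smul, ← neg_smul]
        congr 2
        norm_num [zpow_neg]
      · intro i hi
        rw [if_neg (by lia), if_neg (by lia)]
        simp

/-! ### The diagonal and antidiagonal actions on `V ⊗ V` -/

section Diag

/-- `f ↦ f ⊗ 1 + 1 ⊗ f`. -/
noncomputable def diagAdd : Module.End ℂ V →ₗ[ℂ] Module.End ℂ (V ⊗[ℂ] V) :=
  LinearMap.rTensorHom V + LinearMap.lTensorHom V

/-- `f ↦ f ⊗ 1 - 1 ⊗ f`. -/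
noncomputable def diagSub : Module.End ℂ V →ₗ[ℂ] Module.End ℂ (V ⊗[ℂ] V) :=
  LinearMap.rTensorHom V - LinearMap.lTensorHom V

variable (f g : Module.End ℂ V)

@[simp] theorem diagAdd_tmul (a b : V) : diagAdd f (a ⊗ₜ[ℂ] b) = f a ⊗ₜ b + a ⊗ₜ f b := rfl

@[simp] theorem diagSub_tmul (a b : V) : diagSub f (a ⊗ₜ[ℂ] b) = f a ⊗ₜ b - a ⊗ₜ f b := rfl

theorem diagAdd_one (e : V ⊗[ℂ] V) : diagAdd (1 : Module.End ℂ V) e = (2 : ℂ) • e := by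
  induction e using TensorProduct.induction_on with
  | zero => simp
  | add x y hx hy => rw [map_add, hx, hy, smul_add]
  | tmul a b => simp [two_smul]

theorem diagSub_one (e : V ⊗[ℂ] V) : diagSub (1 : Module.End ℂ V) e = 0 := by
  induction e using TensorProduct.induction_on with
  | zero => simp
  | add x y hx hy => rw [map_add, hx, hy, add_zero]
  | tmul a b => simp

/-- Diagonal and antidiagonal operators are the even and odd parts, under exchange of the factors,
of the Lie algebra generated by f⊗1 and 1⊗f. Hence the four bracket rules below; in particular two
antidiagonal operators commute to a diagonal one. -/
theorem diagAdd_diagAdd (e : V ⊗[ℂ] V) :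
    diagAdd f (diagAdd g e) = diagAdd g (diagAdd f e) + diagAdd (f * g - g * f) e := by
  induction e using TensorProduct.induction_on with
  | zero => simp
  | add x y hx hy => simp only [map_add, hx, hy]; abel
  | tmul a b =>
    simp only [diagAdd_tmul, map_add, Module.End.mul_apply, LinearMap.sub_apply,
      TensorProduct.tmul_sub, TensorProduct.sub_tmul]
    abel

theorem diagAdd_diagSub (e : V ⊗[ℂ] V) :
    diagAdd f (diagSub g e) = diagSub g (diagAdd f e) + diagSub (f * g - g * f) e := by
  induction e using TensorProduct.induction_on with
  | zero => simp
  | add x y hx hy => simp only [map_add, hx, hy]; abel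
  | tmul a b =>
    simp only [diagAdd_tmul, diagSub_tmul, map_add, map_sub, Module.End.mul_apply,
      LinearMap.sub_apply]
    abel

theorem diagSub_diagAdd (e : V ⊗[ℂ] V) :
    diagSub f (diagAdd g e) = diagAdd g (diagSub f e) + diagSub (f * g - g * f) e := by
  rw [diagAdd_diagSub, add_assoc, ← LinearMap.add_apply, ← map_add]
  simp

theorem diagSub_diagSub (e : V ⊗[ℂ] V) :
    diagSub f (diagSub g e) = diagSub g (diagSub f e) + diagAdd (f * g - g * f) e := by
  induction e using TensorProduct.induction_on with
  | zero => simp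
  | add x y hx hy => simp only [map_add, hx, hy]; abel
  | tmul a b =>
    simp only [diagAdd_tmul, diagSub_tmul, map_sub, Module.End.mul_apply,
      LinearMap.sub_apply]
    abel

theorem comm_diagAdd (e : V ⊗[ℂ] V) :
    TensorProduct.comm ℂ V V (diagAdd f e) = diagAdd f (TensorProduct.comm ℂ V V e) := by
  induction e using TensorProduct.induction_on with
  | zero => simp
  | add x y hx hy => simp only [map_add, hx, hy]
  | tmul a b => simp [add_comm]

end Diag

/-! ### Products in `V ⊗ V` and in the orbifold -/

theorem tensorNth_tmul_tmul (n : ℤ) (a b c d : V) :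
    A.tensorNth n (a ⊗ₜ b) (c ⊗ₜ d) = ∑ᶠ i : ℤ, A.nth i a c ⊗ₜ[ℂ] A.nth (n - 1 - i) b d := by
  simp [tensorNth_apply, tensorTerm_tmul]

theorem tensorNth_tmul_vac (n : ℤ) (c : V) (e : V ⊗[ℂ] V) :
    A.tensorNth n (c ⊗ₜ A.vac) e = (A.nth n c).rTensor V e := by
  induction e using TensorProduct.induction_on with
  | zero => simp
  | add x y hx hy => simp only [map_add, hx, hy]
  | tmul a b =>
    rw [tensorNth_tmul_tmul, finsum_eq_single _ n]
    · simp [vac_nth]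
    · intro i hi
      rw [vac_nth, if_neg (by lia), TensorProduct.tmul_zero]

theorem tensorNth_vac_tmul (n : ℤ) (c : V) (e : V ⊗[ℂ] V) :
    A.tensorNth n (A.vac ⊗ₜ c) e = (A.nth n c).lTensor V e := by
  induction e using TensorProduct.induction_on with
  | zero => simp
  | add x y hx hy => simp only [map_add, hx, hy]
  | tmul a b =>
    rw [tensorNth_tmul_tmul, finsum_eq_single _ (-1)]
    · simp [vac_nth]
    · intro i hi
      rw [vac_nth, if_neg (by lia), TensorProduct.zero_tmul]

theorem tensorNth_eta (n : ℤ) (c : V) (e : V ⊗[ℂ] V) :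
    A.tensorNth n (c ⊗ₜ A.vac + A.vac ⊗ₜ c) e = diagAdd (A.nth n c) e := by
  rw [map_add, LinearMap.add_apply, tensorNth_tmul_vac, tensorNth_vac_tmul]
  rfl

theorem tensorNth_translation (n : ℤ) (u v : V ⊗[ℂ] V) :
    A.tensorNth n (diagAdd (A.nth 0 A.omega) u) v = (-n : ℂ) • A.tensorNth (n - 1) u v := by
  induction u using TensorProduct.induction_on with
  | zero => simp
  | add x y hx hy => simp only [map_add, LinearMap.add_apply, hx, hy, smul_add]
  | tmul a b =>
    induction v using TensorProduct.induction_on with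
    | zero => simp
    | add x y hx hy => simp only [map_add, hx, hy, smul_add]
    | tmul c d =>
      rw [diagAdd_tmul, map_add, LinearMap.add_apply, tensorNth_apply, tensorNth_apply,
        tensorNth_apply, ← finsum_comp_equiv (Equiv.addRight (1 : ℤ)),
        ← finsum_add_distrib, smul_finsum']
      -- After the shift of the first sum by one, both summands are multiples of the same term, with
      -- coefficients -(i+1) and -(n-1-i), which add up to -n.
      · refine finsum_congr fun i => ?_
        simp only [tensorTerm_tmul, nth_translation, Equiv.coe_addRight, LinearMap.smul_apply,
          ← TensorProduct.smul_tmul', TensorProduct.tmul_smul]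
        rw [show i + 1 - 1 = i by ring, show n - 1 - (i + 1) = n - 1 - 1 - i by ring,
          show n - 1 - i - 1 = n - 1 - 1 - i by ring, ← add_smul]
        congr 1
        push_cast
        ring
      · exact A.tensorTerm_support_finite _ _ _
      · exact (A.tensorTerm_support_finite n _ _).preimage (Equiv.injective _).injOn
      · exact A.tensorTerm_support_finite n _ _

/-- By induction downwards from -2: (L_{-1}u)_(-2-k) v is k+2 times u_(-3-k) v, and L_{-1}u is again
fixed by the transposition. -/
theorem orbifoldNth_mem_orbifoldC2 (u v : orbifold V) {n : ℤ} (hn : n ≤ -2) :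
    A.orbifoldNth n u v ∈ A.orbifoldC2 := by
  obtain ⟨k, rfl⟩ : ∃ k : ℕ, n = -2 - k := ⟨(-2 - n).toNat, by lia⟩
  clear hn
  induction k generalizing u with
  | zero => exact Submodule.subset_span ⟨u, v, by simp⟩
  | succ k ih =>
    have hu : diagAdd (A.nth 0 A.omega) (u : V ⊗[ℂ] V) ∈ orbifold V := by
      rw [mem_orbifold, comm_diagAdd, (mem_orbifold _).1 u.2]
    have h := ih ⟨_, hu⟩
    have h2 : A.orbifoldNth (-2 - (k : ℤ)) ⟨_, hu⟩ v =
        ((k : ℂ) + 2) • A.orbifoldNth (-2 - ((k + 1 : ℕ) : ℤ)) u v := by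
      apply Subtype.ext
      change A.tensorNth _ (diagAdd (A.nth 0 A.omega) (u : V ⊗[ℂ] V)) v = _
      rw [tensorNth_translation]
      change _ = ((k : ℂ) + 2) • A.tensorNth _ (u : V ⊗[ℂ] V) v
      rw [show (-2 - (k : ℤ) - 1) = -2 - ((k + 1 : ℕ) : ℤ) by push_cast; ring]
      congr 1
      push_cast
      ring
    rw [h2] at h
    exact (Submodule.smul_mem_iff _ (by norm_cast)).1 h

end VertexOperatorAlgebra

namespace VertexOperatorAlgebra

variable {V : Type*} [AddCommGroup V] [Module ℂ V] (A : VertexOperatorAlgebra V)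

/-! ### Coinvariants -/

variable (V) in
/-- `e ↦ e + σ e` with `σ` the transposition. -/
noncomputable def symmetrize : V ⊗[ℂ] V →ₗ[ℂ] orbifold V :=
  LinearMap.codRestrict _ (LinearMap.id + (TensorProduct.comm ℂ V V).toLinearMap) fun e => by
    rw [mem_orbifold]
    simp [add_comm]

theorem coe_symmetrize (e : V ⊗[ℂ] V) :
    (symmetrize V e : V ⊗[ℂ] V) = e + TensorProduct.comm ℂ V V e := rfl

/-- The class of `e + σ e` in `T^2(V)^{S_2} / C_2`. -/
noncomputable def coinv : V ⊗[ℂ] V →ₗ[ℂ] orbifold V ⧸ A.orbifoldC2 :=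
  A.orbifoldC2.mkQ ∘ₗ symmetrize V

theorem coinv_eq_zero_iff (e : V ⊗[ℂ] V) : A.coinv e = 0 ↔ symmetrize V e ∈ A.orbifoldC2 := by
  simp [coinv]

theorem coinv_tmul_vac (a : V) : A.coinv (a ⊗ₜ A.vac) = A.etaBar a := by
  simp only [coinv, etaBar, LinearMap.comp_apply]
  congr 1

theorem coinv_comm (e : V ⊗[ℂ] V) : A.coinv (TensorProduct.comm ℂ V V e) = A.coinv e := by
  simp only [coinv, LinearMap.comp_apply]
  congr 1
  ext
  simp [coe_symmetrize, add_comm]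

theorem coinv_tmul_comm (a b : V) : A.coinv (a ⊗ₜ b) = A.coinv (b ⊗ₜ a) := by
  rw [← coinv_comm, TensorProduct.comm_tmul]

/-- A mode of a fixed vector commutes with the transposition, so symmetrizing u_(n)e gives u_(n) of
the symmetrization of e. Thus e itself need not be fixed. -/
theorem coinv_tensorNth_left {u : V ⊗[ℂ] V} (hu : u ∈ orbifold V) (e : V ⊗[ℂ] V) {n : ℤ}
    (hn : n ≤ -2) : A.coinv (A.tensorNth n u e) = 0 := by
  rw [coinv_eq_zero_iff]
  convert A.orbifoldNth_mem_orbifoldC2 ⟨u, hu⟩ (symmetrize V e) hn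
  ext
  change A.tensorNth n u e + TensorProduct.comm ℂ V V (A.tensorNth n u e) =
    A.tensorNth n u (e + TensorProduct.comm ℂ V V e)
  rw [comm_tensorNth, (mem_orbifold _).1 hu, map_add]

theorem coinv_tensorNth_right {u : V ⊗[ℂ] V} (hu : u ∈ orbifold V) (e : V ⊗[ℂ] V) {n : ℤ}
    (hn : n ≤ -2) : A.coinv (A.tensorNth n e u) = 0 := by
  rw [coinv_eq_zero_iff]
  convert A.orbifoldNth_mem_orbifoldC2 (symmetrize V e) ⟨u, hu⟩ hn
  ext
  change A.tensorNth n e u + TensorProduct.comm ℂ V V (A.tensorNth n e u) =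
    A.tensorNth n (e + TensorProduct.comm ℂ V V e) u
  rw [comm_tensorNth, (mem_orbifold _).1 hu, map_add, LinearMap.add_apply]

/-- A symmetric linear map on `V ⊗ V` that kills the diagonal action of `a_(n)` for `n ≤ -2` and
of `L_{-1}`. -/
structure IsInvariant {M : Type*} [AddCommGroup M] [Module ℂ M] (ρ : V ⊗[ℂ] V →ₗ[ℂ] M) :
    Prop where
  nth : ∀ (c : V) (n : ℤ) (e : V ⊗[ℂ] V), n ≤ -2 → ρ (diagAdd (A.nth n c) e) = 0
  translation : ∀ e : V ⊗[ℂ] V, ρ (diagAdd (A.nth 0 A.omega) e) = 0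
  symm : ∀ e : V ⊗[ℂ] V, ρ (TensorProduct.comm ℂ V V e) = ρ e

theorem vac_tmul_vac_mem : A.vac ⊗ₜ[ℂ] A.vac ∈ orbifold V := by
  rw [mem_orbifold, TensorProduct.comm_tmul]

/-- This is how L_{-1} comes to act by zero on coinvariants: it is ω_(0), not a mode of index at
most -2, but its values are (-2)-products with the vacuum. -/
theorem tensorNth_neg_two_vac (e : V ⊗[ℂ] V) :
    A.tensorNth (-2) e (A.vac ⊗ₜ A.vac) = diagAdd (A.nth 0 A.omega) e := by
  induction e using TensorProduct.induction_on with
  | zero => simp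
  | add x y hx hy => simp only [map_add, LinearMap.add_apply, hx, hy]
  | tmul a b =>
    rw [tensorNth_tmul_tmul,
      finsum_eq_sum_of_support_subset (s := {-2, -1}) _ fun i hi => ?_]
    · rw [Finset.sum_pair (by norm_num)]
      norm_num [nth_neg_one_vac, translation]
    · by_contra h
      simp only [Finset.coe_insert, Finset.coe_singleton, Set.mem_insert_iff,
        Set.mem_singleton_iff, not_or] at h
      refine hi ?_
      dsimp only
      rcases lt_or_ge i 0 with h0 | h0
      · rw [A.nth_vac b (-2 - 1 - i) (by lia), TensorProduct.tmul_zero]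
      · rw [A.nth_vac a i h0, TensorProduct.zero_tmul]

theorem isInvariant_coinv : A.IsInvariant A.coinv where
  nth c n e hn := by
    rw [← tensorNth_eta]
    exact A.coinv_tensorNth_left (A.eta c).2 e hn
  translation e := by
    rw [← tensorNth_neg_two_vac]
    exact A.coinv_tensorNth_right A.vac_tmul_vac_mem e le_rfl
  symm := A.coinv_comm

/-- The commutator `[a_(p), b_(q)]` as a finite sum. -/
theorem nth_mul_sub {a b : V} {M : ℕ} (hM : ∀ i : ℕ, M ≤ i → A.nth i a b = 0) (p q : ℤ) :
    A.nth p a * A.nth q b - A.nth q b * A.nth p a =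
      ∑ i ∈ Finset.range M, (Ring.choose p i : ℤ) • A.nth (p + q - i) (A.nth i a b) := by
  ext c
  simp [LinearMap.sum_apply, ← A.nth_comm_sum hM]

theorem nth_zero_mul_sub (a b : V) (q : ℤ) :
    A.nth 0 a * A.nth q b - A.nth q b * A.nth 0 a = A.nth q (A.nth 0 a b) := by
  ext c
  simp only [LinearMap.sub_apply, Module.End.mul_apply]
  rw [nth_comm_finsum, finsum_eq_single _ 0]
  · simp
  · intro i hi
    rw [Ring.choose_zero_pos ℤ (Nat.pos_of_ne_zero hi), zero_smul]

variable {A} {M : Type*} [AddCommGroup M] [Module ℂ M] {ρ : V ⊗[ℂ] V →ₗ[ℂ] M}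

/-- The commutator is a combination of modes (a_(i)b)_(n-1-i) with i ≥ 0, all of index at most -3.
-/
theorem IsInvariant.comm_eq_zero (hρ : A.IsInvariant ρ) (a b : V) (n : ℤ) (hn : n ≤ -2)
    (e : V ⊗[ℂ] V) : ρ (diagAdd (A.nth (-1) a * A.nth n b - A.nth n b * A.nth (-1) a) e) = 0 := by
  obtain ⟨N, hN⟩ := A.exists_nth_eq_zero a b
  rw [A.nth_mul_sub (M := N) (fun i hi => hN i (by exact_mod_cast hi))]
  simp only [map_sum, LinearMap.sum_apply, map_zsmul, LinearMap.smul_apply]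
  refine Finset.sum_eq_zero fun i _ => ?_
  rw [hρ.nth _ _ _ (by lia), smul_zero]

theorem IsInvariant.diagAdd_neg_one_diagAdd (hρ : A.IsInvariant ρ) (a b : V) (n : ℤ) (hn : n ≤ -2)
    (e : V ⊗[ℂ] V) : ρ (diagAdd (A.nth (-1) a) (diagAdd (A.nth n b) e)) = 0 := by
  rw [diagAdd_diagAdd, map_add, hρ.nth _ _ _ hn, hρ.comm_eq_zero _ _ _ hn, add_zero]

/-- Diagonal modes of index -1 are not killed, and survive in the reductions as insertions.
Two-point functions with such an insertion obey the same rules as those without. -/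
theorem IsInvariant.comp (hρ : A.IsInvariant ρ) (c : V) :
    A.IsInvariant (ρ ∘ₗ diagAdd (A.nth (-1) c)) where
  nth b n e hn := hρ.diagAdd_neg_one_diagAdd c b n hn e
  translation e := by
    rw [LinearMap.comp_apply, diagAdd_diagAdd, map_add, hρ.translation, zero_add,
      ← neg_sub (A.nth 0 A.omega * A.nth (-1) c), nth_zero_mul_sub, nth_translation,
      map_neg, LinearMap.neg_apply, map_neg, map_smul, LinearMap.smul_apply, map_smul,
      hρ.nth _ _ _ (by norm_num), smul_zero, neg_zero]
  symm e := by
    rw [LinearMap.comp_apply, LinearMap.comp_apply, ← comm_diagAdd, hρ.symm]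

theorem IsInvariant.map {M' : Type*} [AddCommGroup M'] [Module ℂ M'] (hρ : A.IsInvariant ρ)
    (φ : M →ₗ[ℂ] M') : A.IsInvariant (φ ∘ₗ ρ) where
  nth b n e hn := by rw [LinearMap.comp_apply, hρ.nth b n e hn, map_zero]
  translation e := by rw [LinearMap.comp_apply, hρ.translation, map_zero]
  symm e := by rw [LinearMap.comp_apply, LinearMap.comp_apply, hρ.symm]

variable (A)

/-! ### Normally ordered products -/

/-- Polarization: f⊗g + g⊗f is half of D⁺f D⁺g − D⁻f D⁻g. -/
theorem tensorTerm_add_tensorTerm (n i : ℤ) (a b : V) (e : V ⊗[ℂ] V) :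
    A.tensorTerm n i (a ⊗ₜ b) e + A.tensorTerm n (n - 1 - i) (b ⊗ₜ a) e =
      (1 / 2 : ℂ) • (diagAdd (A.nth i a) (diagAdd (A.nth (n - 1 - i) b) e) -
        diagSub (A.nth i a) (diagSub (A.nth (n - 1 - i) b) e)) := by
  induction e using TensorProduct.induction_on with
  | zero => simp
  | add x y hx hy =>
    rw [map_add, map_add, add_add_add_comm, hx, hy, ← smul_add]
    simp only [map_add]
    congr 1
    abel
  | tmul c d =>
    rw [tensorTerm_tmul, tensorTerm_tmul, show n - 1 - (n - 1 - i) = i by ring]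
    simp only [diagAdd_tmul, diagSub_tmul, map_add, map_sub]
    module

/-- Both products have the same commutator D⁺[f, g], so the difference does not depend on the order
of the factors. -/
theorem tensorTerm_add_tensorTerm' (n i : ℤ) (a b : V) (e : V ⊗[ℂ] V) :
    A.tensorTerm n i (a ⊗ₜ b) e + A.tensorTerm n (n - 1 - i) (b ⊗ₜ a) e =
      (1 / 2 : ℂ) • (diagAdd (A.nth (n - 1 - i) b) (diagAdd (A.nth i a) e) -
        diagSub (A.nth (n - 1 - i) b) (diagSub (A.nth i a) e)) := by
  rw [tensorTerm_add_tensorTerm, diagAdd_diagAdd, diagSub_diagSub]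
  congr 1
  abel

theorem tensorNth_symm (n : ℤ) (a b : V) (e : V ⊗[ℂ] V) :
    ∃ K : ℕ, ∀ N : ℕ, K ≤ N → A.tensorNth n (a ⊗ₜ b + b ⊗ₜ a) e =
      ∑ s ∈ Finset.range N, (A.tensorTerm n (-1 - s) (a ⊗ₜ b) e +
          A.tensorTerm n (n - 1 - (-1 - s)) (b ⊗ₜ a) e) +
        ∑ s ∈ Finset.range N, (A.tensorTerm n s (a ⊗ₜ b) e +
          A.tensorTerm n (n - 1 - s) (b ⊗ₜ a) e) := by
  set f : ℤ → V ⊗[ℂ] V := fun i =>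
    A.tensorTerm n i (a ⊗ₜ b) e + A.tensorTerm n (n - 1 - i) (b ⊗ₜ a) e with hf
  have h1 := A.tensorTerm_support_finite n (a ⊗ₜ b) e
  have h2 : (Function.support fun i : ℤ => A.tensorTerm n (n - 1 - i) (b ⊗ₜ a) e).Finite :=
    (A.tensorTerm_support_finite n (b ⊗ₜ a) e).preimage
      (f := fun i => n - 1 - i) (fun i _ j _ h => by simpa using h)
  have hfin : f.support.Finite := (h1.union h2).subset (Function.support_add _ _)
  have hsum : A.tensorNth n (a ⊗ₜ b + b ⊗ₜ a) e = ∑ᶠ i, f i := by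
    rw [map_add, LinearMap.add_apply, tensorNth_apply, tensorNth_apply,
      ← finsum_comp_equiv (Equiv.subLeft (n - 1)) (f := fun i => A.tensorTerm n i (b ⊗ₜ a) e)]
    exact (finsum_add_distrib h1 h2).symm
  obtain ⟨B, hB⟩ := hfin.bddAbove
  obtain ⟨C, hC⟩ := hfin.bddBelow
  refine ⟨B.toNat + C.natAbs + 1, fun N hN => ?_⟩
  rw [hsum, finsum_eq_sum_of_support_subset (s := Finset.Ico (-(N : ℤ)) N) f fun i hi => ?_]
  · rw [← Finset.Ico_union_Ico_eq_Ico (show -(N : ℤ) ≤ 0 by lia) (show (0 : ℤ) ≤ N by lia),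
      Finset.sum_union (Finset.Ico_disjoint_Ico_consecutive _ _ _)]
    congr 1
    · refine (Finset.sum_nbij' (fun s : ℕ => -1 - (s : ℤ)) (fun i => (-1 - i).toNat)
        ?_ ?_ ?_ ?_ ?_).symm
      · intro s hs; simp at hs ⊢; lia
      · intro i hi; simp at hi ⊢; lia
      · intro s hs; simp
      · intro i hi; simp at hi ⊢; lia
      · intro s hs; rfl
    · refine (Finset.sum_nbij' (fun s : ℕ => (s : ℤ)) (fun i => i.toNat) ?_ ?_ ?_ ?_ ?_).symm
      · intro s hs; simp at hs ⊢; lia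
      · intro i hi; simp at hi ⊢; lia
      · intro s hs; simp
      · intro i hi; simp at hi ⊢; lia
      · intro s hs; rfl
  · have := hB hi
    have := hC hi
    simp
    lia

/-- The modes of the normally ordered product of the antidiagonal fields of `a` and `b` act by
zero on coinvariants. -/
theorem coinv_normalOrder (a b : V) (e : V ⊗[ℂ] V) {n : ℤ} (hn : n ≤ -2) (N : ℕ)
    (ha : ∀ k : ℤ, N ≤ k → diagSub (A.nth k a) e = 0)
    (hb : ∀ k : ℤ, n + N ≤ k → diagSub (A.nth k b) e = 0) :
    ∑ s ∈ Finset.range N, A.coinv (diagSub (A.nth (-1 - s) a) (diagSub (A.nth (n + s) b) e)) +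
      ∑ s ∈ Finset.range N,
        A.coinv (diagSub (A.nth (n - 1 - s) b) (diagSub (A.nth s a) e)) = 0 := by
  have hmem : a ⊗ₜ[ℂ] b + b ⊗ₜ a ∈ orbifold V := by
    rw [mem_orbifold]
    simp [add_comm]
  have h0 := A.coinv_tensorNth_left hmem e hn
  obtain ⟨K, hK⟩ := A.tensorNth_symm n a b e
  -- The cut-off K + N exceeds both the threshold of the expansion and N; the superfluous terms are
  -- removed at the end by `hz`.
  rw [hK (K + N) (by lia), map_add, map_sum, map_sum] at h0
  have h1 : ∀ s : ℕ, A.coinv (A.tensorTerm n (-1 - s) (a ⊗ₜ b) e +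
      A.tensorTerm n (n - 1 - (-1 - s)) (b ⊗ₜ a) e) = (-1 / 2 : ℂ) •
        A.coinv (diagSub (A.nth (-1 - s) a) (diagSub (A.nth (n + s) b) e)) := by
    intro s
    rw [tensorTerm_add_tensorTerm, show n - 1 - (-1 - (s : ℤ)) = n + s by ring, map_smul, map_sub]
    -- For s > 0 the outer mode has index at most -2. For s = 0 it has index -1, and the inner mode,
    -- of index n ≤ -2, is moved to the left.
    have : A.coinv (diagAdd (A.nth (-1 - s) a) (diagAdd (A.nth (n + s) b) e)) = 0 := by
      rcases Nat.eq_zero_or_pos s with rfl | hs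
      · simpa using A.isInvariant_coinv.diagAdd_neg_one_diagAdd a b n hn e
      · exact A.isInvariant_coinv.nth _ _ _ (by lia)
    rw [this]
    module
  have h2 : ∀ s : ℕ, A.coinv (A.tensorTerm n s (a ⊗ₜ b) e +
      A.tensorTerm n (n - 1 - s) (b ⊗ₜ a) e) = (-1 / 2 : ℂ) •
        A.coinv (diagSub (A.nth (n - 1 - s) b) (diagSub (A.nth s a) e)) := by
    intro s
    -- In this half b is put on the left, where its mode n-1-s ≤ -3 is killed at once.
    rw [tensorTerm_add_tensorTerm', map_smul, map_sub, A.isInvariant_coinv.nth _ _ _ (by lia)]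
    module
  simp only [h1, h2, ← Finset.smul_sum, ← smul_add] at h0
  have h3 := (smul_eq_zero.1 h0).resolve_left (by norm_num)
  have hz : ∀ (F : ℕ → orbifold V ⧸ A.orbifoldC2), (∀ s, N ≤ s → F s = 0) →
      ∑ s ∈ Finset.range (K + N), F s = ∑ s ∈ Finset.range N, F s := fun F hF =>
    (Finset.sum_subset (by simp) fun s _ hs => hF s (by simpa using hs)).symm
  rwa [hz _ fun s hs => by rw [hb _ (by lia), map_zero, map_zero],
    hz _ fun s hs => by rw [ha _ (by lia), map_zero, map_zero]] at h3

end VertexOperatorAlgebra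

namespace VertexOperatorAlgebra

variable {V : Type*} [AddCommGroup V] [Module ℂ V] (A : VertexOperatorAlgebra V)

/-! ### The action of `η(c)_(-1)` on coinvariants -/

/-- The commutator formula for c⊗1 in V⊗V is that of V in the first factor; the second factor is
untouched, whence the shift i ↦ i + (m - j) of the summation index. -/
theorem rTensor_tensorNth_tmul (c a b : V) (m n : ℤ) {K : ℕ}
    (hK : ∀ i : ℕ, K ≤ i → A.nth i c a = 0) (v : V ⊗[ℂ] V) :
    (A.nth m c).rTensor V (A.tensorNth n (a ⊗ₜ b) v) =
      A.tensorNth n (a ⊗ₜ b) ((A.nth m c).rTensor V v) +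
        ∑ j ∈ Finset.range K, (Ring.choose m j : ℤ) •
          A.tensorNth (m + n - j) ((A.nth j c).rTensor V (a ⊗ₜ b)) v := by
  have hterm : ∀ i : ℤ, (A.nth m c).rTensor V (A.tensorTerm n i (a ⊗ₜ b) v) =
      A.tensorTerm n i (a ⊗ₜ b) ((A.nth m c).rTensor V v) +
        ∑ j ∈ Finset.range K, (Ring.choose m j : ℤ) •
          A.tensorTerm (m + n - j) (i + (m - j)) ((A.nth j c).rTensor V (a ⊗ₜ b)) v := by
    intro i
    induction v using TensorProduct.induction_on with
    | zero => simp
    | add x y hx hy =>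
      simp only [map_add, hx, hy, smul_add, Finset.sum_add_distrib]
      abel
    | tmul p q =>
      simp only [tensorTerm_tmul, LinearMap.rTensor_tmul]
      rw [← sub_eq_iff_eq_add', ← TensorProduct.sub_tmul, A.nth_comm_sum hK,
        TensorProduct.sum_tmul]
      refine Finset.sum_congr rfl fun j _ => ?_
      rw [TensorProduct.smul_tmul', show m + n - (j : ℤ) - 1 - (i + (m - j)) = n - 1 - i by ring,
        show m + i - (j : ℤ) = i + (m - j) by ring]
  have hfin : ∀ j : ℕ, (Function.support fun i : ℤ =>
      A.tensorTerm (m + n - j) (i + (m - j)) ((A.nth j c).rTensor V (a ⊗ₜ b)) v).Finite := fun j =>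
    (A.tensorTerm_support_finite (m + n - j) _ v).preimage
      (f := fun i => i + (m - j)) (fun i _ j _ h => by simpa using h)
  have hfin' : ∀ j : ℕ, (Function.support fun i : ℤ => (Ring.choose m j : ℤ) •
      A.tensorTerm (m + n - j) (i + (m - j)) ((A.nth j c).rTensor V (a ⊗ₜ b)) v).Finite := fun j =>
    (hfin j).subset (Function.support_const_smul_subset _ _)
  rw [tensorNth_apply]
  refine (((A.nth m c).rTensor V).toAddMonoidHom.map_finsum
    (A.tensorTerm_support_finite n (a ⊗ₜ b) v)).trans ?_
  refine (finsum_congr hterm).trans ?_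
  rw [finsum_add_distrib (A.tensorTerm_support_finite n _ _)
    ((Set.Finite.biUnion (Finset.finite_toSet (Finset.range K)) fun j _ => hfin' j).subset ?_),
    finsum_sum_comm _ _ fun j _ => hfin' j]
  · congr 1
    refine Finset.sum_congr rfl fun j _ => ?_
    rw [← smul_finsum' _ (hfin j), tensorNth_apply]
    congr 1
    exact finsum_comp_equiv (Equiv.addRight (m - j : ℤ))
      (f := fun i => A.tensorTerm (m + n - j) i ((A.nth j c).rTensor V (a ⊗ₜ b)) v)
  · intro i hi
    obtain ⟨j, hj, h⟩ := Finset.exists_ne_zero_of_sum_ne_zero hi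
    exact Set.mem_biUnion hj h

/-- The formula for 1⊗c is the one for c⊗1 conjugated by the transposition; the two are added. The
bound must be uniform over the pure tensors in u, so it is stated for all large K. -/
theorem diagAdd_tensorNth (c : V) (m n : ℤ) (u v : V ⊗[ℂ] V) :
    ∃ J : ℕ, ∀ K : ℕ, J ≤ K → diagAdd (A.nth m c) (A.tensorNth n u v) =
      A.tensorNth n u (diagAdd (A.nth m c) v) +
        ∑ j ∈ Finset.range K, (Ring.choose m j : ℤ) •
          A.tensorNth (m + n - j) (diagAdd (A.nth j c) u) v := by
  induction u using TensorProduct.induction_on with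
  | zero => simp
  | add x y hx hy =>
    obtain ⟨J, hJ⟩ := hx
    obtain ⟨J', hJ'⟩ := hy
    refine ⟨max J J', fun K hK => ?_⟩
    simp only [map_add, LinearMap.add_apply, hJ K (by lia), hJ' K (by lia), smul_add,
      Finset.sum_add_distrib]
    abel
  | tmul a b =>
    obtain ⟨J, hJ⟩ := A.exists_nth_eq_zero c a
    obtain ⟨J', hJ'⟩ := A.exists_nth_eq_zero c b
    refine ⟨max J J', fun K hK => ?_⟩
    have h1 := A.rTensor_tensorNth_tmul c a b m n (K := K) (fun i hi => hJ i (by lia)) v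
    have h2 := congrArg (TensorProduct.comm ℂ V V)
      (A.rTensor_tensorNth_tmul c b a m n (K := K) (fun i hi => hJ' i (by lia))
        (TensorProduct.comm ℂ V V v))
    have hc : ∀ (f : Module.End ℂ V) (e : V ⊗[ℂ] V),
        TensorProduct.comm ℂ V V (f.rTensor V e) = f.lTensor V (TensorProduct.comm ℂ V V e) := by
      intro f e
      induction e using TensorProduct.induction_on with
      | zero => simp
      | add x y hx hy => simp only [map_add, hx, hy]
      | tmul a b => simp
    have hcc : ∀ e : V ⊗[ℂ] V, TensorProduct.comm ℂ V V (TensorProduct.comm ℂ V V e) = e := by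
      intro e
      simp
    simp only [map_add, map_sum, map_zsmul, comm_tensorNth, hc, TensorProduct.comm_tmul,
      hcc] at h2
    have hd : ∀ (f : Module.End ℂ V) (e : V ⊗[ℂ] V),
      diagAdd f e = f.rTensor V e + f.lTensor V e := fun _ _ => rfl
    simp only [hd, map_add, LinearMap.add_apply, smul_add, Finset.sum_add_distrib, h1, h2]
    abel

/-- C_2 is stable under η(c)_(-1): moving it past a_(-2) only creates modes of index at most -3. -/
theorem coinv_diagAdd_neg_one {e : V ⊗[ℂ] V} (he : A.coinv e = 0) (c : V) :
    A.coinv (diagAdd (A.nth (-1) c) e) = 0 := by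
  have key : ∀ v ∈ A.orbifoldC2, A.orbifoldNth (-1) (A.eta c) v ∈ A.orbifoldC2 := by
    intro v hv
    induction hv using Submodule.span_induction with
    | zero => simp
    | add x y _ _ hx hy => rw [map_add]; exact add_mem hx hy
    | smul t x _ hx => rw [map_smul]; exact Submodule.smul_mem _ _ hx
    | mem x hx =>
      obtain ⟨a, b, rfl⟩ := hx
      obtain ⟨J, hJ⟩ := A.diagAdd_tensorNth c (-1) (-2) (a : V ⊗[ℂ] V) b
      have h : A.orbifoldNth (-1) (A.eta c) (A.orbifoldNth (-2) a b) =
          A.orbifoldNth (-2) a (A.orbifoldNth (-1) (A.eta c) b) +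
            ∑ j ∈ Finset.range J, (Ring.choose (-1) j : ℤ) •
              A.orbifoldNth (-1 + -2 - j) (A.orbifoldNth j (A.eta c) a) b := by
        apply Subtype.ext
        rw [Submodule.coe_add, Submodule.coe_sum]
        change A.tensorNth _ (c ⊗ₜ A.vac + A.vac ⊗ₜ c) (A.tensorNth _ (a : V ⊗[ℂ] V) b) =
          A.tensorNth _ (a : V ⊗[ℂ] V) (A.tensorNth _ (c ⊗ₜ A.vac + A.vac ⊗ₜ c) b) +
            ∑ j ∈ Finset.range J, (Ring.choose (-1) j : ℤ) •
              A.tensorNth _ (A.tensorNth j (c ⊗ₜ A.vac + A.vac ⊗ₜ c) a) b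
        simp only [tensorNth_eta]
        exact hJ J le_rfl
      rw [h]
      exact add_mem (A.orbifoldNth_mem_orbifoldC2 _ _ le_rfl) (sum_mem fun j _ =>
        zsmul_mem (A.orbifoldNth_mem_orbifoldC2 _ _ (by lia)) _)
  rw [coinv_eq_zero_iff] at he ⊢
  convert key _ he
  ext
  change diagAdd (A.nth (-1) c) e + TensorProduct.comm ℂ V V (diagAdd (A.nth (-1) c) e) =
    A.tensorNth (-1) (c ⊗ₜ A.vac + A.vac ⊗ₜ c) (e + TensorProduct.comm ℂ V V e)
  rw [tensorNth_eta, comm_diagAdd, map_add]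

end VertexOperatorAlgebra

namespace VertexOperatorAlgebra

variable {V : Type*} [AddCommGroup V] [Module ℂ V] (A : VertexOperatorAlgebra V)

/-! ### Weights -/

theorem mem_weightSpace {d : ℤ} {a : V} :
    a ∈ A.weightSpace d ↔ A.nth 1 A.omega a = (d : ℂ) • a := Module.End.mem_eigenspace_iff

theorem nth_mem_weightSpace {d e : ℤ} {a b : V} (ha : a ∈ A.weightSpace d)
    (hb : b ∈ A.weightSpace e) (n : ℤ) : A.nth n a b ∈ A.weightSpace (d + e - n - 1) := by
  rw [mem_weightSpace] at *
  have h := A.nth_comm_finsum A.omega a b 1 n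
  rw [finsum_eq_sum_of_support_subset (s := Finset.range 2) _ fun i hi => ?_,
    Finset.sum_range_succ, Finset.sum_range_one, hb] at h
  · simp only [Nat.cast_zero, Nat.cast_one, Ring.choose_zero_right, Ring.choose_one_right, ha,
      nth_translation, map_smul, LinearMap.smul_apply, one_smul, sub_zero] at h
    rw [show 1 + n - 1 = n by ring] at h
    rw [sub_eq_iff_eq_add.1 h]
    push_cast
    module
  · by_contra hc
    refine hi ?_
    dsimp only
    rw [show Ring.choose (1 : ℤ) i = 0 from ?_, zero_smul]
    have : 1 < i := by simpa using hc
    have h := Ring.choose_natCast (R := ℤ) 1 i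
    rw [Nat.choose_eq_zero_of_lt this] at h
    exact_mod_cast h

/-- Read off from [L_0, L_n] directly, so that the weight of ω is not needed. -/
theorem omega_nth_mem_weightSpace {d : ℤ} {b : V} (hb : b ∈ A.weightSpace d) (n : ℤ) :
    A.nth (n + 1) A.omega b ∈ A.weightSpace (d - n) := by
  rw [mem_weightSpace] at *
  have h := A.virasoro 0 n b
  rw [zero_add, hb, map_smul] at h
  rw [sub_eq_iff_eq_add.1 h]
  rcases eq_or_ne n 0 with rfl | hn
  · simp [hb]
  · rw [if_neg (by simpa using hn)]
    push_cast
    rw [zero_add]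
    module

/-! ### Currents -/

/-- The Virasoro mode `L_n`. -/
def vir (n : ℤ) : Module.End ℂ V := A.nth (n + 1) A.omega

theorem vir_comm (m n : ℤ) : A.vir m * A.vir n - A.vir n * A.vir m =
    ((m : ℂ) - n) • A.vir (m + n) +
      if m + n = 0 then (((m : ℂ) ^ 3 - m) / 12 * A.centralCharge) • 1 else 0 := by
  ext v
  have h := A.virasoro m n v
  simp only [vir, LinearMap.sub_apply, Module.End.mul_apply, h, LinearMap.add_apply,
    LinearMap.smul_apply]
  split_ifs <;> rfl

/-- The commutation relations `[L_m, x_(n)] = -n x_(m+n) + l (m+1 choose 2) δ_{m,-n}` of the modes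
of a vector of weight one. -/
def IsCurrent (x : V) (l : ℂ) : Prop :=
  ∀ m n : ℤ, A.vir m * A.nth n x - A.nth n x * A.vir m =
    (-n : ℂ) • A.nth (m + n) x + if m + n = 0 then (l * ((m + 1) * m / 2)) • 1 else 0

/-- Two currents with `[x_(m), y_(n)] = w_(m+n) + m k δ_{m,-n}`, where `L_1 w = 0`. -/
structure IsCurrentPair (x y w : V) (k lx ly : ℂ) : Prop where
  left : A.IsCurrent x lx
  right : A.IsCurrent y ly
  bracket : A.IsCurrent w 0
  comm : ∀ m n : ℤ, A.nth m x * A.nth n y - A.nth n y * A.nth m x =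
    A.nth (m + n) w + if m + n = 0 then (m * k) • 1 else 0

/-- The vector x need not be quasi-primary: L_1 x = l·1 produces the central term, through the
binomial coefficient of m+1 over 2. -/
theorem isCurrent_of {x : V} {l : ℂ} (hx : x ∈ A.weightSpace 1)
    (h2 : A.nth 2 A.omega x = l • A.vac) (h3 : ∀ n : ℤ, 3 ≤ n → A.nth n A.omega x = 0) :
    A.IsCurrent x l := by
  intro m n
  rw [vir, A.nth_mul_sub (M := 3) fun i hi => h3 i (by exact_mod_cast hi), Finset.sum_range_succ,
    Finset.sum_range_succ, Finset.sum_range_one]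
  have h1 : A.nth 1 A.omega x = x := by simpa using A.mem_weightSpace.1 hx
  have hvac : ∀ k : ℤ, A.nth k A.vac = if k = -1 then 1 else 0 := by
    intro k
    ext b
    rw [vac_nth]
    split_ifs <;> rfl
  have hch : ((Ring.choose (m + 1) 2 : ℤ) : ℂ) = (m + 1) * m / 2 := by
    have h := Ring.descPochhammer_eq_factorial_smul_choose (m + 1) 2
    rw [descPochhammer_succ_right, descPochhammer_one] at h
    simp only [Nat.cast_one, mul_sub, Polynomial.smeval_sub, Polynomial.smeval_mul,
      Polynomial.smeval_X, Polynomial.smeval_one, Nat.factorial_two, pow_one, pow_zero] at h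
    norm_num at h
    have h' : ((m : ℂ) + 1) * m = 2 * (Ring.choose (m + 1) 2 : ℤ) := by 
      have h'' : (m + 1) * m = 2 * Ring.choose (m + 1) 2 := by linarith
      exact_mod_cast h''
    rw [h']
    ring
  simp only [Nat.cast_zero, Nat.cast_one, Nat.cast_ofNat, Ring.choose_zero_right,
    Ring.choose_one_right, h1, h2, nth_translation, map_smul, hvac, sub_zero,
    ← Int.cast_smul_eq_zsmul ℂ, hch]
  rw [show m + 1 + n - 1 = m + n by ring]
  have : (m + 1 + n - 2 = -1) ↔ (m + n = 0) := by constructor <;> intro h <;> lia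
  simp only [this]
  split_ifs <;> push_cast <;> module

variable {A}

theorem IsCFTType.isCurrent (hA : A.IsCFTType) {x : V} (hx : x ∈ A.weightSpace 1) :
    ∃ l, A.IsCurrent x l ∧ A.nth 2 A.omega x = l • A.vac := by
  have h2 : A.nth 2 A.omega x ∈ A.weightSpace 0 := by
    simpa using A.omega_nth_mem_weightSpace hx 1
  rw [hA.2, Submodule.mem_span_singleton] at h2
  obtain ⟨l, hl⟩ := h2
  refine ⟨l, A.isCurrent_of hx hl.symm fun n hn => ?_, hl.symm⟩
  have h := A.omega_nth_mem_weightSpace hx (n - 1)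
  rw [hA.1 _ (by lia), Submodule.mem_bot] at h
  simpa using h

theorem IsCFTType.nth_eq_zero (hA : A.IsCFTType) {x y : V} (hx : x ∈ A.weightSpace 1)
    (hy : y ∈ A.weightSpace 1) {n : ℤ} (hn : 2 ≤ n) : A.nth n x y = 0 := by
  have h := A.nth_mem_weightSpace hx hy n
  rwa [hA.1 _ (by lia), Submodule.mem_bot] at h

theorem nth_zero_mem_weightSpace {x y : V} (hx : x ∈ A.weightSpace 1)
    (hy : y ∈ A.weightSpace 1) : A.nth 0 x y ∈ A.weightSpace 1 := by
  simpa using A.nth_mem_weightSpace hx hy 0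

theorem IsCFTType.exists_comm (hA : A.IsCFTType) {x y : V} (hx : x ∈ A.weightSpace 1)
    (hy : y ∈ A.weightSpace 1) :
    ∃ k : ℂ, ∀ m n : ℤ, A.nth m x * A.nth n y - A.nth n y * A.nth m x =
      A.nth (m + n) (A.nth 0 x y) + if m + n = 0 then (m * k) • 1 else 0 := by
  have h1 : A.nth 1 x y ∈ A.weightSpace 0 := by
    simpa using A.nth_mem_weightSpace hx hy 1
  rw [hA.2, Submodule.mem_span_singleton] at h1
  obtain ⟨k, hk⟩ := h1
  refine ⟨k, fun m n => ?_⟩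
  rw [A.nth_mul_sub (M := 2) fun i hi => hA.nth_eq_zero hx hy (by exact_mod_cast hi),
    Finset.sum_range_succ, Finset.sum_range_one]
  have hvac : ∀ k : ℤ, A.nth k A.vac = if k = -1 then 1 else 0 := by
    intro k
    ext b
    rw [vac_nth]
    split_ifs <;> rfl
  simp only [Nat.cast_zero, Nat.cast_one, Ring.choose_zero_right, Ring.choose_one_right, ← hk,
    map_smul, hvac, sub_zero, ← Int.cast_smul_eq_zsmul ℂ]
  have : (m + n - 1 = -1) ↔ (m + n = 0) := by constructor <;> intro h <;> lia
  simp only [this]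
  split_ifs <;> module

theorem IsCFTType.isCurrentPair (hA : A.IsCFTType) {x y : V} (hx : x ∈ A.weightSpace 1)
    (hy : y ∈ A.weightSpace 1) :
    ∃ k lx ly, A.IsCurrentPair x y (A.nth 0 x y) k lx ly := by
  obtain ⟨lx, hlx, _⟩ := hA.isCurrent hx
  obtain ⟨ly, hly, hly'⟩ := hA.isCurrent hy
  obtain ⟨k, hk⟩ := hA.exists_comm hx hy
  obtain ⟨lw, hlw, hlw'⟩ := hA.isCurrent (nth_zero_mem_weightSpace hx hy)
  refine ⟨k, lx, ly, hlx, hly, ?_, hk⟩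
  have hw := nth_zero_mem_weightSpace hx hy
  refine A.isCurrent_of hw ?_ fun n hn => ?_
  -- L_1 commutes with x_(0), and L_1 y is a multiple of the vacuum, which x_(0) kills. Hence the
  -- bracket w has no anomaly.
  · have h := LinearMap.congr_fun (hlx 1 0) y
    norm_num [vir, Module.End.mul_apply, hly', nth_vac] at h
    rw [zero_smul]
    exact h
  · have h := A.omega_nth_mem_weightSpace hw (n - 1)
    rw [hA.1 _ (by lia), Submodule.mem_bot] at h
    simpa using h

theorem IsCurrentPair.symm {x y w : V} {k lx ly : ℂ} (h : A.IsCurrentPair x y w k lx ly) :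
    A.IsCurrentPair y x (-w) k ly lx where
  left := h.right
  right := h.left
  bracket m n := by
    have := congrArg Neg.neg (h.bracket m n)
    simp only [map_neg, mul_neg, neg_mul, zero_mul, zero_smul, ite_self, add_zero, smul_neg] at *
    rw [← this]
    abel
  comm m n := by
    rw [← neg_sub, h.comm, add_comm n m, map_neg, neg_add]
    congr 1
    split_ifs with hmn
    · have : (n : ℂ) = -m := by
        rw [show n = -m by lia]
        push_cast
        rfl
      rw [this, ← neg_smul]
      ring_nf
    · simp

variable (A)

/-- The modes of `x_(-1-a) 1`. -/
theorem nth_nth_vac (x : V) (a : ℕ) (m : ℤ) :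
    A.nth m (A.nth (-1 - a) x A.vac) =
      ((∏ i ∈ Finset.range a, ((i : ℂ) - m)) / a.factorial) • A.nth (m - a) x := by
  induction a generalizing m with
  | zero => simp [nth_neg_one_vac]
  | succ a ih =>
    have hT : A.nth 0 A.omega (A.nth (-1 - a) x A.vac) =
        ((a : ℂ) + 1) • A.nth (-1 - (a + 1 : ℕ)) x A.vac := by
      have h := LinearMap.congr_fun (A.nth_zero_mul_sub A.omega x (-1 - a)) A.vac
      simp only [LinearMap.sub_apply, Module.End.mul_apply, nth_translation,
        A.nth_vac A.omega 0 le_rfl, map_zero, sub_zero, LinearMap.smul_apply] at h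
      rw [h]
      congr 2
      · push_cast
        ring
      · congr 1
        push_cast
        ring_nf
    have h := A.nth_translation (A.nth (-1 - a) x A.vac) m
    rw [hT, map_smul, ih] at h
    have ha : (a : ℂ) + 1 ≠ 0 := by exact_mod_cast a.succ_ne_zero
    have h' := congrArg (fun f => ((a : ℂ) + 1)⁻¹ • f) h
    simp only [smul_smul, inv_mul_cancel₀ ha, one_smul] at h'
    rw [h', show m - 1 - (a : ℤ) = m - (a + 1 : ℕ) by push_cast; ring]
    congr 1
    rw [Finset.prod_range_succ', Nat.factorial_succ]
    push_cast
    have : ∀ i : ℕ, (i : ℂ) - (m - 1) = i + 1 - m := fun i => by ring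
    simp only [this]
    field_simp
    ring_nf

end VertexOperatorAlgebra

namespace VertexOperatorAlgebra

variable {V : Type*} [AddCommGroup V] [Module ℂ V] (A : VertexOperatorAlgebra V)

/-! ### Two-point functions -/

section TwoPoint

/-- The vacuum `1 ⊗ 1`. -/
def vac₂ : V ⊗[ℂ] V := A.vac ⊗ₜ A.vac

theorem diagSub_nth_vac₂ (x : V) {n : ℤ} (hn : 0 ≤ n) : diagSub (A.nth n x) A.vac₂ = 0 := by
  simp [vac₂, A.nth_vac x n hn]

theorem diagAdd_nth_vac₂ (x : V) {n : ℤ} (hn : 0 ≤ n) : diagAdd (A.nth n x) A.vac₂ = 0 := by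
  simp [vac₂, A.nth_vac x n hn]

theorem diagSub_vir_vac₂ {n : ℤ} (hn : -1 ≤ n) : diagSub (A.vir n) A.vac₂ = 0 :=
  A.diagSub_nth_vac₂ _ (by lia)

theorem diagAdd_vir_vac₂ {n : ℤ} (hn : -1 ≤ n) : diagAdd (A.vir n) A.vac₂ = 0 :=
  A.diagAdd_nth_vac₂ _ (by lia)

variable (ρ : V ⊗[ℂ] V →ₗ[ℂ] ℂ)

/-- The two-point function of the antidiagonal actions of `f` and `g`. -/
noncomputable def pt₂ (f g : Module.End ℂ V) : ℂ := ρ (diagSub f (diagSub g A.vac₂))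

/-- The four-point function of the antidiagonal actions of `f₁, …, f₄`. -/
noncomputable def pt₄ (f₁ f₂ f₃ f₄ : Module.End ℂ V) : ℂ :=
  ρ (diagSub f₁ (diagSub f₂ (diagSub f₃ (diagSub f₄ A.vac₂))))

variable {A ρ}

theorem IsInvariant.vir (hρ : A.IsInvariant ρ) {n : ℤ} (hn : n ≤ -1) (hn' : n ≠ -2)
    (e : V ⊗[ℂ] V) : ρ (diagAdd (A.vir n) e) = 0 := by
  rcases eq_or_ne n (-1) with rfl | h
  · exact hρ.translation e
  · exact hρ.nth _ _ _ (by lia)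

variable (A ρ) in
theorem pt₂_swap (f g : Module.End ℂ V) :
    A.pt₂ ρ f g = A.pt₂ ρ g f + ρ (diagAdd (f * g - g * f) A.vac₂) := by
  rw [pt₂, diagSub_diagSub, map_add]
  rfl

/-- L_{-1} kills the vacuum on the right and is killed by ρ on the left, so the sum of its
commutators with the two fields vanishes. -/
theorem IsInvariant.pt₂_translation (hρ : A.IsInvariant ρ) (f g : Module.End ℂ V) :
    A.pt₂ ρ (A.vir (-1) * f - f * A.vir (-1)) g + A.pt₂ ρ f (A.vir (-1) * g - g * A.vir (-1)) =
      0 := by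
  have h := hρ.vir le_rfl (by norm_num) (diagSub f (diagSub g A.vac₂))
  rw [diagAdd_diagSub, diagAdd_diagSub, A.diagAdd_vir_vac₂ le_rfl, map_add, map_zero, zero_add,
    add_comm] at h
  exact h

theorem pt₂_smul_left (c : ℂ) (f g : Module.End ℂ V) : A.pt₂ ρ (c • f) g = c * A.pt₂ ρ f g := by
  simp [pt₂]

theorem pt₂_smul_right (c : ℂ) (f g : Module.End ℂ V) : A.pt₂ ρ f (c • g) = c * A.pt₂ ρ f g := by
  simp [pt₂]

variable {x y w : V} {k lx ly : ℂ}

theorem IsCurrent.translation (hx : A.IsCurrent x lx) (n : ℤ) :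
    A.vir (-1) * A.nth n x - A.nth n x * A.vir (-1) = (-n : ℂ) • A.nth (n - 1) x := by
  rw [hx]
  rw [show (-1 : ℤ) + n = n - 1 by ring]
  split_ifs <;> simp

theorem IsCurrent.vir_comm (hx : A.IsCurrent x lx) {m n : ℤ} (h : m + n ≠ 0) :
    A.vir m * A.nth n x - A.nth n x * A.vir m = (-n : ℂ) • A.nth (m + n) x := by
  rw [hx, if_neg h, add_zero]

theorem IsCurrent.comm_vir (hx : A.IsCurrent x lx) {m n : ℤ} (h : m + n ≠ 0) :
    A.nth n x * A.vir m - A.vir m * A.nth n x = (n : ℂ) • A.nth (m + n) x := by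
  rw [← neg_sub, hx.vir_comm h, neg_smul, neg_neg]

theorem vir_translation (n : ℤ) :
    A.vir (-1) * A.vir n - A.vir n * A.vir (-1) = (-1 - n : ℂ) • A.vir (n - 1) := by
  rw [A.vir_comm]
  rw [show (-1 : ℤ) + n = n - 1 by ring]
  split_ifs <;> norm_num

/-- A function of two mode indices as it arises from a two-point function: the first field has
weight `s + 1` and the second one weight one, or weight two when `t = 1`. -/
def IsPrimaryPair (s t : ℂ) (f : ℤ → ℤ → ℂ) : Prop :=
  ∀ a b : ℤ, (a - s) * f (a + 1) b + (b - t) * f a (b + 1) = 0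

theorem IsInvariant.isPrimaryPair (hρ : A.IsInvariant ρ) (hx : A.IsCurrent x lx)
    (hy : A.IsCurrent y ly) :
    IsPrimaryPair 0 0 fun a b => A.pt₂ ρ (A.nth (-a) x) (A.nth (-b) y) := by
  intro a b
  have h := hρ.pt₂_translation (A.nth (-a) x) (A.nth (-b) y)
  rw [hx.translation, hy.translation, pt₂_smul_left, pt₂_smul_right] at h
  simp only [neg_add']
  push_cast at h
  linear_combination h

theorem IsInvariant.isPrimaryPair_vir (hρ : A.IsInvariant ρ) (hy : A.IsCurrent y ly) :
    IsPrimaryPair 1 0 fun a b => A.pt₂ ρ (A.vir (-a)) (A.nth (-b) y) := by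
  intro a b
  have h := hρ.pt₂_translation (A.vir (-a)) (A.nth (-b) y)
  rw [vir_translation, hy.translation, pt₂_smul_left, pt₂_smul_right] at h
  simp only [neg_add']
  push_cast at h
  linear_combination h

theorem IsInvariant.isPrimaryPair_vir_vir (hρ : A.IsInvariant ρ) :
    IsPrimaryPair 1 1 fun a b => A.pt₂ ρ (A.vir (-a)) (A.vir (-b)) := by
  intro a b
  have h := hρ.pt₂_translation (A.vir (-a)) (A.vir (-b))
  rw [vir_translation, vir_translation, pt₂_smul_left, pt₂_smul_right] at h
  simp only [neg_add']
  push_cast at h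
  linear_combination h

/-- Solves the translation recursion by lowering the second index to t+1, its first value in the
creating range; two-point functions of fixed total weight become multiples of a single one. -/
theorem IsPrimaryPair.right {s : ℂ} {f : ℤ → ℤ → ℂ} {t : ℤ} (hf : IsPrimaryPair s t f) (j : ℕ)
    (a : ℤ) : f a (t + 1 + j) =
      (-1) ^ j * ((∏ i ∈ Finset.range j, (a - s + i)) / j.factorial) * f (a + j) (t + 1) := by
  induction j generalizing a with
  | zero => simp
  | succ j ih =>
    have h := hf a (t + 1 + j)
    rw [ih, show a + 1 + (j : ℤ) = a + (j + 1 : ℕ) by push_cast; ring,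
      show t + 1 + (j : ℤ) + 1 = t + 1 + (j + 1 : ℕ) by push_cast; ring] at h
    have hj : (j : ℂ) + 1 ≠ 0 := by exact_mod_cast j.succ_ne_zero
    have e : ∀ i : ℕ, ((a + 1 : ℤ) : ℂ) - s + i = a - s + (i + 1 : ℕ) := by
      intro i
      push_cast
      ring
    simp only [e] at h
    rw [Finset.prod_range_succ', Nat.factorial_succ, Nat.cast_mul, Nat.cast_zero, add_zero,
      mul_comm (_ : ℂ) (a - s), mul_div_mul_comm]
    refine mul_left_cancel₀ hj ?_
    have e2 : ((j : ℂ) + 1) * ((a - s) / ((j + 1 : ℕ) : ℂ)) = a - s := by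
      push_cast
      field_simp
    have e3 : ((t + 1 + (j : ℤ) : ℤ) : ℂ) - t = j + 1 := by
      push_cast
      ring
    rw [e3] at h
    linear_combination h + (-1) ^ j * ((∏ i ∈ Finset.range j, (a - s + (i + 1 : ℕ))) /
      j.factorial) * f (a + (j + 1 : ℕ)) (t + 1) * e2

theorem IsPrimaryPair.swap {s t : ℂ} {f : ℤ → ℤ → ℂ} (hf : IsPrimaryPair s t f) :
    IsPrimaryPair t s fun a b => f b a := fun a b => by
  rw [add_comm]
  exact hf b a

/-- The first index is lowered to s+1 by the exchanged recursion. From there `right` has coefficient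
±1, so the product left over has j factors, a fixed number when j is numeric and n symbolic. -/
theorem IsPrimaryPair.left {s : ℤ} {f : ℤ → ℤ → ℂ} (hf : IsPrimaryPair s 0 f) (j n : ℕ) :
    f (s + 1 + j) (n + 1) = (-1) ^ n *
      ((∏ i ∈ Finset.range j, ((n : ℂ) + 1 + i)) / j.factorial) * f (s + 1 + j + n) 1 := by
  have h1 := hf.swap.right j (n + 1)
  have h2 := IsPrimaryPair.right (t := 0) (by exact_mod_cast hf) (n + j) (s + 1)
  have h3 : ∏ i ∈ Finset.range (n + j), (((s + 1 : ℤ) : ℂ) - s + i) = (n + j).factorial := by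
    rw [← Finset.prod_range_add_one_eq_factorial]
    push_cast
    exact Finset.prod_congr rfl fun i _ => by ring
  rw [h3, div_self (by exact_mod_cast (n + j).factorial_ne_zero), mul_one] at h2
  simp only [zero_add] at h2
  rw [show (1 : ℤ) + ((n + j : ℕ) : ℤ) = n + 1 + j by push_cast; ring] at h2
  rw [h1, h2, show (s : ℤ) + 1 + ((n + j : ℕ) : ℤ) = s + 1 + j + n by push_cast; ring, pow_add]
  have : ((-1 : ℂ) ^ j) * (-1) ^ j = 1 := by rw [← mul_pow]; simp
  push_cast
  simp only [sub_zero]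
  linear_combination ((-1) ^ n * ((∏ i ∈ Finset.range j, ((n : ℂ) + 1 + i)) / j.factorial) *
    f (s + 1 + j + n) 1) * this

end TwoPoint

end VertexOperatorAlgebra

namespace VertexOperatorAlgebra

variable {V : Type*} [AddCommGroup V] [Module ℂ V] {A : VertexOperatorAlgebra V}

/-! ### Four-point functions in terms of two-point functions -/

section FourPoint

variable {ρ : V ⊗[ℂ] V →ₗ[ℂ] ℂ} {x y w : V} {k lx ly : ℂ}

variable (A ρ) in
theorem pt₂_diagAdd (f g h : Module.End ℂ V) :
    ρ (diagSub f (diagSub g (diagAdd h A.vac₂))) =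
      A.pt₂ (ρ ∘ₗ diagAdd h) f g + A.pt₂ ρ (f * h - h * f) g + A.pt₂ ρ f (g * h - h * g) := by
  rw [diagSub_diagAdd, map_add, diagSub_diagAdd, map_add, map_add]
  rfl

theorem IsInvariant.pt₂_comm (hρ : A.IsInvariant ρ) (h : A.IsCurrentPair x y w k lx ly) {m n : ℤ}
    (hmn : m + n ≤ -2) : A.pt₂ ρ (A.nth m x) (A.nth n y) = A.pt₂ ρ (A.nth n y) (A.nth m x) := by
  rw [pt₂_swap, h.comm, if_neg (by lia), add_zero, hρ.nth _ _ _ hmn, add_zero]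

theorem IsInvariant.pt₂_vir_comm (hρ : A.IsInvariant ρ) (hx : A.IsCurrent x lx) {m n : ℤ}
    (hmn : m + n ≤ -2) : A.pt₂ ρ (A.vir m) (A.nth n x) = A.pt₂ ρ (A.nth n x) (A.vir m) := by
  rw [pt₂_swap, hx.vir_comm (by lia), map_smul, LinearMap.smul_apply, map_smul,
    hρ.nth _ _ _ hmn, smul_zero, add_zero]

theorem IsCurrentPair.nth_vac (h : A.IsCurrentPair x y w k lx ly) {m : ℤ} (hm : 0 ≤ m) :
    diagAdd (A.nth m x) (diagSub (A.nth (-1) y) A.vac₂) =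
      if m = 0 then diagSub (A.nth (-1) w) A.vac₂ else 0 := by
  rw [diagAdd_diagSub, A.diagAdd_nth_vac₂ _ hm, map_zero, zero_add, h.comm, map_add,
    LinearMap.add_apply]
  rcases eq_or_ne m 0 with rfl | h0
  · simp
  · rw [A.diagSub_nth_vac₂ w (by lia), if_neg h0, zero_add]
    split_ifs
    · rw [map_smul, LinearMap.smul_apply, diagSub_one, smul_zero]
    · simp

theorem IsCurrentPair.nth_vac' (h : A.IsCurrentPair x y w k lx ly) {m : ℤ} (hm : 0 ≤ m) :
    diagSub (A.nth m x) (diagSub (A.nth (-1) y) A.vac₂) =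
      (if m = 0 then diagAdd (A.nth (-1) w) A.vac₂ else 0) +
        if m = 1 then (2 * k) • A.vac₂ else 0 := by
  rw [diagSub_diagSub, A.diagSub_nth_vac₂ _ hm, map_zero, zero_add, h.comm, map_add,
    LinearMap.add_apply]
  rcases eq_or_ne m 0 with rfl | h0
  · simp
  rcases eq_or_ne m 1 with rfl | h1
  · norm_num
    rw [A.diagAdd_nth_vac₂ w (by norm_num), zero_add, diagAdd_one, smul_smul, mul_comm]
  · rw [A.diagAdd_nth_vac₂ w (by lia), if_neg h0, if_neg (by lia), if_neg h1]
    simp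

theorem IsCurrent.vir_vac (hy : A.IsCurrent y ly) {m : ℤ} (hm : -1 ≤ m) :
    diagSub (A.vir m) (diagSub (A.nth (-1) y) A.vac₂) =
      (if m = -1 then diagAdd (A.nth (-2) y) A.vac₂ else 0) +
      (if m = 0 then diagAdd (A.nth (-1) y) A.vac₂ else 0) +
        if m = 1 then (2 * ly) • A.vac₂ else 0 := by
  rw [diagSub_diagSub, A.diagSub_vir_vac₂ hm, map_zero, zero_add, hy, map_add,
    LinearMap.add_apply, map_smul, LinearMap.smul_apply]
  rcases eq_or_ne m (-1) with rfl | h2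
  · norm_num
  rcases eq_or_ne m 0 with rfl | h0
  · norm_num
  rcases eq_or_ne m 1 with rfl | h1
  · norm_num
    rw [A.diagAdd_nth_vac₂ _ (by norm_num), zero_add, diagAdd_one, smul_smul]
    congr 1
    ring
  · rw [A.diagAdd_nth_vac₂ y (by lia), if_neg h0, if_neg (by lia), if_neg h1, if_neg h2]
    simp

/-- A negative diagonal mode is moved to the left, where only x_(-1) survives as an insertion; a
nonnegative one acts on the vacuum side, where only x_(0)y contributes. -/
theorem IsInvariant.pt_vir_diagAdd_nth (hρ : A.IsInvariant ρ) (h : A.IsCurrentPair x y w k lx ly)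
    {P m : ℤ} (hP : 2 ≤ P) :
    ρ (diagSub (A.vir (-P)) (diagAdd (A.nth m x) (diagSub (A.nth (-1) y) A.vac₂))) =
      (if m < 0 then -m * A.pt₂ ρ (A.nth (m - P) x) (A.nth (-1) y) else 0) +
      (if m = -1 then A.pt₂ (ρ ∘ₗ diagAdd (A.nth (-1) x)) (A.vir (-P)) (A.nth (-1) y) else 0) +
      if m = 0 then A.pt₂ ρ (A.vir (-P)) (A.nth (-1) w) else 0 := by
  rcases lt_or_ge m 0 with hm | hm
  · rw [diagSub_diagAdd, map_add, h.left.vir_comm (by lia), if_pos hm, if_neg hm.ne,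
      show -P + m = m - P by ring, map_smul, LinearMap.smul_apply, map_smul, smul_eq_mul, add_zero,
      add_comm]
    congr 1
    split_ifs with h1
    · subst h1
      rfl
    · exact hρ.nth _ _ _ (by lia)
  · rw [h.nth_vac hm, if_neg hm.not_gt, if_neg (show m ≠ -1 by lia)]
    split_ifs
    · simp [pt₂]
    · simp

/-- The four-point functions `⟨L x L y⟩` with an annihilating mode of `x`. -/
theorem IsInvariant.pt₄_vir_nth_vir (hρ : A.IsInvariant ρ) (h : A.IsCurrentPair x y w k lx ly)
    {P q t : ℤ} (hP : 2 ≤ P) (hq : 2 ≤ q) (ht : 0 ≤ t) :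
    A.pt₄ ρ (A.vir (-P)) (A.nth t x) (A.vir (-q)) (A.nth (-1) y) =
      (if t < q then t * (q - t) * A.pt₂ ρ (A.nth (t - q - P) x) (A.nth (-1) y) else 0) +
      (if t + 1 = q then
        t * A.pt₂ (ρ ∘ₗ diagAdd (A.nth (-1) x)) (A.vir (-P)) (A.nth (-1) y) else 0) +
      (if t = q then q * A.pt₂ ρ (A.vir (-P)) (A.nth (-1) w) -
        lx * q * (q - 1) * A.pt₂ ρ (A.vir (-P)) (A.nth (-1) y) else 0) +
      (if t = 0 then A.pt₂ (ρ ∘ₗ diagAdd (A.nth (-1) w)) (A.vir (-P)) (A.vir (-q)) +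
        A.pt₂ ρ (A.vir (-P)) (A.nth (-1 - q) w) + A.pt₂ ρ (A.vir (-q)) (A.nth (-1 - P) w) else 0) +
      if t = 1 then 2 * k * A.pt₂ ρ (A.vir (-P)) (A.vir (-q)) else 0 := by
  -- The annihilating mode is moved to the right past L_{-q}. The commutator is diagonal (`e1`);
  -- what remains acts on D⁻y_(-1) 1 (`e2`).
  rw [pt₄, diagSub_diagSub (A.nth t x), map_add, map_add]
  have e1 : ρ (diagSub (A.vir (-P)) (diagAdd (A.nth t x * A.vir (-q) - A.vir (-q) * A.nth t x)
      (diagSub (A.nth (-1) y) A.vac₂))) =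
      (if t < q then t * (q - t) * A.pt₂ ρ (A.nth (t - q - P) x) (A.nth (-1) y) else 0) +
      (if t + 1 = q then
        t * A.pt₂ (ρ ∘ₗ diagAdd (A.nth (-1) x)) (A.vir (-P)) (A.nth (-1) y) else 0) +
      (if t = q then q * A.pt₂ ρ (A.vir (-P)) (A.nth (-1) w) -
        lx * q * (q - 1) * A.pt₂ ρ (A.vir (-P)) (A.nth (-1) y) else 0) := by
    have hc : A.nth t x * A.vir (-q) - A.vir (-q) * A.nth t x =
        (t : ℂ) • A.nth (t - q) x + (if t = q then (-(lx * q * (q - 1) / 2)) • 1 else 0) := by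
      rw [← neg_sub, h.left, neg_add, neg_smul, neg_neg, show -q + t = t - q by ring]
      simp only [sub_eq_zero]
      congr 1
      split_ifs
      · rw [← neg_smul]
        congr 1
        push_cast
        ring
      · simp
    rw [hc, map_add, LinearMap.add_apply, map_add, map_add, map_smul, LinearMap.smul_apply,
      map_smul, map_smul, smul_eq_mul, hρ.pt_vir_diagAdd_nth h hP]
    rcases eq_or_ne t q with rfl | htq
    · simp only [lt_irrefl, sub_self, if_true, if_false, map_smul, LinearMap.smul_apply,
        diagAdd_one, pt₂, smul_eq_mul]
      norm_num
      ring
    · rw [if_neg htq, if_neg htq, if_neg (show t - q ≠ 0 by lia)]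
      simp only [show t - q < 0 ↔ t < q by lia, show t - q = -1 ↔ t + 1 = q by lia]
      push_cast
      split_ifs <;> simp <;> ring
  have e2 : ρ (diagSub (A.vir (-P)) (diagSub (A.vir (-q))
      (diagSub (A.nth t x) (diagSub (A.nth (-1) y) A.vac₂)))) =
      (if t = 0 then A.pt₂ (ρ ∘ₗ diagAdd (A.nth (-1) w)) (A.vir (-P)) (A.vir (-q)) +
        A.pt₂ ρ (A.vir (-P)) (A.nth (-1 - q) w) + A.pt₂ ρ (A.vir (-q)) (A.nth (-1 - P) w) else 0) +
      if t = 1 then 2 * k * A.pt₂ ρ (A.vir (-P)) (A.vir (-q)) else 0 := by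
    rw [h.nth_vac' ht, map_add, map_add, map_add]
    congr 1
    · split_ifs
      · rw [pt₂_diagAdd, h.bracket.vir_comm (by lia), h.bracket.vir_comm (by lia),
          pt₂_smul_left, pt₂_smul_right, show -P + -1 = -1 - P by ring,
          show -q + -1 = -1 - q by ring, ← hρ.pt₂_vir_comm h.bracket (m := -q) (by lia)]
        push_cast
        ring
      · simp
    · split_ifs
      · simp [pt₂]
      · simp
  rw [e1, e2]
  ring

/-- Among the negative Virasoro modes only L_{-2} = ω_(-1) survives on the left as an insertion;
L_{-1} is killed too. -/
theorem IsInvariant.pt_nth_diagAdd_vir (hρ : A.IsInvariant ρ) (h : A.IsCurrentPair x y w k lx ly)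
    {a i : ℤ} (ha : 1 ≤ a) :
    ρ (diagSub (A.nth (-a) x) (diagAdd (A.vir i) (diagSub (A.nth (-1) y) A.vac₂))) =
      (if i < 0 then -a * A.pt₂ ρ (A.nth (i - a) x) (A.nth (-1) y) else 0) +
      (if i = -2 then A.pt₂ (ρ ∘ₗ diagAdd (A.vir (-2))) (A.nth (-a) x) (A.nth (-1) y) else 0) +
      if i = 0 then A.pt₂ ρ (A.nth (-a) x) (A.nth (-1) y) else 0 := by
  rcases lt_or_ge i 0 with hi | hi
  · rw [diagSub_diagAdd, map_add, h.left.comm_vir (by lia), if_pos hi, if_neg hi.ne,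
      show i + -a = i - a by ring, map_smul, LinearMap.smul_apply, map_smul, smul_eq_mul, add_zero,
      add_comm]
    push_cast
    congr 1
    split_ifs with h1
    · subst h1
      rfl
    · exact hρ.vir (by lia) h1 _
  · rw [diagAdd_diagSub, A.diagAdd_vir_vac₂ (by lia), map_zero, zero_add, h.right, if_neg hi.not_gt,
      if_neg (show i ≠ -2 by lia), map_add, LinearMap.add_apply, map_add, map_smul, LinearMap.smul_apply]
    rcases eq_or_ne i 0 with rfl | h0
    · simp [pt₂]
    · rw [A.diagSub_nth_vac₂ _ (by lia), if_neg h0]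
      split_ifs
      · simp [diagSub_one]
      · simp

/-- The four-point functions `⟨x L L y⟩` with an annihilating mode of the first `L`. -/
theorem IsInvariant.pt₄_nth_vir_vir (hρ : A.IsInvariant ρ) (h : A.IsCurrentPair x y w k lx ly)
    {a j q : ℤ} (ha : 1 ≤ a) (hq : 2 ≤ q) (hj : -1 ≤ j) :
    A.pt₄ ρ (A.nth (-a) x) (A.vir j) (A.vir (-q)) (A.nth (-1) y) =
      (if j < q then -a * (j + q) * A.pt₂ ρ (A.nth (j - q - a) x) (A.nth (-1) y) else 0) +
      (if j + 2 = q then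
        (j + q) * A.pt₂ (ρ ∘ₗ diagAdd (A.vir (-2))) (A.nth (-a) x) (A.nth (-1) y) else 0) +
      (if j = q then (2 * q + A.centralCharge * (q ^ 3 - q) / 6) *
        A.pt₂ ρ (A.nth (-a) x) (A.nth (-1) y) else 0) +
      (if j = -1 then A.pt₂ ρ (A.vir (-q)) (A.nth (-a - 2) w) +
        2 * A.pt₂ ρ (A.nth (-a) x) (A.nth (-q - 2) y) else 0) +
      (if j = 0 then A.pt₂ (ρ ∘ₗ diagAdd (A.nth (-1) y)) (A.vir (-q)) (A.nth (-a) x) +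
        A.pt₂ ρ (A.vir (-q)) (A.nth (-a - 1) w) +
          A.pt₂ ρ (A.nth (-a) x) (A.nth (-q - 1) y) else 0) +
      if j = 1 then 2 * ly * A.pt₂ ρ (A.vir (-q)) (A.nth (-a) x) else 0 := by
  rw [pt₄, diagSub_diagSub (A.vir j), map_add, map_add]
  have e1 : ρ (diagSub (A.nth (-a) x) (diagAdd (A.vir j * A.vir (-q) - A.vir (-q) * A.vir j)
      (diagSub (A.nth (-1) y) A.vac₂))) =
      (if j < q then -a * (j + q) * A.pt₂ ρ (A.nth (j - q - a) x) (A.nth (-1) y) else 0) +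
      (if j + 2 = q then
        (j + q) * A.pt₂ (ρ ∘ₗ diagAdd (A.vir (-2))) (A.nth (-a) x) (A.nth (-1) y) else 0) +
      (if j = q then (2 * q + A.centralCharge * (q ^ 3 - q) / 6) *
        A.pt₂ ρ (A.nth (-a) x) (A.nth (-1) y) else 0) := by
    rw [A.vir_comm, map_add, LinearMap.add_apply, map_add, map_add, map_smul, LinearMap.smul_apply,
      map_smul, map_smul, smul_eq_mul, hρ.pt_nth_diagAdd_vir h ha, ← sub_eq_add_neg]
    simp only [sub_eq_zero]
    rcases eq_or_ne j q with rfl | hjq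
    · simp only [lt_irrefl, if_true, if_false, map_smul, LinearMap.smul_apply, sub_self,
        diagAdd_one, pt₂, smul_eq_mul]
      norm_num
      ring
    · rw [if_neg hjq, if_neg hjq, if_neg hjq]
      simp only [show j - q < 0 ↔ j < q by lia, show j - q = -2 ↔ j + 2 = q by lia]
      push_cast
      split_ifs <;> simp <;> ring
  have e2 : ρ (diagSub (A.nth (-a) x) (diagSub (A.vir (-q))
      (diagSub (A.vir j) (diagSub (A.nth (-1) y) A.vac₂)))) =
      (if j = -1 then A.pt₂ ρ (A.vir (-q)) (A.nth (-a - 2) w) +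
        2 * A.pt₂ ρ (A.nth (-a) x) (A.nth (-q - 2) y) else 0) +
      (if j = 0 then A.pt₂ (ρ ∘ₗ diagAdd (A.nth (-1) y)) (A.vir (-q)) (A.nth (-a) x) +
        A.pt₂ ρ (A.vir (-q)) (A.nth (-a - 1) w) +
          A.pt₂ ρ (A.nth (-a) x) (A.nth (-q - 1) y) else 0) +
      if j = 1 then 2 * ly * A.pt₂ ρ (A.vir (-q)) (A.nth (-a) x) else 0 := by
    rw [h.right.vir_vac hj]
    simp only [map_add]
    congr 1
    · congr 1
      · split_ifs
        · rw [pt₂_diagAdd, h.comm, if_neg (by lia), add_zero, h.right.vir_comm (by lia),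
            pt₂_smul_right, show -q + -2 = -q - 2 by ring, show -a + -2 = -a - 2 by ring,
            hρ.pt₂_vir_comm h.bracket (by lia)]
          rw [show A.pt₂ (ρ ∘ₗ diagAdd (A.nth (-2) y)) (A.nth (-a) x) (A.vir (-q)) = 0 from
            hρ.nth _ _ _ le_rfl]
          push_cast
          ring
        · simp
      · split_ifs
        · rw [pt₂_diagAdd, h.comm, if_neg (by lia), add_zero, h.right.vir_comm (by lia),
            pt₂_smul_right, show -q + -1 = -q - 1 by ring, show -a + -1 = -a - 1 by ring,
            hρ.pt₂_vir_comm h.bracket (by lia), (hρ.comp y).pt₂_vir_comm h.left (by lia)]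
          push_cast
          ring
        · simp
    · split_ifs
      · simp only [map_smul, smul_eq_mul]
        rw [hρ.pt₂_vir_comm h.left (by lia)]
        rfl
      · simp
  rw [e1, e2]
  ring

/-- The four-point functions `⟨L L x y⟩` with an annihilating mode of the second `L`. -/
theorem IsInvariant.pt₄_vir_vir_nth (hρ : A.IsInvariant ρ) (h : A.IsCurrentPair x y w k lx ly)
    {B j α : ℤ} (hB : 2 ≤ B) (hα : 1 ≤ α) (hj : -1 ≤ j) :
    A.pt₄ ρ (A.vir (-B)) (A.vir j) (A.nth (-α) x) (A.nth (-1) y) =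
      (if j < α then α * (α - j) * A.pt₂ ρ (A.nth (j - α - B) x) (A.nth (-1) y) else 0) +
      (if j + 1 = α then
        α * A.pt₂ (ρ ∘ₗ diagAdd (A.nth (-1) x)) (A.vir (-B)) (A.nth (-1) y) else 0) +
      (if j = α then α * A.pt₂ ρ (A.vir (-B)) (A.nth (-1) w) +
        lx * (α + 1) * α * A.pt₂ ρ (A.vir (-B)) (A.nth (-1) y) else 0) +
      (if j = -1 then A.pt₂ ρ (A.vir (-B)) (A.nth (-α - 2) w) +
        2 * A.pt₂ ρ (A.nth (-α) x) (A.nth (-B - 2) y) else 0) +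
      (if j = 0 then A.pt₂ (ρ ∘ₗ diagAdd (A.nth (-1) y)) (A.vir (-B)) (A.nth (-α) x) +
        A.pt₂ ρ (A.nth (-α) x) (A.nth (-B - 1) y) +
          A.pt₂ ρ (A.vir (-B)) (A.nth (-α - 1) w) else 0) +
      if j = 1 then 2 * ly * A.pt₂ ρ (A.vir (-B)) (A.nth (-α) x) else 0 := by
  rw [pt₄, diagSub_diagSub (A.vir j), map_add, map_add]
  have e1 : ρ (diagSub (A.vir (-B)) (diagAdd (A.vir j * A.nth (-α) x - A.nth (-α) x * A.vir j)
      (diagSub (A.nth (-1) y) A.vac₂))) =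
      (if j < α then α * (α - j) * A.pt₂ ρ (A.nth (j - α - B) x) (A.nth (-1) y) else 0) +
      (if j + 1 = α then
        α * A.pt₂ (ρ ∘ₗ diagAdd (A.nth (-1) x)) (A.vir (-B)) (A.nth (-1) y) else 0) +
      (if j = α then α * A.pt₂ ρ (A.vir (-B)) (A.nth (-1) w) +
        lx * (α + 1) * α * A.pt₂ ρ (A.vir (-B)) (A.nth (-1) y) else 0) := by
    rw [h.left, map_add, LinearMap.add_apply, map_add, map_add, map_smul, LinearMap.smul_apply,
      map_smul, map_smul, smul_eq_mul, hρ.pt_vir_diagAdd_nth h hB, ← sub_eq_add_neg]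
    simp only [sub_eq_zero]
    rcases eq_or_ne j α with rfl | hjq
    · simp only [lt_irrefl, if_true, if_false, map_smul, LinearMap.smul_apply, sub_self,
        diagAdd_one, pt₂, smul_eq_mul]
      norm_num
      ring
    · rw [if_neg hjq, if_neg hjq, if_neg hjq]
      simp only [show j - α < 0 ↔ j < α by lia, show j - α = -1 ↔ j + 1 = α by lia]
      push_cast
      split_ifs <;> simp <;> ring
  have e2 : ρ (diagSub (A.vir (-B)) (diagSub (A.nth (-α) x)
      (diagSub (A.vir j) (diagSub (A.nth (-1) y) A.vac₂)))) =
      (if j = -1 then A.pt₂ ρ (A.vir (-B)) (A.nth (-α - 2) w) +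
        2 * A.pt₂ ρ (A.nth (-α) x) (A.nth (-B - 2) y) else 0) +
      (if j = 0 then A.pt₂ (ρ ∘ₗ diagAdd (A.nth (-1) y)) (A.vir (-B)) (A.nth (-α) x) +
        A.pt₂ ρ (A.nth (-α) x) (A.nth (-B - 1) y) +
          A.pt₂ ρ (A.vir (-B)) (A.nth (-α - 1) w) else 0) +
      if j = 1 then 2 * ly * A.pt₂ ρ (A.vir (-B)) (A.nth (-α) x) else 0 := by
    rw [h.right.vir_vac hj]
    simp only [map_add]
    congr 1
    · congr 1
      · split_ifs
        · rw [pt₂_diagAdd, h.comm, if_neg (by lia), add_zero, h.right.vir_comm (by lia),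
            pt₂_smul_left, show -B + -2 = -B - 2 by ring, show -α + -2 = -α - 2 by ring,
            ← hρ.pt₂_comm h (by lia)]
          rw [show A.pt₂ (ρ ∘ₗ diagAdd (A.nth (-2) y)) (A.vir (-B)) (A.nth (-α) x) = 0 from
            hρ.nth _ _ _ le_rfl]
          push_cast
          ring
        · simp
      · split_ifs
        · rw [pt₂_diagAdd, h.comm, if_neg (by lia), add_zero, h.right.vir_comm (by lia),
            pt₂_smul_left, show -B + -1 = -B - 1 by ring, show -α + -1 = -α - 1 by ring,
            ← hρ.pt₂_comm h (by lia)]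
          push_cast
          ring
        · simp
    · split_ifs
      · simp only [map_smul, smul_eq_mul]
        rfl
      · simp
  rw [e1, e2]
  ring

/-- Exchanging the middle operators of `⟨L x L y⟩`. -/
theorem IsInvariant.pt₄_swap (hρ : A.IsInvariant ρ) (hx : A.IsCurrent x lx) {P α q : ℤ}
    (hα : 1 ≤ α) (hq : 2 ≤ q) (hP : 2 ≤ P) :
    A.pt₄ ρ (A.vir (-P)) (A.nth (-α) x) (A.vir (-q)) (A.nth (-1) y) =
      A.pt₄ ρ (A.vir (-P)) (A.vir (-q)) (A.nth (-α) x) (A.nth (-1) y) -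
        α * (α + q) * A.pt₂ ρ (A.nth (-α - q - P) x) (A.nth (-1) y) := by
  rw [pt₄, diagSub_diagSub (A.nth (-α) x), map_add, map_add, hx.comm_vir (by lia), map_smul,
    LinearMap.smul_apply, map_smul, map_smul, diagSub_diagAdd, map_add, hρ.nth _ _ _ (by lia),
    hx.vir_comm (by lia), map_smul, LinearMap.smul_apply, map_smul,
    show -P + (-q + -α) = -α - q - P by ring]
  simp only [smul_eq_mul]
  push_cast
  rw [pt₄, pt₂]
  ring

theorem IsInvariant.pt₄_vir_vir_comm (hρ : A.IsInvariant ρ) {P q : ℤ} (hq : 2 ≤ q) (hP : 2 ≤ P)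
    (x y : V) (α : ℤ) :
    A.pt₄ ρ (A.vir (-P)) (A.vir (-q)) (A.nth (-α) x) (A.nth (-1) y) =
      A.pt₄ ρ (A.vir (-q)) (A.vir (-P)) (A.nth (-α) x) (A.nth (-1) y) := by
  rw [pt₄, diagSub_diagSub, map_add, A.vir_comm, if_neg (by lia), add_zero, map_smul,
    LinearMap.smul_apply, map_smul, hρ.vir (by lia) (by lia), smul_zero, add_zero]
  rfl

end FourPoint

end VertexOperatorAlgebra

namespace VertexOperatorAlgebra

variable {V : Type*} [AddCommGroup V] [Module ℂ V] {A : VertexOperatorAlgebra V}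

/-! ### Normally ordered products in four-point functions -/

section Relations

theorem ite_zero_congr {p q : Prop} [Decidable p] [Decidable q] {a b : ℂ} (h : p ↔ q)
    (hab : q → a = b) : (if p then a else 0) = if q then b else 0 := by
  by_cases hq : q
  · rw [if_pos (h.2 hq), if_pos hq, hab hq]
  · rw [if_neg (fun hp => hq (h.1 hp)), if_neg hq]

/-- This is the shape of every annihilating half of a normally ordered product: a generic range
multiplying one two-point function, plus at most five exceptional indices. -/
theorem sum_mul_ite (g f : ℕ → ℂ) (F c₁ c₂ c₃ c₄ c₅ : ℂ) {N n a₁ a₂ a₃ a₄ a₅ : ℕ} (h : n ≤ N)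
    (h₁ : a₁ < N) (h₂ : a₂ < N) (h₃ : a₃ < N) (h₄ : a₄ < N) (h₅ : a₅ < N) :
    ∑ t ∈ Finset.range N, g t * ((if t < n then f t * F else 0) + (if t = a₁ then c₁ else 0) +
      (if t = a₂ then c₂ else 0) + (if t = a₃ then c₃ else 0) + (if t = a₄ then c₄ else 0) +
      if t = a₅ then c₅ else 0) =
    (∑ t ∈ Finset.range n, g t * f t) * F + g a₁ * c₁ + g a₂ * c₂ + g a₃ * c₃ + g a₄ * c₄ +
      g a₅ * c₅ := by
  have h0 : ∑ t ∈ Finset.range N, g t * (if t < n then f t * F else 0) =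
      (∑ t ∈ Finset.range n, g t * f t) * F := by
    rw [Finset.sum_mul, ← Finset.sum_subset (Finset.range_subset_range.2 h)]
    · exact Finset.sum_congr rfl fun t ht => by rw [if_pos (Finset.mem_range.1 ht), mul_assoc]
    · intro t _ ht
      rw [if_neg (by simpa using ht), mul_zero]
  simp only [mul_add, Finset.sum_add_distrib, h0]
  simp [h₁, h₂, h₃, h₄, h₅]

variable {ρ : V ⊗[ℂ] V →ₗ[ℂ] ℂ} {x y w : V} {k lx ly : ℂ}

/-- The coefficient `(-1)^j (z + j - 1 choose j)`. -/
noncomputable def rightCoeff (j : ℕ) (z : ℂ) : ℂ :=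
  (-1) ^ j * ((∏ i ∈ Finset.range j, (z + i)) / j.factorial)

/-- The coefficient `(-1)^n (n + j choose j)`. -/
noncomputable def leftCoeff (j n : ℕ) : ℂ :=
  (-1) ^ n * ((∏ i ∈ Finset.range j, ((n : ℂ) + 1 + i)) / j.factorial)

theorem IsInvariant.pt₂_right (hρ : A.IsInvariant ρ) (hx : A.IsCurrent x lx)
    (hy : A.IsCurrent y ly) (j : ℕ) {m n M : ℤ} (hn : n = -1 - j) (hM : M = -m + j) :
    A.pt₂ ρ (A.nth m x) (A.nth n y) =
      rightCoeff j (-m) * A.pt₂ ρ (A.nth (-M) x) (A.nth (-1) y) := by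
  have h := IsPrimaryPair.right (t := 0) (s := 0)
    (by simpa using hρ.isPrimaryPair hx hy) j (-m)
  simp only [zero_add, sub_zero, neg_neg, Int.cast_neg, neg_add' (1 : ℤ)] at h
  rw [hn, hM, rightCoeff, h]

theorem IsInvariant.pt₂_vir_right (hρ : A.IsInvariant ρ) (hy : A.IsCurrent y ly) (j : ℕ)
    {m n M : ℤ} (hn : n = -1 - j) (hM : M = -m + j) :
    A.pt₂ ρ (A.vir m) (A.nth n y) =
      rightCoeff j (-m - 1) * A.pt₂ ρ (A.vir (-M)) (A.nth (-1) y) := by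
  have h := IsPrimaryPair.right (t := 0) (s := 1)
    (by simpa using hρ.isPrimaryPair_vir hy) j (-m)
  simp only [zero_add, neg_neg, Int.cast_neg, neg_add' (1 : ℤ)] at h
  rw [hn, hM, rightCoeff, h]

theorem IsInvariant.pt₂_vir_vir_right (hρ : A.IsInvariant ρ) (j : ℕ)
    {m n M : ℤ} (hn : n = -2 - j) (hM : M = -m + j) :
    A.pt₂ ρ (A.vir m) (A.vir n) =
      rightCoeff j (-m - 1) * A.pt₂ ρ (A.vir (-M)) (A.vir (-2)) := by
  have h := IsPrimaryPair.right (t := 1) (s := 1)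
    (by simpa using hρ.isPrimaryPair_vir_vir) j (-m)
  simp only [one_add_one_eq_two, neg_neg, Int.cast_neg, neg_add' (2 : ℤ)] at h
  rw [hn, hM, rightCoeff, h]

theorem IsInvariant.pt₂_vir_left (hρ : A.IsInvariant ρ) (hy : A.IsCurrent y ly) (j n : ℕ)
    {m m' M : ℤ} (hm : m = -2 - j) (hn : m' = -1 - n) (hM : M = 2 + j + n) :
    A.pt₂ ρ (A.vir m) (A.nth m' y) =
      leftCoeff j n * A.pt₂ ρ (A.vir (-M)) (A.nth (-1) y) := by
  have h := IsPrimaryPair.left (s := 1) (by simpa using hρ.isPrimaryPair_vir hy) j n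
  rw [hm, hn, hM, leftCoeff, ← show (1 : ℤ) + 1 + j + n = 2 + j + n by ring, ← h]
  congr 2 <;> congr 1 <;> ring_nf

theorem IsCurrent.diagAdd_vir_eq_zero (hy : A.IsCurrent y ly) {m : ℤ} (hm : 1 ≤ m) :
    diagAdd (A.vir m) (diagSub (A.nth (-1) y) A.vac₂) = 0 := by
  rw [diagAdd_diagSub, A.diagAdd_vir_vac₂ (by lia), map_zero, zero_add, hy, map_add,
    LinearMap.add_apply, map_smul, LinearMap.smul_apply, A.diagSub_nth_vac₂ _ (by lia), smul_zero,
    zero_add]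
  split_ifs <;> simp [diagSub_one]

theorem IsCurrent.diagSub_vir_vir_eq_zero (hy : A.IsCurrent y ly) {m q : ℤ} (hq : 2 ≤ q)
    (hm : q + 1 ≤ m) :
    diagSub (A.vir m) (diagSub (A.vir (-q)) (diagSub (A.nth (-1) y) A.vac₂)) = 0 := by
  rw [diagSub_diagSub, hy.vir_vac (by lia), A.vir_comm, if_neg (by lia), if_neg (by lia),
    if_neg (by lia), if_neg (by lia), add_zero (_ • _), map_smul,
    LinearMap.smul_apply, hy.diagAdd_vir_eq_zero (by lia)]
  simp

theorem IsCurrentPair.diagSub_nth_vir_eq_zero (h : A.IsCurrentPair x y w k lx ly) {m q : ℤ}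
    (hq : 2 ≤ q) (hm : q + 2 ≤ m) :
    diagSub (A.nth m x) (diagSub (A.vir (-q)) (diagSub (A.nth (-1) y) A.vac₂)) = 0 := by
  rw [diagSub_diagSub, h.nth_vac' (by lia), h.left.comm_vir (by lia), map_smul,
    LinearMap.smul_apply, h.nth_vac (by lia), if_neg (by lia), if_neg (by lia), if_neg (by lia)]
  simp

theorem IsCurrentPair.diagSub_vir_nth_eq_zero (h : A.IsCurrentPair x y w k lx ly) {m α : ℤ}
    (hα : 1 ≤ α) (hm : α + 1 ≤ m) :
    diagSub (A.vir m) (diagSub (A.nth (-α) x) (diagSub (A.nth (-1) y) A.vac₂)) = 0 := by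
  rw [diagSub_diagSub, h.right.vir_vac (by lia), h.left.vir_comm (by lia), map_smul,
    LinearMap.smul_apply, h.nth_vac (by lia), if_neg (by lia), if_neg (by lia), if_neg (by lia),
    if_neg (by lia)]
  simp

variable (A) in
/-- The functional on `V ⊗ V` induced by one on `T^2(V)^{S_2} / C_2`. -/
noncomputable def ev (φ : Module.Dual ℂ (orbifold V ⧸ A.orbifoldC2)) : V ⊗[ℂ] V →ₗ[ℂ] ℂ :=
  φ ∘ₗ A.coinv

variable {φ : Module.Dual ℂ (orbifold V ⧸ A.orbifoldC2)}

theorem isInvariant_ev : A.IsInvariant (A.ev φ) := A.isInvariant_coinv.map φ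

variable (A φ) in
theorem ev_normalOrder (a b : V) (e : V ⊗[ℂ] V) {n : ℤ} (hn : n ≤ -2) (N : ℕ)
    (ha : ∀ k : ℤ, N ≤ k → diagSub (A.nth k a) e = 0)
    (hb : ∀ k : ℤ, n + N ≤ k → diagSub (A.nth k b) e = 0) :
    ∑ s ∈ Finset.range N, A.ev φ (diagSub (A.nth (-1 - s) a) (diagSub (A.nth (n + s) b) e)) +
      ∑ s ∈ Finset.range N,
        A.ev φ (diagSub (A.nth (n - 1 - s) b) (diagSub (A.nth s a) e)) = 0 := by
  have h := congrArg φ (A.coinv_normalOrder a b e hn N ha hb)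
  simpa [ev] using h

set_option maxHeartbeats 800000 in
/-- The normally ordered product of (a derivative of) the Virasoro field and a derivative of the
current `x`, applied to `L_(-q) y_(-1) 1`. -/
theorem IsCurrentPair.normalOrder_vir_nth (h : A.IsCurrentPair x y w k lx ly) {a b : V}
    {um up vm vp : ℕ → ℂ} {i : ℕ} (hi : i ≤ 1) (α c : ℕ)
    (hum : ∀ s : ℕ, A.nth (-1 - s) a = um s • A.vir (-2 - i - s))
    (hup : ∀ s : ℕ, A.nth s a = up s • A.vir (s - 1 - i)) (hup0 : ∀ s : ℕ, s < i → up s = 0)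
    (hvm : ∀ s : ℕ, A.nth (-1 - s) b = vm s • A.nth (-1 - α - s) x)
    (hvp : ∀ s : ℕ, A.nth (α + s) b = vp s • A.nth s x)
    (hvp0 : ∀ s : ℕ, s < α → A.nth s b = 0) {M : ℤ} (hM : M = α + i + c + 6) :
    um 0 * vm 1 *
      (A.pt₄ (A.ev φ) (A.vir (-(i + 2))) (A.vir (-(c + 2))) (A.nth (-(α + 2)) x) (A.nth (-1) y) -
        (α + 2) * (α + c + 4) * A.pt₂ (A.ev φ) (A.nth (-M) x) (A.nth (-1) y)) +
    um 1 * vm 0 *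
      (A.pt₄ (A.ev φ) (A.vir (-(i + 3))) (A.vir (-(c + 2))) (A.nth (-(α + 1)) x) (A.nth (-1) y) -
        (α + 1) * (α + c + 3) * A.pt₂ (A.ev φ) (A.nth (-M) x) (A.nth (-1) y)) +
    ((∑ t ∈ Finset.range (c + 2), um (α + 2 + t) * vp t * (t * (c + 2 - t))) *
        A.pt₂ (A.ev φ) (A.nth (-M) x) (A.nth (-1) y) +
      um (α + 2 + (c + 1)) * vp (c + 1) * ((c + 1) *
        A.pt₂ (A.ev φ ∘ₗ diagAdd (A.nth (-1) x)) (A.vir (-(M - 1))) (A.nth (-1) y)) +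
      um (α + 2 + (c + 2)) * vp (c + 2) *
        ((c + 2) * A.pt₂ (A.ev φ) (A.vir (-M)) (A.nth (-1) w) -
        lx * (c + 2) * (c + 1) * A.pt₂ (A.ev φ) (A.vir (-M)) (A.nth (-1) y)) +
      um (α + 2) * vp 0 * (rightCoeff c (α + i + 3) *
        A.pt₂ (A.ev φ ∘ₗ diagAdd (A.nth (-1) w)) (A.vir (-(M - 2))) (A.vir (-2)) +
        (rightCoeff (c + 2) (α + i + 3) + leftCoeff c (α + i + 4)) *
          A.pt₂ (A.ev φ) (A.vir (-M)) (A.nth (-1) w)) +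
      um (α + 2 + 1) * vp 1 * (2 * k * (rightCoeff c (α + i + 4) *
        A.pt₂ (A.ev φ) (A.vir (-(M - 1))) (A.vir (-2))))) +
    ((∑ j ∈ Finset.range (c + 3), vm (i + 2 + j) * up (i + j) *
        (-(α + 3 + i + j) * (j + c + 1))) * A.pt₂ (A.ev φ) (A.nth (-M) x) (A.nth (-1) y) +
      vm (i + 2 + (c + 1)) * up (i + (c + 1)) * ((2 * c + 2) *
        A.pt₂ (A.ev φ ∘ₗ diagAdd (A.vir (-2))) (A.nth (-(M - 2)) x) (A.nth (-1) y)) +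
      vm (i + 2 + (c + 3)) * up (i + (c + 3)) * ((2 * (c + 2) +
        A.centralCharge * ((c + 2) ^ 3 - (c + 2)) / 6) *
          A.pt₂ (A.ev φ) (A.nth (-M) x) (A.nth (-1) y)) +
      vm (i + 2) * up i * (leftCoeff c (α + i + 4) * A.pt₂ (A.ev φ) (A.vir (-M)) (A.nth (-1) w) +
        2 * rightCoeff (c + 3) (α + 3 + i) * A.pt₂ (A.ev φ) (A.nth (-M) x) (A.nth (-1) y)) +
      vm (i + 2 + 1) * up (i + 1) * (leftCoeff c (α + i + 3) *
        A.pt₂ (A.ev φ ∘ₗ diagAdd (A.nth (-1) y)) (A.vir (-(M - 1))) (A.nth (-1) x) +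
        leftCoeff c (α + i + 4) * A.pt₂ (A.ev φ) (A.vir (-M)) (A.nth (-1) w) +
        rightCoeff (c + 2) (α + 4 + i) * A.pt₂ (A.ev φ) (A.nth (-M) x) (A.nth (-1) y)) +
      vm (i + 2 + 2) * up (i + 2) * (2 * ly * (leftCoeff c (α + i + 4) *
        A.pt₂ (A.ev φ) (A.vir (-M)) (A.nth (-1) x)))) = 0 := by
  have hρ := isInvariant_ev (A := A) (φ := φ)
  -- In the applications a is ω (i = 0) or L_{-1}ω (i = 1), and b = x_(-1-α)1. The cut-off is not
  -- sharp; its form prepares the splitting of the sum at α+2.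
  have hNO := A.ev_normalOrder φ a b
    (diagSub (A.vir (-(c + 2))) (diagSub (A.nth (-1) y) A.vac₂)) (n := -2) le_rfl
    (α + 2 + (c + 9))
    (fun m hm => by
      lift m to ℕ using by lia
      rw [hup, map_smul, LinearMap.smul_apply,
        h.right.diagSub_vir_vir_eq_zero (by lia) (by lia), smul_zero])
    (fun m hm => by
      obtain ⟨s, rfl⟩ : ∃ s : ℕ, m = α + s := ⟨(m - α).toNat, by lia⟩
      rw [hvp, map_smul, LinearMap.smul_apply,
        h.diagSub_nth_vir_eq_zero (by lia) (by lia), smul_zero])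
  refine Eq.trans (congrArg₂ (· + ·) (Eq.symm ?_) (Eq.symm ?_)) hNO
  · clear hNO
    have e1 : ∀ t : ℕ, A.pt₄ (A.ev φ) (A.vir (-(α + i + 4 + t : ℤ))) (A.nth t x)
        (A.vir (-(c + 2))) (A.nth (-1) y) =
        (if t < c + 2 then t * (c + 2 - t) * A.pt₂ (A.ev φ) (A.nth (-M) x) (A.nth (-1) y)
          else 0) +
        (if t = c + 1 then (c + 1) *
          A.pt₂ (A.ev φ ∘ₗ diagAdd (A.nth (-1) x)) (A.vir (-(M - 1))) (A.nth (-1) y) else 0) +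
        (if t = c + 2 then (c + 2) * A.pt₂ (A.ev φ) (A.vir (-M)) (A.nth (-1) w) -
          lx * (c + 2) * (c + 1) * A.pt₂ (A.ev φ) (A.vir (-M)) (A.nth (-1) y) else 0) +
        (if t = 0 then rightCoeff c (α + i + 3) *
          A.pt₂ (A.ev φ ∘ₗ diagAdd (A.nth (-1) w)) (A.vir (-(M - 2))) (A.vir (-2)) +
          (rightCoeff (c + 2) (α + i + 3) + leftCoeff c (α + i + 4)) *
            A.pt₂ (A.ev φ) (A.vir (-M)) (A.nth (-1) w) else 0) +
        (if t = 1 then 2 * k * (rightCoeff c (α + i + 4) *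
          A.pt₂ (A.ev φ) (A.vir (-(M - 1))) (A.vir (-2))) else 0) +
        (if t = 0 then 0 else 0) := by
      intro t
      rw [hρ.pt₄_vir_nth_vir h (by lia) (by lia) (by lia), ite_self, add_zero]
      refine congrArg₂ (· + ·) (congrArg₂ (· + ·) (congrArg₂ (· + ·) (congrArg₂ (· + ·)
        (ite_zero_congr (by lia) fun ht => ?_) (ite_zero_congr (by lia) fun ht => ?_))
        (ite_zero_congr (by lia) fun ht => ?_)) (ite_zero_congr (by lia) fun ht => ?_))
        (ite_zero_congr (by lia) fun ht => ?_)
      · rw [show (t : ℤ) - (c + 2) - (α + i + 4 + t) = -M by lia]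
        push_cast
        ring
      · rw [show (α + i + 4 + t : ℤ) = M - 1 by lia, ht]
        push_cast
        ring
      · rw [show (α + i + 4 + t : ℤ) = M by lia]
        push_cast
        ring
      · subst ht
        rw [(hρ.comp w).pt₂_vir_vir_right c (M := M - 2) (by ring) (by push_cast; lia),
          hρ.pt₂_vir_right h.bracket (c + 2) (M := M) (by push_cast; ring) (by push_cast; lia),
          hρ.pt₂_vir_left h.bracket c (α + i + 4) (M := M) (m := -(c + 2))
            (m' := -1 - (α + i + 4 + (0 : ℕ))) (by ring) (by push_cast; ring)
            (by push_cast; lia)]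
        push_cast
        ring_nf
      · subst ht
        rw [hρ.pt₂_vir_vir_right c (M := M - 1) (by ring) (by push_cast; lia)]
        push_cast
        ring_nf
    have e2 : ∀ t : ℕ, A.ev φ (diagSub (A.nth (-1 - (α + 2 + t : ℕ)) a)
        (diagSub (A.nth (-2 + (α + 2 + t : ℕ)) b)
          (diagSub (A.vir (-(c + 2))) (diagSub (A.nth (-1) y) A.vac₂)))) =
        um (α + 2 + t) * vp t * A.pt₄ (A.ev φ) (A.vir (-(α + i + 4 + t : ℤ))) (A.nth t x)
          (A.vir (-(c + 2))) (A.nth (-1) y) := by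
      intro t
      rw [hum, show (-2 + ((α + 2 + t : ℕ) : ℤ)) = α + t by push_cast; ring, hvp]
      simp only [map_smul, LinearMap.smul_apply, smul_eq_mul, pt₄]
      rw [show (-2 - (i : ℤ) - (α + 2 + t : ℕ)) = -(α + i + 4 + t) by push_cast; ring]
      ring
    -- The mode of b is -2+s: creating for s = 0, 1, zero for 2 ≤ s < α+2, and a multiple of x_(t)
    -- for s = α+2+t.
    rw [Finset.sum_range_add]
    refine congrArg₂ (· + ·) ?_ ?_
    · rw [Finset.sum_range_succ', Finset.sum_range_succ',
        Finset.sum_eq_zero (fun s hs => ?_), zero_add, add_comm]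
      · rw [hum, hum, show (-2 + ((0 : ℕ) : ℤ)) = -1 - (1 : ℕ) by norm_num,
          show (-2 + ((0 + 1 : ℕ) : ℤ)) = -1 - (0 : ℕ) by norm_num, hvm, hvm]
        simp only [map_smul, LinearMap.smul_apply, smul_eq_mul]
        refine congrArg₂ (· + ·) ?_ ?_
        · have h4 := hρ.pt₄_swap h.left (P := i + 2) (α := α + 2) (q := c + 2) (y := y) (by lia)
            (by lia) (by lia)
          rw [show (-(α + 2 : ℤ) - (c + 2) - (i + 2)) = -M by lia] at h4
          rw [← pt₄, show (-2 - (i : ℤ) - (0 : ℕ)) = -(i + 2) by push_cast; ring,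
            show (-1 - (α : ℤ) - (1 : ℕ)) = -(α + 2) by push_cast; ring, h4]
          push_cast
          ring
        · have h4 := hρ.pt₄_swap h.left (P := i + 3) (α := α + 1) (q := c + 2) (y := y) (by lia)
            (by lia) (by lia)
          rw [show (-(α + 1 : ℤ) - (c + 2) - (i + 3)) = -M by lia] at h4
          rw [← pt₄, show (-2 - (i : ℤ) - (0 + 1 : ℕ)) = -(i + 3) by push_cast; ring,
            show (-1 - (α : ℤ) - (0 : ℕ)) = -(α + 1) by push_cast; ring, h4]
          norm_num
          ring
      · rw [show (-2 + ((s + 1 + 1 : ℕ) : ℤ)) = s by push_cast; ring,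
          hvp0 s (Finset.mem_range.1 hs)]
        simp
    · simp only [e2, e1]
      refine (sum_mul_ite (fun t : ℕ => um (α + 2 + t) * vp t)
        (fun t : ℕ => (t : ℂ) * (c + 2 - t)) _ _ _ _ _ _ (by lia) (by lia) (by lia) (by lia)
        (by lia) (by lia)).trans ?_
      simp only [add_zero]
      ring
  · clear hNO
    have e1 : ∀ j : ℕ, A.pt₄ (A.ev φ) (A.nth (-(α + 3 + i + j)) x) (A.vir (j - 1))
        (A.vir (-(c + 2))) (A.nth (-1) y) =
        (if j < c + 3 then -(α + 3 + i + j) * (j + c + 1) *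
          A.pt₂ (A.ev φ) (A.nth (-M) x) (A.nth (-1) y) else 0) +
        (if j = c + 1 then (2 * c + 2) *
          A.pt₂ (A.ev φ ∘ₗ diagAdd (A.vir (-2))) (A.nth (-(M - 2)) x) (A.nth (-1) y) else 0) +
        (if j = c + 3 then (2 * (c + 2) + A.centralCharge * ((c + 2) ^ 3 - (c + 2)) / 6) *
          A.pt₂ (A.ev φ) (A.nth (-M) x) (A.nth (-1) y) else 0) +
        (if j = 0 then leftCoeff c (α + i + 4) * A.pt₂ (A.ev φ) (A.vir (-M)) (A.nth (-1) w) +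
          2 * rightCoeff (c + 3) (α + 3 + i) * A.pt₂ (A.ev φ) (A.nth (-M) x) (A.nth (-1) y)
            else 0) +
        (if j = 1 then leftCoeff c (α + i + 3) *
          A.pt₂ (A.ev φ ∘ₗ diagAdd (A.nth (-1) y)) (A.vir (-(M - 1))) (A.nth (-1) x) +
          leftCoeff c (α + i + 4) * A.pt₂ (A.ev φ) (A.vir (-M)) (A.nth (-1) w) +
          rightCoeff (c + 2) (α + 4 + i) * A.pt₂ (A.ev φ) (A.nth (-M) x) (A.nth (-1) y) else 0) +
        (if j = 2 then 2 * ly * (leftCoeff c (α + i + 4) *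
          A.pt₂ (A.ev φ) (A.vir (-M)) (A.nth (-1) x)) else 0) := by
      intro j
      rw [hρ.pt₄_nth_vir_vir h (by lia) (by lia) (by lia)]
      refine congrArg₂ (· + ·) (congrArg₂ (· + ·) (congrArg₂ (· + ·) (congrArg₂ (· + ·)
        (congrArg₂ (· + ·)
        (ite_zero_congr (by lia) fun ht => ?_) (ite_zero_congr (by lia) fun ht => ?_))
        (ite_zero_congr (by lia) fun ht => ?_)) (ite_zero_congr (by lia) fun ht => ?_))
        (ite_zero_congr (by lia) fun ht => ?_)) (ite_zero_congr (by lia) fun ht => ?_)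
      · rw [show (j : ℤ) - 1 - (c + 2) - (α + 3 + i + j) = -M by lia]
        push_cast
        ring
      · rw [show (α + 3 + i + j : ℤ) = M - 2 by lia, ht]
        push_cast
        ring
      · rw [show (α + 3 + i + j : ℤ) = M by lia]
        push_cast
        ring
      · subst ht
        rw [hρ.pt₂_right h.left h.right (c + 3) (M := M) (by push_cast; ring) (by push_cast; lia),
          hρ.pt₂_vir_left h.bracket c (α + i + 4) (M := M) (m := -(c + 2))
            (m' := -(α + 3 + i + (0 : ℕ)) - 2) (by ring) (by push_cast; ring) (by push_cast; lia)]
        push_cast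
        ring_nf
      · subst ht
        rw [hρ.pt₂_right h.left h.right (c + 2) (M := M) (by push_cast; ring) (by push_cast; lia),
          hρ.pt₂_vir_left h.bracket c (α + i + 4) (M := M) (m := -(c + 2))
            (m' := -(α + 3 + i + (1 : ℕ)) - 1) (by ring) (by push_cast; ring) (by push_cast; lia),
          (hρ.comp y).pt₂_vir_left h.left c (α + i + 3) (M := M - 1) (m := -(c + 2))
            (m' := -(α + 3 + i + (1 : ℕ))) (by ring) (by push_cast; ring) (by push_cast; lia)]
        push_cast
        ring_nf
      · subst ht
        rw [hρ.pt₂_vir_left h.left c (α + i + 4) (M := M) (m := -(c + 2))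
            (m' := -(α + 3 + i + (2 : ℕ))) (by ring) (by push_cast; ring) (by push_cast; lia)]
    have e2 : ∀ j : ℕ, A.ev φ (diagSub (A.nth (-2 - 1 - (i + j : ℕ)) b)
        (diagSub (A.nth (i + j : ℕ) a)
          (diagSub (A.vir (-(c + 2))) (diagSub (A.nth (-1) y) A.vac₂)))) =
        vm (i + 2 + j) * up (i + j) * A.pt₄ (A.ev φ) (A.nth (-(α + 3 + i + j)) x) (A.vir (j - 1))
          (A.vir (-(c + 2))) (A.nth (-1) y) := by
      intro t
      rw [hup, show (-2 - 1 - ((i + t : ℕ) : ℤ)) = -1 - (i + 2 + t : ℕ) by push_cast; ring, hvm]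
      simp only [map_smul, LinearMap.smul_apply, smul_eq_mul, pt₄]
      rw [show (-1 - (α : ℤ) - (i + 2 + t : ℕ)) = -(α + 3 + i + t) by push_cast; ring,
        show (((i + t : ℕ) : ℤ) - 1 - i) = t - 1 by push_cast; ring]
      ring
    -- The modes a_(s) with s < i vanish, so the sum starts at s = i, where L_{-1} appears.
    rw [show α + 2 + (c + 9) = i + (α + c + 11 - i) by lia, Finset.sum_range_add,
      Finset.sum_eq_zero (fun s hs => ?_), zero_add]
    · simp only [e2, e1]
      refine (sum_mul_ite (fun j : ℕ => vm (i + 2 + j) * up (i + j))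
        (fun j : ℕ => -(α + 3 + i + j : ℂ) * (j + c + 1)) _ _ _ _ _ _ (by lia) (by lia) (by lia)
        (by lia) (by lia) (by lia)).trans ?_
      simp only [add_zero]
    · rw [hup, hup0 s (Finset.mem_range.1 hs), zero_smul]
      simp

end Relations

end VertexOperatorAlgebra

namespace VertexOperatorAlgebra

variable {V : Type*} [AddCommGroup V] [Module ℂ V] {A : VertexOperatorAlgebra V}

section Relations

variable {x y w : V} {k lx ly : ℂ} {φ : Module.Dual ℂ (orbifold V ⧸ A.orbifoldC2)}

/-- The normally ordered square of (a derivative of) the Virasoro field applied to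
`x_(-α-1) y_(-1) 1`. -/
theorem IsCurrentPair.normalOrder_vir_vir (h : A.IsCurrentPair x y w k lx ly) {a : V}
    {um up : ℕ → ℂ} (i α κ : ℕ)
    (hum : ∀ s : ℕ, A.nth (-1 - s) a = um s • A.vir (-2 - i - s))
    (hup : ∀ s : ℕ, A.nth s a = up s • A.vir (s - 1 - i)) (hup0 : ∀ s : ℕ, s < i → up s = 0)
    {M : ℤ} (hM : M = α + κ + 2 * i + 6) :
    ∑ s ∈ Finset.range (κ + 2), um s * um (κ + 1 - s) *
      A.pt₄ (A.ev φ) (A.vir (-(i + 2 + s))) (A.vir (-(κ + 3 + i - s))) (A.nth (-(α + 1)) x)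
        (A.nth (-1) y) +
    2 * ((∑ j ∈ Finset.range (α + 2), up (i + j) * um (κ + 2 + i + j) *
          ((α + 1) * (α + 2 - j))) * A.pt₂ (A.ev φ) (A.nth (-M) x) (A.nth (-1) y) +
      up (i + (α + 1)) * um (κ + 2 + i + (α + 1)) * ((α + 1) *
        A.pt₂ (A.ev φ ∘ₗ diagAdd (A.nth (-1) x)) (A.vir (-(M - 1))) (A.nth (-1) y)) +
      up (i + (α + 2)) * um (κ + 2 + i + (α + 2)) *
        ((α + 1) * A.pt₂ (A.ev φ) (A.vir (-M)) (A.nth (-1) w) +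
        lx * (α + 2) * (α + 1) * A.pt₂ (A.ev φ) (A.vir (-M)) (A.nth (-1) y)) +
      up i * um (κ + 2 + i) * (leftCoeff (κ + 2 * i + 2) (α + 2) *
          A.pt₂ (A.ev φ) (A.vir (-M)) (A.nth (-1) w) +
        2 * rightCoeff (κ + 2 * i + 5) (α + 1) *
          A.pt₂ (A.ev φ) (A.nth (-M) x) (A.nth (-1) y)) +
      up (i + 1) * um (κ + 2 + i + 1) * (leftCoeff (κ + 2 * i + 3) α *
        A.pt₂ (A.ev φ ∘ₗ diagAdd (A.nth (-1) y)) (A.vir (-(M - 1))) (A.nth (-1) x) +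
        rightCoeff (κ + 2 * i + 5) (α + 1) *
          A.pt₂ (A.ev φ) (A.nth (-M) x) (A.nth (-1) y) +
        leftCoeff (κ + 2 * i + 3) (α + 1) * A.pt₂ (A.ev φ) (A.vir (-M)) (A.nth (-1) w)) +
      up (i + 2) * um (κ + 2 + i + 2) * (2 * ly * (leftCoeff (κ + 2 * i + 4) α *
        A.pt₂ (A.ev φ) (A.vir (-M)) (A.nth (-1) x)))) = 0 := by
  have hρ := isInvariant_ev (A := A) (φ := φ)
  have hNO := A.ev_normalOrder φ a a
    (diagSub (A.nth (-(α + 1)) x) (diagSub (A.nth (-1) y) A.vac₂)) (n := -(κ + 2)) (by lia)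
    (κ + 2 + (i + (α + 4)))
    (fun m hm => by
      lift m to ℕ using by lia
      rw [hup, map_smul, LinearMap.smul_apply,
        h.diagSub_vir_nth_eq_zero (by lia) (by lia), smul_zero])
    (fun m hm => by
      lift m to ℕ using by lia
      rw [hup, map_smul, LinearMap.smul_apply,
        h.diagSub_vir_nth_eq_zero (by lia) (by lia), smul_zero])
  have e1 : ∀ j : ℕ, A.pt₄ (A.ev φ) (A.vir (-(κ + 4 + 2 * i + j))) (A.vir (j - 1))
      (A.nth (-(α + 1)) x) (A.nth (-1) y) =
      (if j < α + 2 then (α + 1) * (α + 2 - j) *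
        A.pt₂ (A.ev φ) (A.nth (-M) x) (A.nth (-1) y) else 0) +
      (if j = α + 1 then (α + 1) *
        A.pt₂ (A.ev φ ∘ₗ diagAdd (A.nth (-1) x)) (A.vir (-(M - 1))) (A.nth (-1) y) else 0) +
      (if j = α + 2 then (α + 1) * A.pt₂ (A.ev φ) (A.vir (-M)) (A.nth (-1) w) +
        lx * (α + 2) * (α + 1) * A.pt₂ (A.ev φ) (A.vir (-M)) (A.nth (-1) y) else 0) +
      (if j = 0 then leftCoeff (κ + 2 * i + 2) (α + 2) *
          A.pt₂ (A.ev φ) (A.vir (-M)) (A.nth (-1) w) +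
        2 * rightCoeff (κ + 2 * i + 5) (α + 1) *
          A.pt₂ (A.ev φ) (A.nth (-M) x) (A.nth (-1) y) else 0) +
      (if j = 1 then leftCoeff (κ + 2 * i + 3) α *
        A.pt₂ (A.ev φ ∘ₗ diagAdd (A.nth (-1) y)) (A.vir (-(M - 1))) (A.nth (-1) x) +
        rightCoeff (κ + 2 * i + 5) (α + 1) *
          A.pt₂ (A.ev φ) (A.nth (-M) x) (A.nth (-1) y) +
        leftCoeff (κ + 2 * i + 3) (α + 1) * A.pt₂ (A.ev φ) (A.vir (-M)) (A.nth (-1) w) else 0) +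
      (if j = 2 then 2 * ly * (leftCoeff (κ + 2 * i + 4) α *
        A.pt₂ (A.ev φ) (A.vir (-M)) (A.nth (-1) x)) else 0) := by
    intro j
    rw [hρ.pt₄_vir_vir_nth h (by lia) (by lia) (by lia)]
    refine congrArg₂ (· + ·) (congrArg₂ (· + ·) (congrArg₂ (· + ·) (congrArg₂ (· + ·)
      (congrArg₂ (· + ·)
      (ite_zero_congr (by lia) fun ht => ?_) (ite_zero_congr (by lia) fun ht => ?_))
      (ite_zero_congr (by lia) fun ht => ?_)) (ite_zero_congr (by lia) fun ht => ?_))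
      (ite_zero_congr (by lia) fun ht => ?_)) (ite_zero_congr (by lia) fun ht => ?_)
    · rw [show (j : ℤ) - 1 - (α + 1) - (κ + 4 + 2 * i + j) = -M by lia]
      push_cast
      ring
    · rw [show (κ + 4 + 2 * i + j : ℤ) = M - 1 by lia]
      push_cast
      ring
    · rw [show (κ + 4 + 2 * i + j : ℤ) = M by lia]
      push_cast
      ring
    · subst ht
      rw [hρ.pt₂_right h.left h.right (κ + 2 * i + 5) (M := M) (by push_cast; ring)
          (by push_cast; lia),
        hρ.pt₂_vir_left h.bracket (κ + 2 * i + 2) (α + 2) (M := M)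
          (m := -(κ + 4 + 2 * i + (0 : ℕ)))
          (m' := -(α + 1) - 2) (by push_cast; ring) (by push_cast; ring) (by push_cast; lia)]
      push_cast
      ring_nf
    · subst ht
      rw [hρ.pt₂_right h.left h.right (κ + 2 * i + 5) (M := M) (by push_cast; ring)
          (by push_cast; lia),
        hρ.pt₂_vir_left h.bracket (κ + 2 * i + 3) (α + 1) (M := M)
          (m := -(κ + 4 + 2 * i + (1 : ℕ)))
          (m' := -(α + 1) - 1) (by push_cast; ring) (by push_cast; ring) (by push_cast; lia),
        (hρ.comp y).pt₂_vir_left h.left (κ + 2 * i + 3) α (M := M - 1)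
          (m := -(κ + 4 + 2 * i + (1 : ℕ)))
          (m' := -(α + 1)) (by push_cast; ring) (by ring) (by push_cast; lia)]
      push_cast
      ring_nf
    · subst ht
      rw [hρ.pt₂_vir_left h.left (κ + 2 * i + 4) α (M := M)
          (m := -(κ + 4 + 2 * i + (2 : ℕ)))
          (m' := -(α + 1)) (by push_cast; ring) (by ring) (by push_cast; lia)]
  have e2 : ∀ j : ℕ, A.ev φ (diagSub (A.nth (-(κ + 2) - 1 - (i + j : ℕ)) a)
      (diagSub (A.nth (i + j : ℕ) a)
        (diagSub (A.nth (-(α + 1)) x) (diagSub (A.nth (-1) y) A.vac₂)))) =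
      up (i + j) * um (κ + 2 + i + j) * A.pt₄ (A.ev φ) (A.vir (-(κ + 4 + 2 * i + j)))
        (A.vir (j - 1)) (A.nth (-(α + 1)) x) (A.nth (-1) y) := by
    intro t
    rw [hup, show (-(κ + 2) - 1 - ((i + t : ℕ) : ℤ)) = -1 - (κ + 2 + i + t : ℕ) by push_cast; ring,
      hum]
    simp only [map_smul, LinearMap.smul_apply, smul_eq_mul, pt₄]
    rw [show (-2 - (i : ℤ) - (κ + 2 + i + t : ℕ)) = -(κ + 4 + 2 * i + t) by push_cast; ring,
      show (((i + t : ℕ) : ℤ) - 1 - i) = t - 1 by push_cast; ring]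
    ring
  have e3 : ∀ T : ℕ, ∑ s ∈ Finset.range (i + T),
      A.ev φ (diagSub (A.nth (-(κ + 2) - 1 - s) a) (diagSub (A.nth s a)
        (diagSub (A.nth (-(α + 1)) x) (diagSub (A.nth (-1) y) A.vac₂)))) =
      ∑ j ∈ Finset.range T, up (i + j) * um (κ + 2 + i + j) *
        A.pt₄ (A.ev φ) (A.vir (-(κ + 4 + 2 * i + j))) (A.vir (j - 1)) (A.nth (-(α + 1)) x)
          (A.nth (-1) y) := by
    intro T
    rw [Finset.sum_range_add, Finset.sum_eq_zero (fun s hs => ?_), zero_add]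
    · exact Finset.sum_congr rfl fun j _ => e2 j
    · rw [hup s, hup0 s (Finset.mem_range.1 hs), zero_smul]
      simp
  have e4 : ∀ s ∈ Finset.range (κ + 2), A.ev φ (diagSub (A.nth (-1 - s) a)
      (diagSub (A.nth (-(κ + 2) + s) a)
        (diagSub (A.nth (-(α + 1)) x) (diagSub (A.nth (-1) y) A.vac₂)))) =
      um s * um (κ + 1 - s) *
        A.pt₄ (A.ev φ) (A.vir (-(i + 2 + s))) (A.vir (-(κ + 3 + i - s))) (A.nth (-(α + 1)) x)
          (A.nth (-1) y) := by
    intro s hs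
    rw [Finset.mem_range] at hs
    rw [hum, show (-(κ + 2) + (s : ℤ)) = -1 - (κ + 1 - s : ℕ) by lia, hum]
    simp only [map_smul, LinearMap.smul_apply, smul_eq_mul, pt₄]
    rw [show (-2 - (i : ℤ) - s) = -(i + 2 + s) by ring,
      show (-2 - (i : ℤ) - (κ + 1 - s : ℕ)) = -(κ + 3 + i - s) by lia]
    ring
  -- As both fields are equal, the tail of the first half, from s = κ+2 on, repeats the second half;
  -- this is the factor 2 in the statement.
  have e5 : ∀ s : ℕ, A.ev φ (diagSub (A.nth (-1 - (κ + 2 + s : ℕ)) a)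
      (diagSub (A.nth (-(κ + 2) + (κ + 2 + s : ℕ)) a)
        (diagSub (A.nth (-(α + 1)) x) (diagSub (A.nth (-1) y) A.vac₂)))) =
      A.ev φ (diagSub (A.nth (-(κ + 2) - 1 - s) a) (diagSub (A.nth s a)
        (diagSub (A.nth (-(α + 1)) x) (diagSub (A.nth (-1) y) A.vac₂)))) := by
    intro s
    rw [show (-1 - ((κ + 2 + s : ℕ) : ℤ)) = -(κ + 2) - 1 - s by push_cast; ring,
      show (-(κ + 2) + ((κ + 2 + s : ℕ) : ℤ)) = s by push_cast; ring]
  have e6 := fun (T : ℕ) (hT : α + 4 ≤ T) =>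
    sum_mul_ite (fun j : ℕ => up (i + j) * um (κ + 2 + i + j))
      (fun j : ℕ => ((α : ℂ) + 1) * (α + 2 - j)) (N := T) (n := α + 2) (a₁ := α + 1)
      (a₂ := α + 2) (a₃ := 0) (a₄ := 1) (a₅ := 2)
      (h := by lia) (h₁ := by lia) (h₂ := by lia) (h₃ := by lia) (h₄ := by lia) (h₅ := by lia)
  rw [Finset.sum_range_add, Finset.sum_congr rfl fun s _ => e5 s, e3,
    show κ + 2 + (i + (α + 4)) = i + (κ + α + 6) by ring, e3,
    Finset.sum_congr rfl e4] at hNO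
  simp only [e1] at hNO
  rw [e6 _ le_rfl, e6 _ (by lia)] at hNO
  rw [← hNO]
  simp only [add_zero]
  ring

end Relations

end VertexOperatorAlgebra

/-! ### The relations for ω, its derivative, and derivatives of a current -/

namespace VertexOperatorAlgebra

variable {V : Type*} [AddCommGroup V] [Module ℂ V] {A : VertexOperatorAlgebra V}

section Relations

variable {x y w : V} {k lx ly : ℂ} {φ : Module.Dual ℂ (orbifold V ⧸ A.orbifoldC2)}

theorem prod_range_add_div_factorial (α s : ℕ) :
    (∏ i ∈ Finset.range α, ((s : ℂ) + 1 + i)) / α.factorial =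
      (∏ i ∈ Finset.range s, ((α : ℂ) + 1 + i)) / s.factorial := by
  have h : ∀ m n : ℕ, (n.factorial : ℂ) * ∏ i ∈ Finset.range m, ((n : ℂ) + 1 + i) =
      (n + m).factorial := by
    intro m n
    rw [← Nat.factorial_mul_ascFactorial, Nat.ascFactorial_eq_prod_range]
    push_cast
    rfl
  rw [div_eq_div_iff (by exact_mod_cast α.factorial_ne_zero)
    (by exact_mod_cast s.factorial_ne_zero), mul_comm, h, mul_comm, h, add_comm]

theorem nth_neg_nth_vac (x : V) (α s : ℕ) :
    A.nth (-1 - s) (A.nth (-1 - α) x A.vac) =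
      ((∏ i ∈ Finset.range s, ((α : ℂ) + 1 + i)) / s.factorial) • A.nth (-1 - α - s) x := by
  rw [nth_nth_vac, ← prod_range_add_div_factorial]
  congr 1
  · congr 1
    refine Finset.prod_congr rfl fun i _ => ?_
    push_cast
    ring
  · congr 1
    ring_nf

/-- The sign (-1)^α, absent for the creating modes, is what makes the final relations depend on the
parity of α. -/
theorem nth_add_nth_vac (x : V) (α s : ℕ) :
    A.nth (α + s) (A.nth (-1 - α) x A.vac) =
      ((-1) ^ α * ((∏ i ∈ Finset.range s, ((α : ℂ) + 1 + i)) / s.factorial)) • A.nth s x := by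
  rw [nth_nth_vac, ← prod_range_add_div_factorial, ← mul_div_assoc]
  congr 1
  · congr 1
    rw [← Finset.prod_range_reflect]
    have : ((-1 : ℂ) ^ α) = ∏ i ∈ Finset.range α, (-1 : ℂ) := by simp
    rw [this, ← Finset.prod_mul_distrib]
    refine Finset.prod_congr rfl fun i hi => ?_
    rw [Finset.mem_range] at hi
    rw [show α - 1 - i = α - (1 + i) by lia, Nat.cast_sub (by lia)]
    push_cast
    ring
  · congr 1
    ring_nf

theorem nth_nth_vac_eq_zero (x : V) {α s : ℕ} (h : s < α) :
    A.nth s (A.nth (-1 - α) x A.vac) = 0 := by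
  rw [nth_nth_vac, Finset.prod_eq_zero (Finset.mem_range.2 h) (by simp), zero_div, zero_smul]

theorem nth_neg_omega (s : ℕ) :
    A.nth (-1 - s) A.omega = (1 : ℂ) • A.vir (-2 - (0 : ℕ) - s) := by
  rw [vir, one_smul]
  congr 1
  push_cast
  ring_nf

theorem nth_natCast_omega (s : ℕ) :
    A.nth s A.omega = (1 : ℂ) • A.vir (s - 1 - (0 : ℕ)) := by
  rw [vir, one_smul]
  congr 1
  push_cast
  ring_nf

theorem nth_neg_translation_omega (s : ℕ) :
    A.nth (-1 - s) (A.nth 0 A.omega A.omega) = ((s : ℂ) + 1) • A.vir (-2 - (1 : ℕ) - s) := by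
  rw [vir, nth_translation]
  congr 1
  · push_cast
    ring
  · congr 1
    push_cast
    ring_nf

theorem nth_natCast_translation_omega (s : ℕ) :
    A.nth s (A.nth 0 A.omega A.omega) = (-s : ℂ) • A.vir (s - 1 - (1 : ℕ)) := by
  rw [vir, nth_translation]
  congr 1
  congr 1
  push_cast
  ring_nf

theorem sum_range_sub (N : ℕ) (c : ℂ) :
    ∑ j ∈ Finset.range N, (c - j) = N * (2 * c - N + 1) / 2 := by
  induction N with
  | zero => simp
  | succ N ih =>
    rw [Finset.sum_range_succ, ih]
    push_cast
    ring

theorem sum_range_mul_sub (N : ℕ) (c K : ℂ) :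
    ∑ j ∈ Finset.range N, (1 + j) * (K + j) * (c - j) =
      N * (N + 1) * ((2 * N + 3 * K - 2) * c / 6 -
        (N - 1) * ((N + 2) / 4 + (K - 2) / 3)) := by
  induction N with
  | zero => simp
  | succ N ih =>
    rw [Finset.sum_range_succ, ih]
    push_cast
    ring

variable (φ) in
theorem IsCurrentPair.omega_omega (h : A.IsCurrentPair x y w k lx ly) (α κ : ℕ)
    {M : ℤ} (hM : M = α + κ + 6) :
    ∑ s ∈ Finset.range (κ + 2),
      A.pt₄ (A.ev φ) (A.vir (-(2 + s))) (A.vir (-(κ + 3 - s))) (A.nth (-(α + 1)) x)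
        (A.nth (-1) y) +
    2 * ((α + 1) * (α + 2) * (α + 3) / 2 * A.pt₂ (A.ev φ) (A.nth (-M) x) (A.nth (-1) y) +
      (α + 1) *
        A.pt₂ (A.ev φ ∘ₗ diagAdd (A.nth (-1) x)) (A.vir (-(M - 1))) (A.nth (-1) y) +
      ((α + 1) * A.pt₂ (A.ev φ) (A.vir (-M)) (A.nth (-1) w) +
        lx * (α + 2) * (α + 1) * A.pt₂ (A.ev φ) (A.vir (-M)) (A.nth (-1) y)) +
      (leftCoeff (κ + 2) (α + 2) * A.pt₂ (A.ev φ) (A.vir (-M)) (A.nth (-1) w) +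
        2 * rightCoeff (κ + 5) (α + 1) * A.pt₂ (A.ev φ) (A.nth (-M) x) (A.nth (-1) y)) +
      (leftCoeff (κ + 3) α *
        A.pt₂ (A.ev φ ∘ₗ diagAdd (A.nth (-1) y)) (A.vir (-(M - 1))) (A.nth (-1) x) +
        rightCoeff (κ + 5) (α + 1) * A.pt₂ (A.ev φ) (A.nth (-M) x) (A.nth (-1) y) +
        leftCoeff (κ + 3) (α + 1) * A.pt₂ (A.ev φ) (A.vir (-M)) (A.nth (-1) w)) +
      2 * ly * (leftCoeff (κ + 4) α * A.pt₂ (A.ev φ) (A.vir (-M)) (A.nth (-1) x))) = 0 := by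
  have h0 := h.normalOrder_vir_vir (φ := φ) 0 α κ (a := A.omega) (um := fun _ => 1)
    (up := fun _ => 1) nth_neg_omega nth_natCast_omega (by simp) (M := M) (by push_cast; lia)
  simp only [Nat.cast_zero, zero_add, mul_zero, add_zero, one_mul, ← Finset.mul_sum,
    sum_range_sub] at h0
  push_cast at h0
  linear_combination h0

variable (φ) in
theorem IsCurrentPair.translation_omega_omega (h : A.IsCurrentPair x y w k lx ly) (α κ : ℕ)
    {M : ℤ} (hM : M = α + κ + 8) :
    ∑ s ∈ Finset.range (κ + 2), ((s : ℂ) + 1) * ((κ + 1 - s : ℕ) + 1) *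
      A.pt₄ (A.ev φ) (A.vir (-(3 + s))) (A.vir (-(κ + 4 - s))) (A.nth (-(α + 1)) x)
        (A.nth (-1) y) +
    2 * (-((α + 1) * (α + 2) * (α + 3) * (α + 4) * (α + 2 * κ + 9) / 12) *
        A.pt₂ (A.ev φ) (A.nth (-M) x) (A.nth (-1) y) -
      (α + 2) * (α + κ + 5) * (α + 1) *
        A.pt₂ (A.ev φ ∘ₗ diagAdd (A.nth (-1) x)) (A.vir (-(M - 1))) (A.nth (-1) y) -
      (α + 3) * (α + κ + 6) * ((α + 1) * A.pt₂ (A.ev φ) (A.vir (-M)) (A.nth (-1) w) +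
        lx * (α + 2) * (α + 1) * A.pt₂ (A.ev φ) (A.vir (-M)) (A.nth (-1) y)) -
      (κ + 4) * (leftCoeff (κ + 4) (α + 2) * A.pt₂ (A.ev φ) (A.vir (-M)) (A.nth (-1) w) +
        2 * rightCoeff (κ + 7) (α + 1) * A.pt₂ (A.ev φ) (A.nth (-M) x) (A.nth (-1) y)) -
      2 * (κ + 5) * (leftCoeff (κ + 5) α *
        A.pt₂ (A.ev φ ∘ₗ diagAdd (A.nth (-1) y)) (A.vir (-(M - 1))) (A.nth (-1) x) +
        rightCoeff (κ + 7) (α + 1) * A.pt₂ (A.ev φ) (A.nth (-M) x) (A.nth (-1) y) +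
        leftCoeff (κ + 5) (α + 1) * A.pt₂ (A.ev φ) (A.vir (-M)) (A.nth (-1) w)) -
      3 * (κ + 6) *
        (2 * ly * (leftCoeff (κ + 6) α * A.pt₂ (A.ev φ) (A.vir (-M)) (A.nth (-1) x)))) = 0 := by
  have h0 := h.normalOrder_vir_vir (φ := φ) 1 α κ (a := A.nth 0 A.omega A.omega)
    (um := fun s => s + 1) (up := fun s => -s) nth_neg_translation_omega
    nth_natCast_translation_omega (by simp) (M := M) (by push_cast; lia)
  have hS : ∑ j ∈ Finset.range (α + 2), (-((1 + j : ℕ) : ℂ)) * ((κ + 2 + 1 + j : ℕ) + 1) *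
      ((α + 1) * (α + 2 - j)) =
      -((α + 1) * ((α + 2) * (α + 3) * (α + 4) * (α + 2 * κ + 9) / 12)) := by
    have h1 := sum_range_mul_sub (α + 2) (α + 2) (κ + 4)
    have h2 : ∀ j ∈ Finset.range (α + 2), (-((1 + j : ℕ) : ℂ)) * ((κ + 2 + 1 + j : ℕ) + 1) *
      ((α + 1) * (α + 2 - j)) = -(α + 1) * ((1 + j) * ((κ + 4) + j) * ((α + 2) - j)) := by
      intro j _
      push_cast
      ring
    rw [Finset.sum_congr rfl h2, ← Finset.mul_sum, h1]
    push_cast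
    ring
  rw [hS] at h0
  simp only [Nat.cast_one, mul_one, show κ + 2 + 5 = κ + 7 by rfl, show κ + 2 + 2 = κ + 4 by rfl,
    show κ + 2 + 3 = κ + 5 by rfl, show κ + 2 + 4 = κ + 6 by rfl] at h0
  have e1 : ∀ s : ℕ, (-(1 + 2 + s : ℤ)) = -(3 + s) := fun s => by ring
  have e2 : ∀ s : ℕ, (-(κ + 3 + 1 - s : ℤ)) = -(κ + 4 - s) := fun s => by ring
  simp only [e1, e2] at h0
  push_cast at h0 ⊢
  linear_combination h0

variable (φ) in
theorem IsCurrentPair.omega_nth (h : A.IsCurrentPair x y w k lx ly) (α c : ℕ)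
    {M : ℤ} (hM : M = α + c + 6) {B : ℕ → ℂ}
    (hB : ∀ s, B s = (∏ i ∈ Finset.range s, ((α : ℂ) + 1 + i)) / s.factorial) :
    B 1 *
      (A.pt₄ (A.ev φ) (A.vir (-2)) (A.vir (-(c + 2))) (A.nth (-(α + 2)) x) (A.nth (-1) y) -
        (α + 2) * (α + c + 4) * A.pt₂ (A.ev φ) (A.nth (-M) x) (A.nth (-1) y)) +
    B 0 *
      (A.pt₄ (A.ev φ) (A.vir (-3)) (A.vir (-(c + 2))) (A.nth (-(α + 1)) x) (A.nth (-1) y) -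
        (α + 1) * (α + c + 3) * A.pt₂ (A.ev φ) (A.nth (-M) x) (A.nth (-1) y)) +
    (-1) ^ α * ((∑ t ∈ Finset.range (c + 2), B t * (t * (c + 2 - t))) *
        A.pt₂ (A.ev φ) (A.nth (-M) x) (A.nth (-1) y) +
      B (c + 1) * ((c + 1) *
        A.pt₂ (A.ev φ ∘ₗ diagAdd (A.nth (-1) x)) (A.vir (-(M - 1))) (A.nth (-1) y)) +
      B (c + 2) * ((c + 2) * A.pt₂ (A.ev φ) (A.vir (-M)) (A.nth (-1) w) -
        lx * (c + 2) * (c + 1) * A.pt₂ (A.ev φ) (A.vir (-M)) (A.nth (-1) y)) +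
      B 0 * (rightCoeff c (α + 3) *
        A.pt₂ (A.ev φ ∘ₗ diagAdd (A.nth (-1) w)) (A.vir (-(M - 2))) (A.vir (-2)) +
        (rightCoeff (c + 2) (α + 3) + leftCoeff c (α + 4)) *
          A.pt₂ (A.ev φ) (A.vir (-M)) (A.nth (-1) w)) +
      B 1 * (2 * k * (rightCoeff c (α + 4) *
        A.pt₂ (A.ev φ) (A.vir (-(M - 1))) (A.vir (-2))))) +
    ((∑ j ∈ Finset.range (c + 3), B (j + 2) * (-(α + 3 + j) * (j + c + 1))) *
        A.pt₂ (A.ev φ) (A.nth (-M) x) (A.nth (-1) y) +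
      B (c + 3) * ((2 * c + 2) *
        A.pt₂ (A.ev φ ∘ₗ diagAdd (A.vir (-2))) (A.nth (-(M - 2)) x) (A.nth (-1) y)) +
      B (c + 5) * ((2 * (c + 2) +
        A.centralCharge * ((c + 2) ^ 3 - (c + 2)) / 6) *
          A.pt₂ (A.ev φ) (A.nth (-M) x) (A.nth (-1) y)) +
      B 2 * (leftCoeff c (α + 4) * A.pt₂ (A.ev φ) (A.vir (-M)) (A.nth (-1) w) +
        2 * rightCoeff (c + 3) (α + 3) * A.pt₂ (A.ev φ) (A.nth (-M) x) (A.nth (-1) y)) +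
      B 3 * (leftCoeff c (α + 3) *
        A.pt₂ (A.ev φ ∘ₗ diagAdd (A.nth (-1) y)) (A.vir (-(M - 1))) (A.nth (-1) x) +
        leftCoeff c (α + 4) * A.pt₂ (A.ev φ) (A.vir (-M)) (A.nth (-1) w) +
        rightCoeff (c + 2) (α + 4) * A.pt₂ (A.ev φ) (A.nth (-M) x) (A.nth (-1) y)) +
      B 4 * (2 * ly * (leftCoeff c (α + 4) *
        A.pt₂ (A.ev φ) (A.vir (-M)) (A.nth (-1) x)))) = 0 := by
  have h0 := h.normalOrder_vir_nth (φ := φ) (i := 0) (by norm_num) α c (a := A.omega)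
    (b := A.nth (-1 - α) x A.vac) (um := fun _ => 1) (up := fun _ => 1) (vm := B)
    (vp := fun s => (-1) ^ α * B s) nth_neg_omega nth_natCast_omega (by simp)
    (fun s => by rw [hB, nth_neg_nth_vac]) (fun s => by rw [hB, nth_add_nth_vac])
    (fun s hs => nth_nth_vac_eq_zero x hs) (M := M) (by push_cast; lia)
  have e1 : ∀ t, 2 + t = t + 2 := fun t => add_comm _ _
  simp only [Nat.cast_zero, zero_add, add_zero, one_mul, mul_one, e1, mul_assoc ((-1) ^ α : ℂ),
    ← Finset.mul_sum, Nat.reduceAdd, show c + 1 + 2 = c + 3 by rfl,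
    show c + 3 + 2 = c + 5 by rfl] at h0
  linear_combination h0

variable (φ) in
theorem IsCurrentPair.translation_omega_nth (h : A.IsCurrentPair x y w k lx ly) (α c : ℕ)
    {M : ℤ} (hM : M = α + c + 7) {B : ℕ → ℂ}
    (hB : ∀ s, B s = (∏ i ∈ Finset.range s, ((α : ℂ) + 1 + i)) / s.factorial) :
    B 1 *
      (A.pt₄ (A.ev φ) (A.vir (-3)) (A.vir (-(c + 2))) (A.nth (-(α + 2)) x) (A.nth (-1) y) -
        (α + 2) * (α + c + 4) * A.pt₂ (A.ev φ) (A.nth (-M) x) (A.nth (-1) y)) +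
    2 * B 0 *
      (A.pt₄ (A.ev φ) (A.vir (-4)) (A.vir (-(c + 2))) (A.nth (-(α + 1)) x) (A.nth (-1) y) -
        (α + 1) * (α + c + 3) * A.pt₂ (A.ev φ) (A.nth (-M) x) (A.nth (-1) y)) +
    (-1) ^ α * ((∑ t ∈ Finset.range (c + 2), (α + 3 + t) * B t * (t * (c + 2 - t))) *
        A.pt₂ (A.ev φ) (A.nth (-M) x) (A.nth (-1) y) +
      (α + c + 4) * B (c + 1) * ((c + 1) *
        A.pt₂ (A.ev φ ∘ₗ diagAdd (A.nth (-1) x)) (A.vir (-(M - 1))) (A.nth (-1) y)) +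
      (α + c + 5) * B (c + 2) * ((c + 2) * A.pt₂ (A.ev φ) (A.vir (-M)) (A.nth (-1) w) -
        lx * (c + 2) * (c + 1) * A.pt₂ (A.ev φ) (A.vir (-M)) (A.nth (-1) y)) +
      (α + 3) * B 0 * (rightCoeff c (α + 4) *
        A.pt₂ (A.ev φ ∘ₗ diagAdd (A.nth (-1) w)) (A.vir (-(M - 2))) (A.vir (-2)) +
        (rightCoeff (c + 2) (α + 4) + leftCoeff c (α + 5)) *
          A.pt₂ (A.ev φ) (A.vir (-M)) (A.nth (-1) w)) +
      (α + 4) * B 1 * (2 * k * (rightCoeff c (α + 5) *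
        A.pt₂ (A.ev φ) (A.vir (-(M - 1))) (A.vir (-2))))) -
    ((∑ j ∈ Finset.range (c + 3), (j + 1) * B (j + 3) * (-(α + 4 + j) * (j + c + 1))) *
        A.pt₂ (A.ev φ) (A.nth (-M) x) (A.nth (-1) y) +
      (c + 2) * B (c + 4) * ((2 * c + 2) *
        A.pt₂ (A.ev φ ∘ₗ diagAdd (A.vir (-2))) (A.nth (-(M - 2)) x) (A.nth (-1) y)) +
      (c + 4) * B (c + 6) * ((2 * (c + 2) +
        A.centralCharge * ((c + 2) ^ 3 - (c + 2)) / 6) *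
          A.pt₂ (A.ev φ) (A.nth (-M) x) (A.nth (-1) y)) +
      B 3 * (leftCoeff c (α + 5) * A.pt₂ (A.ev φ) (A.vir (-M)) (A.nth (-1) w) +
        2 * rightCoeff (c + 3) (α + 4) * A.pt₂ (A.ev φ) (A.nth (-M) x) (A.nth (-1) y)) +
      2 * B 4 * (leftCoeff c (α + 4) *
        A.pt₂ (A.ev φ ∘ₗ diagAdd (A.nth (-1) y)) (A.vir (-(M - 1))) (A.nth (-1) x) +
        leftCoeff c (α + 5) * A.pt₂ (A.ev φ) (A.vir (-M)) (A.nth (-1) w) +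
        rightCoeff (c + 2) (α + 5) * A.pt₂ (A.ev φ) (A.nth (-M) x) (A.nth (-1) y)) +
      3 * B 5 * (2 * ly * (leftCoeff c (α + 5) *
        A.pt₂ (A.ev φ) (A.vir (-M)) (A.nth (-1) x)))) = 0 := by
  have h0 := h.normalOrder_vir_nth (φ := φ) (i := 1) le_rfl α c (a := A.nth 0 A.omega A.omega)
    (b := A.nth (-1 - α) x A.vac) (um := fun s => s + 1) (up := fun s => -s) (vm := B)
    (vp := fun s => (-1) ^ α * B s) nth_neg_translation_omega
    nth_natCast_translation_omega (by simp)
    (fun s => by rw [hB, nth_neg_nth_vac]) (fun s => by rw [hB, nth_add_nth_vac])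
    (fun s hs => nth_nth_vac_eq_zero x hs) (M := M) (by push_cast; lia)
  have e1 : ∑ t ∈ Finset.range (c + 2), (((α + 2 + t : ℕ) : ℂ) + 1) * ((-1) ^ α * B t) *
      (t * (c + 2 - t)) =
      (-1) ^ α * ∑ t ∈ Finset.range (c + 2), (α + 3 + t) * B t * (t * (c + 2 - t)) := by
    rw [Finset.mul_sum]
    refine Finset.sum_congr rfl fun t _ => ?_
    push_cast
    ring
  have e2 : ∑ j ∈ Finset.range (c + 3), B (1 + 2 + j) * (-((1 + j : ℕ) : ℂ)) *
      (-(α + 3 + (1 : ℕ) + j) * (j + c + 1)) =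
      -∑ j ∈ Finset.range (c + 3), (j + 1) * B (j + 3) * (-(α + 4 + j) * (j + c + 1)) := by
    rw [← Finset.sum_neg_distrib]
    refine Finset.sum_congr rfl fun j _ => ?_
    rw [show 1 + 2 + j = j + 3 by ring]
    push_cast
    ring
  rw [e1, e2] at h0
  simp only [show 1 + 2 + (c + 1) = c + 4 by ring, show 1 + 2 + (c + 3) = c + 6 by ring,
    show α + 1 + 4 = α + 5 by rfl, show α + 1 + 3 = α + 4 by rfl, Nat.reduceAdd] at h0
  norm_num [add_assoc] at h0
  norm_num [add_assoc]
  linear_combination h0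

end Relations

end VertexOperatorAlgebra

/-! ### Elimination of four-point functions and vanishing of two-point functions -/

namespace VertexOperatorAlgebra

variable {V : Type*} [AddCommGroup V] [Module ℂ V] {A : VertexOperatorAlgebra V}

section Relations

variable {x y w : V} {k lx ly : ℂ} {φ : Module.Dual ℂ (orbifold V ⧸ A.orbifoldC2)}

-- Seven relations of the same total weight involve only four four-point functions of creating
-- modes, up to exchange of the two Virasoro modes.
set_option maxHeartbeats 4000000 in
theorem IsCurrentPair.relation_even (h : A.IsCurrentPair x y w k lx ly) {α : ℕ} (hα : Even α)
    {M : ℤ} (hM : M = α + 8) :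
    -(8 / 105) * ((α : ℂ) + 6) * (α + 4) * (α + 2) * (α + 1) * α *
        ((α + 1) ^ 2 + 13 * (α + 1) + 79 / 2) * A.pt₂ (A.ev φ) (A.nth (-M) x) (A.nth (-1) y) +
      4 / 3 * (α + 6) * (α + 4) * (α + 2) * α * A.pt₂ (A.ev φ) (A.vir (-M)) (A.nth (-1) w) =
      0 := by
  have hρ := isInvariant_ev (A := A) (φ := φ)
  have h1 := h.translation_omega_omega φ α 0 (M := M) (by push_cast; lia)
  have h2 := h.omega_omega φ (α + 1) 1 (M := M) (by push_cast; lia)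
  have h3 := h.omega_omega φ (α + 2) 0 (M := M) (by push_cast; lia)
  have h4 := h.omega_nth φ α 2 (M := M) (by push_cast; lia) (fun _ => rfl)
  have h5 := h.translation_omega_nth φ α 1 (M := M) (by push_cast; lia) (fun _ => rfl)
  have h6 := h.translation_omega_nth φ (α + 1) 0 (M := M) (by push_cast; lia) (fun _ => rfl)
  have h7 := h.omega_nth φ (α + 1) 1 (M := M) (by push_cast; lia) (fun _ => rfl)
  have hε : (-1 : ℂ) ^ α = 1 := hα.neg_one_pow
  have c32 := hρ.pt₄_vir_vir_comm (P := 3) (q := 2) (by norm_num) (by norm_num) x y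
  have c42 := hρ.pt₄_vir_vir_comm (P := 4) (q := 2) (by norm_num) (by norm_num) x y
  have c43 := hρ.pt₄_vir_vir_comm (P := 4) (q := 3) (by norm_num) (by norm_num) x y
  simp only [Finset.sum_range_succ, Finset.sum_range_zero, Finset.prod_range_succ,
    Finset.prod_range_zero, leftCoeff, rightCoeff, Nat.factorial, Nat.succ_eq_add_one,
    Nat.reduceMul, pow_add, hε, Nat.cast_add, Nat.cast_zero, Nat.cast_one, Nat.cast_ofNat,
    zero_add, add_assoc, Int.reduceAdd, Int.reduceNeg, Int.reduceSub, sub_zero, Nat.reduceAdd,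
    add_zero, Nat.reduceSub, c32, c42, c43] at h1 h2 h3 h4 h5 h6 h7
  -- The four-point functions carry (L_{-4}, L_{-3}, x_(-α-1)), (L_{-4}, L_{-2}, x_(-α-2)), (L_{-3},
  -- L_{-3}, x_(-α-2)) and (L_{-3}, L_{-2}, x_(-α-3)). These coefficients cancel each of them, and
  -- also all insertions and the terms in k, `lx`, `ly` and the central charge.
  linear_combination h1 + 2 * (α + 1) * h2 + (α + 1) * (α + 2) * h3 - 2 * h4 - h5 -
    (α + 1) * (h6 + h7)

-- The same elimination with the total weight raised by one.
set_option maxHeartbeats 4000000 in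
theorem IsCurrentPair.relation_even' (h : A.IsCurrentPair x y w k lx ly) {α : ℕ} (hα : Even α)
    {M : ℤ} (hM : M = α + 9) :
    4 / 15 * ((α : ℂ) + 10) * (α + 8) * (α + 6) * (α + 4) * (α + 2) * (α + 1) * A.pt₂ (A.ev φ) (A.nth (-M) x) (A.nth (-1) y) +
      -(8 / 3) * (α + 6) * (α + 4) ^ 2 * (α + 2) * A.pt₂ (A.ev φ) (A.vir (-M)) (A.nth (-1) w) = 0 := by
  have hρ := isInvariant_ev (A := A) (φ := φ)
  have h1 := h.translation_omega_omega φ α 1 (M := M) (by push_cast; lia)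
  have h2 := h.omega_omega φ (α + 1) 2 (M := M) (by push_cast; lia)
  have h3 := h.omega_omega φ (α + 2) 1 (M := M) (by push_cast; lia)
  have h4 := h.omega_nth φ α 3 (M := M) (by push_cast; lia) (fun _ => rfl)
  have h5 := h.translation_omega_nth φ α 2 (M := M) (by push_cast; lia) (fun _ => rfl)
  have h6 := h.translation_omega_nth φ (α + 1) 1 (M := M) (by push_cast; lia) (fun _ => rfl)
  have h7 := h.omega_nth φ (α + 1) 2 (M := M) (by push_cast; lia) (fun _ => rfl)
  have hε : (-1 : ℂ) ^ α = 1 := hα.neg_one_pow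
  have c42 := hρ.pt₄_vir_vir_comm (P := 4) (q := 2) (by norm_num) (by norm_num) x y
  have c43 := hρ.pt₄_vir_vir_comm (P := 4) (q := 3) (by norm_num) (by norm_num) x y
  have c52 := hρ.pt₄_vir_vir_comm (P := 5) (q := 2) (by norm_num) (by norm_num) x y
  have c53 := hρ.pt₄_vir_vir_comm (P := 5) (q := 3) (by norm_num) (by norm_num) x y
  simp only [Finset.sum_range_succ, Finset.sum_range_zero, Finset.prod_range_succ,
    Finset.prod_range_zero, leftCoeff, rightCoeff, Nat.factorial, Nat.succ_eq_add_one,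
    Nat.reduceMul, pow_add, hε, Nat.cast_add, Nat.cast_zero, Nat.cast_one, Nat.cast_ofNat,
    zero_add, add_assoc, Int.reduceAdd, Int.reduceNeg, Int.reduceSub, sub_zero, Nat.reduceAdd,
    add_zero, Nat.reduceSub, c42, c43, c52, c53] at h1 h2 h3 h4 h5 h6 h7
  -- Six four-point functions cancel: Virasoro modes (-5,-3), (-4,-4) with x_(-α-1), (-5,-2),
  -- (-4,-3) with x_(-α-2), and (-4,-2), (-3,-3) with x_(-α-3).
  linear_combination h1 + 3 * (α + 1) * h2 + (α + 1) * (α + 2) * h3 - 6 * h4 - 2 * h5 -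
    (α + 1) * (h6 + 2 * h7)

set_option maxHeartbeats 4000000 in
theorem IsCurrentPair.relation_odd (h : A.IsCurrentPair x y w k lx ly) {α : ℕ} (hα : Odd α)
    {M : ℤ} (hM : M = α + 9) :
    4 / 15 * ((α : ℂ) + 11) * (α + 7) * (α + 5) * (α + 4) * (α + 3) * (α + 1) * A.pt₂ (A.ev φ) (A.nth (-M) x) (A.nth (-1) y) +
      8 / 3 * (α + 7) * (α + 5) * (α + 3) * (α + 1) * A.pt₂ (A.ev φ) (A.vir (-M)) (A.nth (-1) w) = 0 := by
  have hρ := isInvariant_ev (A := A) (φ := φ)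
  have h1 := h.translation_omega_omega φ α 1 (M := M) (by push_cast; lia)
  have h2 := h.omega_omega φ (α + 1) 2 (M := M) (by push_cast; lia)
  have h3 := h.omega_omega φ (α + 2) 1 (M := M) (by push_cast; lia)
  have h4 := h.omega_nth φ α 3 (M := M) (by push_cast; lia) (fun _ => rfl)
  have h5 := h.translation_omega_nth φ α 2 (M := M) (by push_cast; lia) (fun _ => rfl)
  have h6 := h.translation_omega_nth φ (α + 1) 1 (M := M) (by push_cast; lia) (fun _ => rfl)
  have h7 := h.omega_nth φ (α + 1) 2 (M := M) (by push_cast; lia) (fun _ => rfl)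
  have hε : (-1 : ℂ) ^ α = -1 := hα.neg_one_pow
  have c42 := hρ.pt₄_vir_vir_comm (P := 4) (q := 2) (by norm_num) (by norm_num) x y
  have c43 := hρ.pt₄_vir_vir_comm (P := 4) (q := 3) (by norm_num) (by norm_num) x y
  have c52 := hρ.pt₄_vir_vir_comm (P := 5) (q := 2) (by norm_num) (by norm_num) x y
  have c53 := hρ.pt₄_vir_vir_comm (P := 5) (q := 3) (by norm_num) (by norm_num) x y
  simp only [Finset.sum_range_succ, Finset.sum_range_zero, Finset.prod_range_succ,
    Finset.prod_range_zero, leftCoeff, rightCoeff, Nat.factorial, Nat.succ_eq_add_one,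
    Nat.reduceMul, pow_add, hε, Nat.cast_add, Nat.cast_zero, Nat.cast_one, Nat.cast_ofNat,
    zero_add, add_assoc, Int.reduceAdd, Int.reduceNeg, Int.reduceSub, sub_zero, Nat.reduceAdd,
    add_zero, Nat.reduceSub, c42, c43, c52, c53] at h1 h2 h3 h4 h5 h6 h7
  linear_combination h1 + 3 * (α + 1) * h2 + (α + 1) * (α + 2) * h3 - 6 * h4 - 2 * h5 -
    (α + 1) * (h6 + 2 * h7)


/-- The two operators commute under the bracket because their total mode is at most -2; translating
the mode M from y back to x costs a sign for each of the M-1 steps. -/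
theorem IsCurrentPair.pt₂_swap_eq (h : A.IsCurrentPair x y w k lx ly) {M : ℕ} (hM : 1 ≤ M) :
    A.pt₂ (A.ev φ) (A.nth (-M) y) (A.nth (-1) x) =
      (-1) ^ (M + 1) * A.pt₂ (A.ev φ) (A.nth (-M) x) (A.nth (-1) y) := by
  have hρ := isInvariant_ev (A := A) (φ := φ)
  obtain ⟨j, rfl⟩ := Nat.exists_eq_add_of_le' hM
  rw [← hρ.pt₂_comm h (by push_cast; lia), hρ.pt₂_right h.left h.right j
    (M := (j + 1 : ℕ)) (by push_cast; ring) (by push_cast; ring), rightCoeff]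
  have h1 : ∏ i ∈ Finset.range j, (-((-1 : ℤ) : ℂ) + i) = j.factorial := by
    rw [← Finset.prod_range_add_one_eq_factorial]
    push_cast
    exact Finset.prod_congr rfl fun i _ => by ring
  rw [h1, div_self (by exact_mod_cast j.factorial_ne_zero)]
  ring

theorem IsCurrentPair.pt₂_eq_zero (h : A.IsCurrentPair x y w k lx ly) {M : ℕ} (hM : 9 ≤ M) :
    A.pt₂ (A.ev φ) (A.nth (-M) x) (A.nth (-1) y) = 0 := by
  have hneg : ∀ f : Module.End ℂ V,
      A.pt₂ (A.ev φ) f (A.nth (-1) (-w)) = -A.pt₂ (A.ev φ) f (A.nth (-1) w) := by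
    simp [pt₂]
  rcases Nat.even_or_odd M with hpar | hpar
  · obtain ⟨α, rfl⟩ := Nat.exists_eq_add_of_le' hM
    have hα : Odd α := by
      rw [Nat.even_add] at hpar
      rw [← Nat.not_even_iff_odd, hpar]
      decide
    have h1 := h.relation_odd (φ := φ) hα (M := (α + 9 : ℕ)) (by push_cast; ring)
    have h2 := h.relation_even (φ := φ) hα.add_one (M := (α + 9 : ℕ)) (by push_cast; ring)
    push_cast at h1 h2
    -- The coefficients of the w term are in ratio 2 : 1, so `h1` minus twice `h2` removes it. What
    -- is left is written with natural numbers to make its positivity visible.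
    have h3 : (((α + 7 : ℕ) : ℂ) * (α + 5 : ℕ) * (α + 3 : ℕ) * (α + 1 : ℕ)) *
        ((28 * (α + 11 : ℕ) * (α + 4 : ℕ) + 8 * (α + 2 : ℕ) *
          (2 * (α + 2) ^ 2 + 26 * (α + 2) + 79 : ℕ) : ℕ)) *
        A.pt₂ (A.ev φ) (A.nth (-(α + 9 : ℕ)) x) (A.nth (-1) y) = 0 := by
      push_cast
      linear_combination 105 * h1 - 210 * h2
    refine (mul_eq_zero.1 h3).resolve_left ?_
    norm_cast
  · obtain ⟨α, rfl⟩ := Nat.exists_eq_add_of_le' hM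
    have hα : Even α := by
      rw [Nat.odd_add] at hpar
      exact Nat.not_odd_iff_even.1 fun h => absurd (hpar.1 h) (by decide)
    have h1 := h.relation_even' (φ := φ) hα (M := (α + 9 : ℕ)) (by push_cast; ring)
    have h2 := h.symm.relation_even' (φ := φ) hα (M := (α + 9 : ℕ)) (by push_cast; ring)
    rw [h.pt₂_swap_eq (by lia), hpar.add_one.neg_one_pow, hneg] at h2
    -- For odd M the two-point function is symmetric in x and y while w changes sign, so adding the
    -- two relations removes w.
    have h3 : ((((α + 10) * (α + 8) * (α + 6) * (α + 4) * (α + 2) * (α + 1) : ℕ)) : ℂ) *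
        A.pt₂ (A.ev φ) (A.nth (-(α + 9 : ℕ)) x) (A.nth (-1) y) = 0 := by
      push_cast at h1 h2 ⊢
      linear_combination 15 / 8 * (h1 + h2)
    refine (mul_eq_zero.1 h3).resolve_left ?_
    norm_cast

/-- The two-point functions of currents of large weight vanish on coinvariants. -/
theorem IsCurrentPair.coinv_eq_zero (h : A.IsCurrentPair x y w k lx ly) {M : ℕ} (hM : 9 ≤ M) :
    A.coinv (diagSub (A.nth (-M) x) (diagSub (A.nth (-1) y) A.vac₂)) = 0 :=
  (Module.forall_dual_apply_eq_zero_iff ℂ _).1 fun _ => h.pt₂_eq_zero hM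

end Relations

end VertexOperatorAlgebra

namespace VertexOperatorAlgebra

variable {V : Type*} [AddCommGroup V] [Module ℂ V] (A : VertexOperatorAlgebra V)

/-! ### Words in the modes of currents -/

theorem etaBar_nth_vac (a : V) {n : ℤ} (hn : n ≤ -2) : A.etaBar (A.nth n a A.vac) = 0 := by
  have h := A.isInvariant_coinv.nth a n (A.vac ⊗ₜ A.vac) hn
  rw [diagAdd_tmul, map_add, A.coinv_tmul_comm A.vac, ← two_smul ℂ, coinv_tmul_vac] at h
  exact (smul_eq_zero.1 h).resolve_left two_ne_zero

theorem etaBar_translation (a : V) : A.etaBar (A.nth 0 A.omega a) = 0 := by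
  rw [translation, etaBar_nth_vac _ _ le_rfl]

theorem etaBar_nth_neg_one_comm (a b : V) :
    A.etaBar (A.nth (-1) a b) = A.etaBar (A.nth (-1) b a) := by
  obtain ⟨M, hM⟩ := A.exists_nth_eq_zero a b
  have h := A.nth_comm_sum (M := M) (fun i hi => hM i (by exact_mod_cast hi)) A.vac (-1) (-1)
  rw [nth_neg_one_vac, nth_neg_one_vac] at h
  rw [← sub_eq_zero, ← map_sub, h, map_sum]
  refine Finset.sum_eq_zero fun i _ => ?_
  rw [map_zsmul, A.etaBar_nth_vac _ (by lia), smul_zero]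

theorem coinv_nth_tmul (a b c : V) {n : ℤ} (hn : n ≤ -2) :
    A.coinv (A.nth n a b ⊗ₜ c) = -A.coinv (b ⊗ₜ A.nth n a c) := by
  have h := A.isInvariant_coinv.nth a n (b ⊗ₜ c) hn
  rw [diagAdd_tmul, map_add] at h
  exact eq_neg_of_add_eq_zero_left h

/-- Apply D⁺a_(-1) to b⊗1: since ⟨b⊗1⟩ = 0, so is ⟨a_(-1)b⊗1⟩ + ⟨b⊗a⟩. -/
theorem coinv_nth_neg_one_tmul {b : V} (hb : A.etaBar b = 0) (a : V) :
    A.etaBar (A.nth (-1) a b) = -A.coinv (b ⊗ₜ a) := by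
  have h := A.coinv_diagAdd_neg_one (e := b ⊗ₜ A.vac) (by rw [coinv_tmul_vac, hb]) a
  rw [diagAdd_tmul, map_add, coinv_tmul_vac, nth_neg_one_vac] at h
  exact eq_neg_of_add_eq_zero_left h

variable {A} in
theorem IsCFTType.etaBar_nth_nth_vac (hA : A.IsCFTType) {x y : V} (hx : x ∈ A.weightSpace 1)
    (hy : y ∈ A.weightSpace 1) {m : ℤ} (hm : m ≤ -9) (j : ℕ) :
    A.etaBar (A.nth m x (A.nth (-1 - j) y A.vac)) = 0 := by
  obtain ⟨k, lx, ly, h⟩ := hA.isCurrentPair hx hy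
  induction j generalizing m with
  | zero =>
    obtain ⟨M, rfl⟩ : ∃ M : ℕ, m = -M := ⟨(-m).toNat, by lia⟩
    have h0 := h.coinv_eq_zero (M := M) (by lia)
    have h1 := A.coinv_nth_tmul x A.vac y (n := -M) (by lia)
    rw [A.coinv_tmul_comm A.vac, coinv_tmul_vac] at h1
    simp only [vac₂, diagSub_tmul, map_sub, nth_neg_one_vac] at h0
    rw [coinv_tmul_vac, A.coinv_tmul_comm y, h1, A.coinv_tmul_comm A.vac, coinv_tmul_vac] at h0
    -- Each of the four terms of D⁻x_(-M) (y⊗1 − 1⊗y) contributes η̄(x_(-M)y) once; the mixed ones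
    -- do so after x_(-M) is moved to the other factor.
    have h2 : (4 : ℂ) • A.etaBar (A.nth (-M) x y) = 0 := by
      rw [← h0]
      module
    simpa [nth_neg_one_vac] using h2
  | succ j ih =>
    -- Apply η̄ to L_{-1} x_(m) y_(-1-j) 1, which gives zero. The term with x_(m-1) vanishes by
    -- induction, and j+1 times the wanted term remains.
    have h1 := h.left.translation m
    have h2 := h.right.translation (-1 - j)
    have e1 := LinearMap.congr_fun h1 (A.nth (-1 - j) y A.vac)
    have e2 := LinearMap.congr_fun h2 A.vac
    have hv : A.vir (-1) A.vac = 0 := A.nth_vac _ _ (by norm_num)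
    simp only [LinearMap.sub_apply, Module.End.mul_apply, LinearMap.smul_apply, hv, map_zero,
      sub_zero] at e1 e2
    rw [e2, map_smul] at e1
    have e3 := congrArg A.etaBar e1
    rw [map_sub, map_smul, map_smul, ih (by lia), smul_zero,
      show A.etaBar (A.vir (-1) _) = 0 from A.etaBar_translation _, zero_sub, neg_eq_zero] at e3
    rw [show (-1 - ((j + 1 : ℕ) : ℤ)) = -1 - j - 1 by push_cast; ring]
    refine (smul_eq_zero.1 e3).resolve_left ?_
    push_cast
    rw [neg_sub, sub_neg_eq_add]
    exact_mod_cast j.succ_ne_zero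

/-- The word `x^1_(n_1) x^2_(n_2) ⋯ 1`. -/
def word (l : List (V × ℤ)) : V := (l.map fun p => A.nth p.2 p.1).prod A.vac

/-- All letters have weight one and the modes are negative on average by a margin. -/
structure IsDeep (l : List (V × ℤ)) : Prop where
  mem : ∀ p ∈ l, p.1 ∈ A.weightSpace 1
  sum_le : (l.map Prod.snd).sum ≤ -(9 * l.length + 1)

variable {A}

theorem IsDeep.perm {l l' : List (V × ℤ)} (h : A.IsDeep l) (hl : l.Perm l') : A.IsDeep l' where
  mem p hp := h.mem p (hl.mem_iff.2 hp)
  sum_le := by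
    rw [← (hl.map Prod.snd).sum_eq, ← hl.length_eq]
    exact h.sum_le

section Words

variable {s : ℕ}

/-- The commutator yields a word shorter by one, with the letter x_(0)y, and possibly one shorter by
two. The sum of modes is unchanged while the required bound relaxes, so both are deep and vanish by
induction. -/
theorem IsCFTType.etaBar_word_swap (hA : A.IsCFTType)
    (ih : ∀ l, l.length < s → A.IsDeep l → A.etaBar (A.word l) = 0) {l₁ l₂ : List (V × ℤ)}
    {p q : V × ℤ} (hl : A.IsDeep (l₁ ++ p :: q :: l₂)) (hs : (l₁ ++ p :: q :: l₂).length = s) :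
    A.etaBar (A.word (l₁ ++ p :: q :: l₂)) = A.etaBar (A.word (l₁ ++ q :: p :: l₂)) := by
  have hp := hl.mem p (by simp)
  have hq := hl.mem q (by simp)
  obtain ⟨k, hk⟩ := hA.exists_comm hp hq
  have h1 : A.word (l₁ ++ p :: q :: l₂) = A.word (l₁ ++ q :: p :: l₂) +
      A.word (l₁ ++ (A.nth 0 p.1 q.1, p.2 + q.2) :: l₂) +
      if p.2 + q.2 = 0 then (p.2 * k) • A.word (l₁ ++ l₂) else 0 := by
    have h2 := sub_eq_iff_eq_add'.1 (hk p.2 q.2)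
    simp only [word, List.map_append, List.prod_append, List.map_cons, List.prod_cons]
    rw [← mul_assoc (A.nth p.2 p.1), h2]
    split_ifs <;>
    simp [add_mul, mul_add, mul_assoc, LinearMap.add_apply, add_assoc]
  have hsum := hl.sum_le
  simp only [List.map_append, List.map_cons, List.sum_append, List.sum_cons, List.length_append,
    List.length_cons] at hsum hs
  rw [h1, map_add, map_add, ih (l₁ ++ (A.nth 0 p.1 q.1, p.2 + q.2) :: l₂)
    (by simp only [List.length_append, List.length_cons]; lia) ⟨?_, ?_⟩, add_zero]
  · split_ifs with h0
    · rw [map_smul, ih (l₁ ++ l₂) (by simp only [List.length_append]; lia) ⟨?_, ?_⟩, smul_zero,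
        add_zero]
      · intro r hr
        exact hl.mem r (by simp at hr ⊢; tauto)
      · simp only [List.map_append, List.sum_append, List.length_append]
        push_cast at hsum ⊢
        lia
    · rw [map_zero, add_zero]
  · intro r hr
    rw [List.mem_append, List.mem_cons] at hr
    rcases hr with hr | rfl | hr
    · exact hl.mem r (by simp [hr])
    · exact nth_zero_mem_weightSpace hp hq
    · exact hl.mem r (by simp [hr])
  · simp only [List.map_append, List.map_cons, List.sum_append, List.sum_cons, List.length_append,
      List.length_cons]
    push_cast at hsum ⊢
    lia

theorem IsCFTType.etaBar_word_perm (hA : A.IsCFTType)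
    (ih : ∀ l, l.length < s → A.IsDeep l → A.etaBar (A.word l) = 0) {l l' : List (V × ℤ)}
    (hll' : l.Perm l') (l₁ : List (V × ℤ)) (hl : A.IsDeep (l₁ ++ l))
    (hs : (l₁ ++ l).length = s) :
    A.etaBar (A.word (l₁ ++ l)) = A.etaBar (A.word (l₁ ++ l')) := by
  induction hll' generalizing l₁ with
  | nil => rfl
  | cons p _ ih' =>
    have := ih' (l₁ ++ [p]) (by simpa using hl) (by simpa using hs)
    simpa using this
  | swap p q l => exact hA.etaBar_word_swap ih hl hs
  | trans h₁ _ ih₁ ih₂ =>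
    rw [ih₁ l₁ hl hs, ih₂ l₁ (hl.perm (h₁.append_left l₁))
      (by rw [← (h₁.append_left l₁).length_eq, hs])]

theorem IsCFTType.etaBar_word_of_nonneg (hA : A.IsCFTType)
    (ih : ∀ l, l.length < s → A.IsDeep l → A.etaBar (A.word l) = 0) {l : List (V × ℤ)}
    (hl : A.IsDeep l) (hs : l.length = s) {p : V × ℤ} (hp : p ∈ l) (h0 : 0 ≤ p.2) :
    A.etaBar (A.word l) = 0 := by
  obtain ⟨l', hl'⟩ : ∃ l', l.Perm (l' ++ [p]) := by
    obtain ⟨l₁, l₂, rfl⟩ := List.append_of_mem hp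
    exact ⟨l₁ ++ l₂, List.perm_middle.trans (List.perm_append_singleton _ _).symm⟩
  have h := hA.etaBar_word_perm ih hl' [] hl hs
  simp only [List.nil_append] at h
  rw [h, word, List.map_append, List.prod_append, Module.End.mul_apply, List.map_singleton,
    List.prod_singleton, A.nth_vac _ _ h0, map_zero, map_zero]

theorem word_cons (p : V × ℤ) (l : List (V × ℤ)) :
    A.word (p :: l) = A.nth p.2 p.1 (A.word l) := by
  simp [word]

/-- The word `x_(m) y_(-1-j) v` agrees with `(x_(m) y_(-1-j) 1)_(-1) v`. -/
theorem IsCFTType.etaBar_nth_nth_nth (hA : A.IsCFTType)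
    (ih : ∀ l, l.length < s → A.IsDeep l → A.etaBar (A.word l) = 0) {l : List (V × ℤ)}
    {x y : V} {m : ℤ} {j : ℕ} (hl : A.IsDeep ((x, m) :: (y, -1 - j) :: l))
    (hs : l.length + 2 = s) :
    A.etaBar (A.nth (-1) (A.nth m x (A.nth (-1 - j) y A.vac)) (A.word l)) =
      A.etaBar (A.word ((x, m) :: (y, -1 - j) :: l)) := by
  have hsum := hl.sum_le
  simp only [List.map_cons, List.sum_cons, List.length_cons] at hsum
  push_cast at hsum
  have hx := hl.mem (x, m) (by simp)
  have hy := hl.mem (y, -1 - j) (by simp)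
  have hmem : ∀ p ∈ l, p.1 ∈ A.weightSpace 1 := fun p hp => hl.mem p (by simp [hp])
  have hxy : ∀ a b : ℤ, a + b = m + (-1 - j) → (0 ≤ a ∨ 0 ≤ b) →
      A.etaBar (A.nth a x (A.nth b y (A.word l))) = 0 := by
    intro a b hab h0
    have hd : A.IsDeep ((x, a) :: (y, b) :: l) := by
      refine ⟨?_, ?_⟩
      · intro p hp
        simp only [List.mem_cons] at hp
        rcases hp with rfl | rfl | hp
        exacts [hx, hy, hmem p hp]
      · simp only [List.map_cons, List.sum_cons, List.length_cons]
        push_cast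
        lia
    rw [← word_cons (y, b), ← word_cons (x, a)]
    rcases h0 with h0 | h0
    · exact hA.etaBar_word_of_nonneg ih hd (by simpa using hs) (p := (x, a)) (by simp) h0
    · exact hA.etaBar_word_of_nonneg ih hd (by simpa using hs) (p := (y, b)) (by simp) h0
  have hyx : ∀ a b : ℤ, a + b = m + (-1 - j) → 0 ≤ a →
      A.etaBar (A.nth b y (A.nth a x (A.word l))) = 0 := by
    intro a b hab h0
    have hd : A.IsDeep ((y, b) :: (x, a) :: l) := by
      refine ⟨?_, ?_⟩
      · intro p hp
        simp only [List.mem_cons] at hp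
        rcases hp with rfl | rfl | hp
        exacts [hy, hx, hmem p hp]
      · simp only [List.map_cons, List.sum_cons, List.length_cons]
        push_cast
        lia
    rw [← word_cons (x, a), ← word_cons (y, b)]
    exact hA.etaBar_word_of_nonneg ih hd (by simpa using hs) (p := (x, a)) (by simp) h0
  -- Expand by associativity. Every term except x_(m) y_(-1-j) v contains a nonnegative mode of x or
  -- y, or has coefficient zero.
  rw [nth_assoc_finsum]
  obtain ⟨M₁, hM₁⟩ := A.exists_nth_eq_zero x (A.word l)
  obtain ⟨M₂, hM₂⟩ := A.exists_nth_eq_zero (A.nth (-1 - j) y A.vac) (A.word l)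
  rw [finsum_eq_sum_of_support_subset (s := Finset.range (M₁ + M₂ + 2)) _ fun i hi => ?_, map_sum,
    Finset.sum_eq_single 0]
  · rw [word_cons, word_cons]
    simp only [Nat.cast_zero, add_zero, sub_zero, pow_zero, Ring.choose_zero_right, one_mul,
      one_smul, map_sub, map_smul, nth_nth_vac, LinearMap.smul_apply]
    rw [hyx 0 _ (by ring) le_rfl, smul_zero, smul_zero, sub_zero]
    have h1 : (∏ i ∈ Finset.range j, ((i : ℂ) - (-1 : ℤ))) / j.factorial = 1 := by
      rw [div_eq_one_iff_eq (by exact_mod_cast j.factorial_ne_zero),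
        ← Finset.prod_range_add_one_eq_factorial]
      push_cast
      exact Finset.prod_congr rfl fun i _ => by ring
    rw [h1, one_smul]
  · intro i _ hi
    rw [map_zsmul, map_sub, map_smul, nth_nth_vac, nth_nth_vac]
    simp only [LinearMap.smul_apply, map_smul]
    rw [hyx i _ (by ring) (by lia)]
    -- The nonnegative modes of y_(-1-j)1 of index less than j vanish; those from j on are multiples
    -- of nonnegative modes of y.
    rcases lt_or_ge (i - 1) j with hij | hij
    · rw [Finset.prod_eq_zero (Finset.mem_range.2 hij)]
      · simp
      · rw [Nat.cast_sub (Nat.one_le_iff_ne_zero.2 hi)]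
        push_cast
        ring
    · rw [hxy (m - i) _ (by ring) (Or.inr (by lia))]
      simp
  · simp
  · by_contra hc
    have hi' : M₁ + M₂ + 2 ≤ i := by simpa using hc
    refine hi ?_
    dsimp only
    rw [hM₁ i (by lia), hM₂ (-1 + i) (by lia)]
    simp

theorem IsCFTType.etaBar_word (hA : A.IsCFTType) (l : List (V × ℤ)) (hl : A.IsDeep l) :
    A.etaBar (A.word l) = 0 := by
  induction hs : l.length using Nat.strong_induction_on generalizing l with
  | _ s IH =>
  have ih : ∀ l, l.length < s → A.IsDeep l → A.etaBar (A.word l) = 0 := fun l hls hl' =>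
    IH _ hls l hl' rfl
  by_cases hneg : ∃ p ∈ l, 0 ≤ p.2
  · obtain ⟨p, hp, h0⟩ := hneg
    exact hA.etaBar_word_of_nonneg ih hl hs hp h0
  push Not at hneg
  -- Pigeonhole: the modes average to less than -9.
  obtain ⟨p, hp, hp9⟩ : ∃ p ∈ l, p.2 ≤ -10 := by
    by_contra! hc
    have h1 := List.card_nsmul_le_sum (l.map Prod.snd) (-9) (by
      intro n hn
      obtain ⟨q, hq, rfl⟩ := List.mem_map.1 hn
      have := hc q hq
      lia)
    have h2 := hl.sum_le
    rw [List.length_map, nsmul_eq_mul] at h1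
    lia
  obtain ⟨l', hl'⟩ : ∃ l', l.Perm (p :: l') := by
    obtain ⟨l₁, l₂, rfl⟩ := List.append_of_mem hp
    exact ⟨l₁ ++ l₂, List.perm_middle⟩
  have e1 := hA.etaBar_word_perm ih hl' [] hl hs
  simp only [List.nil_append] at e1
  have hd := hl.perm hl'
  have hneg' : ∀ q ∈ p :: l', q.2 < 0 := fun q hq => hneg q (hl'.mem_iff.2 hq)
  rw [hl'.length_eq] at hs
  rw [e1]
  clear e1 hl' hneg hl hp l
  obtain ⟨x, m⟩ := p
  rcases l' with _ | ⟨⟨y, b⟩, l⟩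
  · rw [word_cons]
    exact A.etaBar_nth_vac x (by lia)
  obtain ⟨j, rfl⟩ : ∃ j : ℕ, b = -1 - j := ⟨(-1 - b).toNat, by
    have := hneg' (y, b) (by simp)
    lia⟩
  have hx := hd.mem (x, m) (by simp)
  have hy := hd.mem (y, -1 - j) (by simp)
  dsimp only at hp9 hx hy
  simp only [List.length_cons] at hs
  have hc := hA.etaBar_nth_nth_vac hx hy (m := m) (by lia) j
  have e1 := hA.etaBar_nth_nth_nth ih hd hs
  rw [← A.etaBar_nth_neg_one_comm, A.coinv_nth_neg_one_tmul hc, A.coinv_tmul_comm] at e1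
  have e2 := A.coinv_nth_tmul x (A.word l) (A.nth (-1 - j) y A.vac) (n := m) (by lia)
  have e3 := hA.etaBar_word_swap (l₁ := []) ih hd (by simpa using hs)
  simp only [List.nil_append] at e3
  have e4 : A.etaBar (A.word ((y, -1 - j) :: (x, m) :: l)) =
      -A.coinv (A.nth m x (A.word l) ⊗ₜ A.nth (-1 - j) y A.vac) := by
    rw [word_cons, word_cons]
    -- For j > 0 the mode of y is at most -2 and can be moved across the tensor sign directly. For j
    -- = 0 this needs η̄(x_(m)v) = 0, which holds by induction: dropping y_(-1) raises the sum by 1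
    -- and relaxes the bound by 9.
    rcases Nat.eq_zero_or_pos j with rfl | hj
    · simp only [Nat.cast_zero, sub_zero, nth_neg_one_vac]
      refine A.coinv_nth_neg_one_tmul ?_ y
      rw [← word_cons (x, m)]
      refine ih _ (by simp only [List.length_cons]; lia) ⟨?_, ?_⟩
      · intro q hq
        exact hd.mem q (by simp at hq ⊢; tauto)
      · have := hd.sum_le
        simp only [List.map_cons, List.sum_cons, List.length_cons] at this ⊢
        push_cast at this ⊢
        lia
    · rw [← A.coinv_tmul_vac, A.coinv_nth_tmul _ _ _ (by lia)]
  rw [e2, neg_neg] at e4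
  rw [e4] at e3
  rw [e3] at e1
  rw [e3]
  -- By `e1` and `e3` the class equals both -⟨v⊗c⟩ and ⟨v⊗c⟩, where c = x_(m) y_(-1-j) 1.
  refine (smul_eq_zero.1 ?_).resolve_left (two_ne_zero (α := ℂ))
  rw [two_smul]
  nth_rewrite 1 [← e1]
  exact neg_add_cancel _

end Words

theorem monomial_eq_word {r : ℕ} (A : VertexOperatorAlgebra V) (x : Fin r → V) (m : Fin r → ℕ) :
    A.monomial x m = A.word (List.ofFn fun i => (x i, -(m i : ℤ))) := by
  have (l : List (V × ℕ)) : l.foldr (fun p v => A.nth (-(p.2 : ℤ)) p.1 v) A.vac =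
      A.word (l.map fun p => (p.1, -(p.2 : ℤ))) := by
    induction l with
    | nil => simp [word]
    | cons p l ih => rw [List.foldr_cons, ih, List.map_cons, word_cons]
  rw [monomial, this, List.map_ofFn]
  rfl

end VertexOperatorAlgebra

theorem mainTheorem7 {V : Type*} [AddCommGroup V] [Module ℂ V] (A : VertexOperatorAlgebra V)
    (hsimple : A.IsSimple) (hCFT : A.IsCFTType)
    (r : ℕ) (x : Fin r → V) (hx : ∀ i, x i ∈ A.weightSpace 1) :
    ∃ N : ℕ, ∀ m : Fin r → ℕ, (∀ i, 1 ≤ m i) → N ≤ ∑ i, m i →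
      A.etaBar (A.monomial x m) = 0 := by
  -- This is the threshold in `IsDeep` for words of length r; it depends on r alone.
  refine ⟨9 * r + 1, fun m _ hm => ?_⟩
  rw [A.monomial_eq_word]
  refine hCFT.etaBar_word _ ⟨?_, ?_⟩
  · intro p hp
    obtain ⟨i, rfl⟩ := (List.mem_ofFn' _ _).1 hp
    exact hx i
  · rw [List.map_ofFn, List.sum_ofFn, List.length_ofFn]
    simp only [Function.comp_apply, Finset.sum_neg_distrib]
    have : ((9 * r + 1 : ℕ) : ℤ) ≤ ((∑ i, m i : ℕ) : ℤ) := by exact_mod_cast hm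
    push_cast at this
    lia
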